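/- Let $n\ge 1$, $\tau>0$, $\delta>0$, $\gamma>0$ with $\gamma\neq\frac1{4\tau}$, $s\in\mathbb R$, $j\in\{0,1,2\}$, and $n+2s+4+2j>0$. Consider on $\mathbb R^n$ the weakly damped Moore–Gibson–Thompson equation $$\tau\varphi_{ttt}+\varphi_{tt}-\Delta\varphi-(\delta+\tau)\Delta\varphi_t+\gamma\varphi_t=0\quad(t>0),\qquad (\varphi,\varphi_t,\varphi_{tt})|_{t=0}=(\varphi_0,\varphi_1,\varphi_2),$$ with data $\varphi_k\in H^{s+2-k}\cap L^1$ for $k=0,1,2$, and let $\varphi\in C([0,\infty),H^{s+2})\cap C^1([0,\infty),H^{s+1})\cap C^2([0,\infty),H^{s})$ be its Sobolev solution (the equation being understood in the sense of distributions). Put $$\Phi_0=\gamma\varphi_0+\varphi_1+\tau\varphi_2,\qquad P_{\Phi_0}=\int_{\mathbb R^n}\Phi_0\,dx,\qquad G(t,x)=\frac1\gamma\Big(\frac{\gamma}{4\pi t}\Big)^{n/2}e^{-\gamma|x|^2/(4t)},$$ so that $G(t,\cdot)$ is $\gamma^{-1}$ times the inverse Fourier transform of $e^{-|\xi|^2t/\gamma}$,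 and let $\|u\|_{\dot H^{r}}=\||D|^{r}u\|_{L^2}$. There are constants $C,c>0$ depending only on $n,\tau,\delta,\gamma,s,j$ such that, for all such data, the following hold. (i) If $n+2(s+2-j)>0$, then for all $t\ge 0$ $$\|\partial_t^j\varphi(t,\cdot)\|_{\dot H^{s+2-j}}\le C(1+t)^{-\frac{n+2s+4+2j}{4}}\,\|(\varphi_0,\varphi_1,\varphi_2)\|_{(H^{s+\max\{1,2-j\}}\cap L^1)\times(H^{s+1}\cap L^1)\times(H^{s}\cap L^1)},$$ and the same bound holds with the homogeneous Sobolev norms $\dot H$ of the data in place of the inhomogeneous ones. (ii) If $n+2(s+2-j)>0$, then, as $t\to\infty$, $$\big\|\partial_t^j\varphi(t,\cdot)-\partial_t^jG(t,\cdot)\,P_{\Phi_0}\big\|_{\dot H^{s+2-j}}=o\big(t^{-\frac{n+2s+4+2j}{4}}\big),\qquad \partial_t^jG=(-\gamma)^{-j}(-\Delta)^jG .$$ (iii) If $P_{\Phi_0}\neq0$, then for all sufficiently large $t$ (depending on the data) $$\|\partial_t^j\varphi(t,\cdot)\|_{\dot H^{s+2-j}}\ge c\,t^{-\frac{n+2s+4+2j}{4}}\,|P_{\Phi_0}|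 ,$$ where the left side is read as $+\infty$ if $\partial_t^j\varphi(t,\cdot)\notin\dot H^{s+2-j}$. -/

import Mathlib

open MeasureTheory Filter Topology
open scoped SchwartzMap FourierTransform Laplacian ENNReal

noncomputable section

/-- The Euclidean space `ℝⁿ`. -/
abbrev Rn (n : ℕ) : Type := EuclideanSpace ℝ (Fin n)

/-- The Fourier transform of the tempered distribution `u` is the function `g`
(in the convention `∫ exp (-2 π i x·ξ) u(x) dx`, so that `-Δ` has the symbol `(2 π |ξ|)²`). -/
def HasFourierFunction {n : ℕ} (u : 𝓢'(Rn n, ℂ)) (g : Rn n → ℂ) : Prop :=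
  ∀ θ : 𝓢(Rn n, ℂ), Integrable (fun ξ ↦ θ ξ * g ξ) ∧ (𝓕 u) θ = ∫ ξ, θ ξ * g ξ

/-- The norm `‖w û‖_{L²}`, for a weight `w` on the frequency side. Its value is `∞` if `û` is not a
function; if it is, the function is unique almost everywhere and the infimum is over one value. -/
def weightedFourierNorm {n : ℕ} (w : Rn n → ℝ) (u : 𝓢'(Rn n, ℂ)) : ℝ≥0∞ :=
  ⨅ (g : Rn n → ℂ) (_ : HasFourierFunction u g), eLpNorm (fun ξ ↦ (w ξ : ℂ) * g ξ) 2 volume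

/-- The inhomogeneous Sobolev norm `‖⟨D⟩^r u‖_{L²}` of order `r`. -/
def sobolevNorm {n : ℕ} (r : ℝ) (u : 𝓢'(Rn n, ℂ)) : ℝ≥0∞ :=
  weightedFourierNorm (fun ξ ↦ (1 + (2 * Real.pi * ‖ξ‖) ^ 2) ^ (r / 2)) u

/-- The homogeneous Sobolev norm `‖|D|^r u‖_{L²}` of order `r`. -/
def homSobolevNorm {n : ℕ} (r : ℝ) (u : 𝓢'(Rn n, ℂ)) : ℝ≥0∞ :=
  weightedFourierNorm (fun ξ ↦ (2 * Real.pi * ‖ξ‖) ^ r) u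

/-- `u ∈ C([0, ∞), H^r)`. -/
def ContinuousInSobolev {n : ℕ} (r : ℝ) (u : ℝ → 𝓢'(Rn n, ℂ)) : Prop :=
  ∀ t, 0 ≤ t → TemperedDistribution.MemSobolev r 2 (u t) ∧
    Tendsto (fun t' ↦ sobolevNorm r (u t' - u t)) (𝓝[Set.Ici 0] t) (𝓝 0)

/-- On `[0, ∞)`, `v` is the time derivative of `u`, as a limit of difference quotients in `H^r`
(one-sided at `t = 0`). -/
def HasTimeDerivInSobolev {n : ℕ} (r : ℝ) (u v : ℝ → 𝓢'(Rn n, ℂ)) : Prop :=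
  ∀ t, 0 ≤ t → Tendsto
    (fun t' ↦ sobolevNorm r ((((t' - t)⁻¹ : ℝ) : ℂ) • (u t' - u t) - v t))
    (𝓝[Set.Ici 0 \ {t}] t) (𝓝 0)

/-- `φ 0` is a Sobolev solution, in `C([0,∞), H^{s+2}) ∩ C¹([0,∞), H^{s+1}) ∩ C²([0,∞), H^s)`, of
`τ φ_ttt + φ_tt - Δφ - (δ + τ) Δφ_t + γ φ_t = 0` with the initial data `f 0`, `f 1`, `f 2`, and
`φ 1`, `φ 2` are its first two time derivatives. The equation holds for `t > 0` in the sense of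
distributions in `x`, that is, after pairing with every Schwartz function `θ`. -/
structure IsSobolevSolution {n : ℕ} (τ δ γ s : ℝ) (f : Fin 3 → 𝓢'(Rn n, ℂ))
    (φ : Fin 3 → ℝ → 𝓢'(Rn n, ℂ)) : Prop where
  cont : ∀ k : Fin 3, ContinuousInSobolev (s + 2 - (k : ℕ)) (φ k)
  deriv_zero : HasTimeDerivInSobolev (s + 1) (φ 0) (φ 1)
  deriv_one : HasTimeDerivInSobolev s (φ 1) (φ 2)
  equation : ∀ (θ : 𝓢(Rn n, ℂ)) (t : ℝ), 0 < t → ∃ d : ℂ,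
    HasDerivAt (fun r ↦ (φ 2 r) θ) d t ∧
      (τ : ℂ) * d + (φ 2 t) θ - (Δ (φ 0 t)) θ - ((δ + τ : ℝ) : ℂ) * (Δ (φ 1 t)) θ
        + (γ : ℂ) * (φ 1 t) θ = 0
  initial : ∀ k : Fin 3, φ k 0 = f k

/-- The data norm `‖(f 0, f 1, f 2)‖` in
`(X^{s + max(1, 2 - j)} ∩ L¹) × (X^{s + 1} ∩ L¹) × (X^s ∩ L¹)`,
where `N r` is the norm of `X^r` (homogeneous or inhomogeneous Sobolev). -/
def dataNorm {n : ℕ} (N : ℝ → 𝓢'(Rn n, ℂ) → ℝ≥0∞) (s : ℝ) (j : Fin 3)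
    (f : Fin 3 → Lp ℂ 1 (volume : Measure (Rn n))) : ℝ≥0∞ :=
  (N (s + max 1 (2 - ((j : ℕ) : ℝ))) (f 0 : 𝓢'(Rn n, ℂ)) + ‖f 0‖ₑ)
    + (N (s + 1) (f 1 : 𝓢'(Rn n, ℂ)) + ‖f 1‖ₑ)
    + (N s (f 2 : 𝓢'(Rn n, ℂ)) + ‖f 2‖ₑ)

/-- The Gaussian `G(t, x) = γ⁻¹ (γ / (4 π t))^{n/2} exp (-γ |x|² / (4 t))`, which is `γ⁻¹` times the
inverse Fourier transform of `exp (-t |ξ|² / γ)` (in the angular frequency `ξ`). -/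
def gaussianProfile (n : ℕ) (γ t : ℝ) (x : Rn n) : ℂ :=
  ((γ⁻¹ * (γ / (4 * Real.pi * t)) ^ ((n : ℝ) / 2) * Real.exp (-(γ * ‖x‖ ^ 2 / (4 * t))) : ℝ) : ℂ)

theorem memLp_gaussianProfile (n : ℕ) {γ t : ℝ} (hγ : 0 < γ) (ht : 0 < t) :
    MemLp (gaussianProfile n γ t) 1 volume := by
  rw [memLp_one_iff_integrable]
  have h := GaussianFourier.integrable_cexp_neg_mul_sq_norm_add (V := Rn n)
    (b := ((γ / (4 * t) : ℝ) : ℂ)) (by rw [Complex.ofReal_re]; positivity) 0 0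
  refine (h.const_mul
    ((γ⁻¹ * (γ / (4 * Real.pi * t)) ^ ((n : ℝ) / 2) : ℝ) : ℂ)).congr ?_
  filter_upwards with x
  simp only [gaussianProfile, Complex.ofReal_mul, Complex.ofReal_exp]
  congr 2
  push_cast
  ring

open Classical in
/-- The Gaussian `G(t, ·)` as a tempered distribution, for `t > 0` and `γ > 0`. -/
def gaussianDistribution (n : ℕ) (γ t : ℝ) : 𝓢'(Rn n, ℂ) :=
  if h : 0 < γ ∧ 0 < t then ((memLp_gaussianProfile n h.1 h.2).toLp (gaussianProfile n γ t) :
    Lp ℂ 1 (volume : Measure (Rn n))) else 0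

/-- `∂_t^j G(t, ·) = (-γ)^{-j} (-Δ)^j G(t, ·)`. -/
def diffusionProfile (n : ℕ) (γ : ℝ) (j : ℕ) (t : ℝ) : 𝓢'(Rn n, ℂ) :=
  (((-γ)⁻¹ ^ j : ℝ) : ℂ) • (fun u : 𝓢'(Rn n, ℂ) ↦ -Δ u)^[j] (gaussianDistribution n γ t)

/-- The moment `P_{Φ₀} = ∫ (γ φ₀ + φ₁ + τ φ₂) dx`. -/
def combinedMoment {n : ℕ} (τ γ : ℝ) (f : Fin 3 → Lp ℂ 1 (volume : Measure (Rn n))) : ℂ :=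
  ∫ x, ((γ : ℂ) * f 0 x + f 1 x + (τ : ℂ) * f 2 x)

/-- The rate `(n + 2 s + 4 + 2 j) / 4`. -/
def decayRate (n : ℕ) (s : ℝ) (j : Fin 3) : ℝ := (n + 2 * s + 4 + 2 * ((j : ℕ) : ℝ)) / 4

end

/-!
On the Fourier side the equation becomes, with `x = |2πξ|²`, the ordinary differential equation
`τ u''' + u'' + (γ + (δ + τ) x) u' + x u = 0`.

For `x` bounded away from `0`, an energy corrected by small multipliers decays exponentially at a
rate independent of `x`. For small `x` the characteristic polynomial has a root `-μ` with
`μ = x / γ + O(x²)`; dividing it out leaves a damped oscillator, so that `u` is `exp (-x t / γ)`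
times the limit amplitude `γ⁻¹ (γ u₀ + u₁ + τ u₂)` up to a relative error `O(x)` and exponentially
small terms. The `L²` norms of the resulting Gaussian weights scale as powers of `t`, and as
`t → ∞` they only see the amplitude at `ξ = 0`, which is `γ⁻¹ P_{Φ₀}`.

For the lower bound the weight `|ξ|^{s+2-j}` need not be square integrable near `0`. It is therefore
cut off at the diffusive scale `|ξ| ∼ t^{-1/2}`, where the Gaussian profile keeps a fixed proportion
of its norm.
-/

/-! ### Decay of oscillators and damped systems -/

section Lyapunov

theorem le_exp_neg_mul_of_deriv_le {F F' : ℝ → ℝ} {m : ℝ} (hF : ∀ t, HasDerivAt F (F' t) t)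
    (hF' : ∀ t, 0 ≤ t → F' t ≤ -m * F t) {t : ℝ} (ht : 0 ≤ t) :
    F t ≤ Real.exp (-m * t) * F 0 := by
  have hd (r : ℝ) : HasDerivAt (fun r ↦ Real.exp (m * r) * F r)
      (Real.exp (m * r) * (m * F r + F' r)) r :=
    (((hasDerivAt_id r).const_mul m).exp.mul (hF r)).congr_deriv (by simp only [id]; ring)
  have hanti : AntitoneOn (fun r ↦ Real.exp (m * r) * F r) (Set.Ici 0) :=
    antitoneOn_of_hasDerivWithinAt_nonpos (convex_Ici 0)
      (fun r _ ↦ (hd r).continuousAt.continuousWithinAt) (fun r _ ↦ (hd r).hasDerivWithinAt)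
      fun r hr ↦ mul_nonpos_of_nonneg_of_nonpos (Real.exp_pos _).le <| by
        linarith [hF' r (interior_subset hr)]
  have h := hanti Set.self_mem_Ici ht ht
  simp only [mul_zero, Real.exp_zero, one_mul] at h
  rwa [neg_mul, Real.exp_neg, inv_mul_eq_div, le_div_iff₀ (Real.exp_pos _), mul_comm]

theorem le_exp_neg_mul_of_lyapunov {E F F' : ℝ → ℝ} {m : ℝ} (hF : ∀ t, HasDerivAt F (F' t) t)
    (hm : 0 ≤ m) (hEF : ∀ t, E t ≤ 2 * F t) (hFE : ∀ t, F t ≤ 2 * E t)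
    (hF' : ∀ t, F' t ≤ -(2 * m) * E t) {t : ℝ} (ht : 0 ≤ t) :
    E t ≤ 4 * Real.exp (-m * t) * E 0 := by
  have h := le_exp_neg_mul_of_deriv_le (m := m) hF
    (fun r _ ↦ by linarith [hF' r, mul_le_mul_of_nonneg_left (hFE r) hm]) ht
  calc E t ≤ 2 * (Real.exp (-m * t) * F 0) := by linarith [hEF t]
    _ ≤ 2 * (Real.exp (-m * t) * (2 * E 0)) := by gcongr; exact hFE 0
    _ = _ := by ring

theorem eventually_mul_le (c : ℝ) {d : ℝ} (hd : 0 < d) : ∀ᶠ ε : ℝ in 𝓝[>] 0, ε * c ≤ d := by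
  have h : Tendsto (fun ε : ℝ ↦ ε * c) (𝓝[>] 0) (𝓝 0) :=
    ((continuous_mul_const c).tendsto' 0 0 (zero_mul c)).mono_left nhdsWithin_le_nhds
  exact (h.eventually_lt_const hd).mono fun _ ↦ le_of_lt

end Lyapunov

section DampedOscillator

variable {V : Type*} [NormedAddCommGroup V] [InnerProductSpace ℝ V]

theorem two_mul_abs_inner_le_add_sq (y z : V) : 2 * |inner ℝ y z| ≤ ‖y‖ ^ 2 + ‖z‖ ^ 2 := by
  linarith [abs_real_inner_le_norm y z, two_mul_le_add_sq ‖y‖ ‖z‖]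

/-- The multiplier `ε y` makes the dissipation `2 b |y'|²` of the energy `|y'|² + d |y|²` reach the
potential part of the energy. -/
theorem exists_oscillator_decay {b₀ b₁ d₀ : ℝ} (hb₀ : 0 < b₀) (hd₀ : 0 < d₀) :
    ∃ m : ℝ, 0 < m ∧ ∀ b d : ℝ, b₀ ≤ b → b ≤ b₁ → d₀ ≤ d → ∀ y z : ℝ → V,
      (∀ t, HasDerivAt y (z t) t) → (∀ t, HasDerivAt z (-(b • z t + d • y t)) t) →
      ∀ t, 0 ≤ t → ‖z t‖ ^ 2 + d * ‖y t‖ ^ 2 ≤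
        4 * Real.exp (-m * t) * (‖z 0‖ ^ 2 + d * ‖y 0‖ ^ 2) := by
  obtain ⟨ε, hε, hε₁, hε₂, hε₃, hε₄⟩ := (eventually_mem_nhdsWithin.and
    ((eventually_mul_le 4 hb₀).and ((eventually_mul_le (2 * b₁) hd₀).and
      ((eventually_mul_le 2 one_pos).and (eventually_mul_le 2 hd₀))))).exists
  rw [Set.mem_Ioi] at hε
  refine ⟨ε / 2, by positivity, fun b d hbl hbu hdl y z hy hz t ht ↦ ?_⟩
  have hb : 0 < b := hb₀.trans_le hbl
  refine le_exp_neg_mul_of_lyapunov (m := ε / 2)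
    (E := fun t ↦ ‖z t‖ ^ 2 + d * ‖y t‖ ^ 2)
    (F := fun t ↦ ‖z t‖ ^ 2 + d * ‖y t‖ ^ 2 + 2 * ε * inner ℝ (y t) (z t))
    (fun r ↦ ((hz r).norm_sq.add ((hy r).norm_sq.const_mul d)).add
      (((hy r).inner ℝ (hz r)).const_mul (2 * ε))) (by positivity) (fun r ↦ ?_) (fun r ↦ ?_)
    (fun r ↦ ?_) ht
  · have h := two_mul_abs_inner_le_add_sq (y r) (z r)
    nlinarith [neg_abs_le (inner ℝ (y r) (z r)), sq_nonneg ‖y r‖, sq_nonneg ‖z r‖]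
  · have h := two_mul_abs_inner_le_add_sq (y r) (z r)
    nlinarith [le_abs_self (inner ℝ (y r) (z r)), sq_nonneg ‖y r‖, sq_nonneg ‖z r‖]
  · simp only [inner_neg_right, inner_add_right, inner_smul_right, real_inner_self_eq_norm_sq,
      real_inner_comm (y r) (z r)]
    have hcross : -(2 * ε * b * inner ℝ (y r) (z r)) ≤ ε * d * ‖y r‖ ^ 2 + b / 2 * ‖z r‖ ^ 2 := by
      have := abs_real_inner_le_norm (y r) (z r)
      have := neg_abs_le (inner ℝ (y r) (z r))
      have hεb : 2 * ε * b ≤ d := by nlinarith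
      have : 2 * (ε * b * (‖y r‖ * ‖z r‖)) ≤ 2 * ε ^ 2 * b * ‖y r‖ ^ 2 + b / 2 * ‖z r‖ ^ 2 := by
        nlinarith [mul_nonneg hb.le (sq_nonneg (2 * ε * ‖y r‖ - ‖z r‖))]
      nlinarith [mul_pos hε hb, sq_nonneg ‖y r‖,
        mul_le_mul_of_nonneg_right hεb (mul_nonneg hε.le (sq_nonneg ‖y r‖))]
    nlinarith [sq_nonneg ‖z r‖]

end DampedOscillator

section HighFrequencyEnergy

variable {V : Type*} [NormedAddCommGroup V] [InnerProductSpace ℝ V]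

theorem two_mul_abs_correction_le {τ r ε ρ κ : ℝ} (hτ : 0 < τ) (hr : 0 < r) (hε : 0 ≤ ε)
    (hετ : ε * (1 + 2 * τ) ≤ r * τ) (hεκ : ε * 2 ≤ r * (τ * κ)) (hρ : r ≤ ρ) (a b p : V) :
    2 * |ε / ρ * (inner ℝ a p / τ - 2 * inner ℝ b p)| ≤
      ‖p‖ ^ 2 + ‖a‖ ^ 2 + τ * κ * ‖b‖ ^ 2 := by
  have hη : ε / ρ ≤ ε / r := by gcongr
  have hη₁ : ε / r * (1 / τ + 2) ≤ 1 := by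
    rw [div_mul_eq_mul_div, div_le_one hr, div_add' _ _ _ hτ.ne', ← mul_div_assoc,
      div_le_iff₀ hτ]
    exact hετ
  have hη₁' : ε / r * (1 / τ) ≤ ε / r * (1 / τ + 2) := by gcongr; linarith
  have hη₂ : ε / r * 2 ≤ τ * κ := by
    rwa [div_mul_eq_mul_div, div_le_iff₀ hr, mul_comm _ r]
  have hρ0 : 0 < ρ := hr.trans_le hρ
  have : 0 < 1 / τ := by positivity
  calc 2 * |ε / ρ * (inner ℝ a p / τ - 2 * inner ℝ b p)|
      ≤ 2 * (ε / ρ * (|inner ℝ a p| / τ + 2 * |inner ℝ b p|)) := by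
        rw [abs_mul, abs_of_nonneg (by positivity : 0 ≤ ε / ρ)]
        gcongr
        refine (abs_sub _ _).trans_eq ?_
        rw [abs_div, abs_of_pos hτ, abs_mul, abs_two]
    _ ≤ ε / r * (1 / τ * (2 * |inner ℝ a p|) +
          2 * (2 * |inner ℝ b p|)) := by
        rw [← mul_assoc, mul_comm 2, mul_assoc]
        gcongr
        exact (by ring : _ = _).le
    _ ≤ ε / r * (1 / τ * (‖a‖ ^ 2 + ‖p‖ ^ 2) + 2 * (‖b‖ ^ 2 + ‖p‖ ^ 2)) := by
        gcongr <;> exact two_mul_abs_inner_le_add_sq _ _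
    _ ≤ _ := by
        nlinarith [mul_le_mul_of_nonneg_right hη₁ (sq_nonneg ‖p‖),
          mul_le_mul_of_nonneg_right hη₂ (sq_nonneg ‖b‖),
          mul_le_mul_of_nonneg_right (hη₁'.trans hη₁) (sq_nonneg ‖a‖)]

theorem dissipation_le {τ r κ₀ κ₁ ε ρ κ : ℝ} (hτ : 0 < τ) (hr : 0 < r) (hκ₀ : 0 < κ₀)
    (hε : 0 ≤ ε) (hε₁ : ε * 4 ≤ 1)
    (hετ : ε * (2 / r ^ 2 + (2 * τ + κ₁) ^ 2 / 2) ≤ τ * κ₀ / 2) (hρ : r ≤ ρ) (hκl : κ₀ ≤ κ)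
    (hκu : κ ≤ κ₁) (a b p : V) :
    -2 * κ * ‖b‖ ^ 2 + ε / τ * (‖p‖ ^ 2 - ‖a‖ ^ 2 - κ * inner ℝ a b)
        - 2 * ε * (‖p‖ ^ 2 / τ - inner ℝ b p / (ρ * τ) - inner ℝ a b - κ * ‖b‖ ^ 2) ≤
      -(2 * (ε / (4 * τ))) * (‖p‖ ^ 2 + ‖a‖ ^ 2 + τ * κ * ‖b‖ ^ 2) := by
  have : 0 < κ := hκ₀.trans_le hκl
  have hbp : 2 * (inner ℝ b p / ρ) ≤ ‖p‖ ^ 2 / 2 + 2 / r ^ 2 * ‖b‖ ^ 2 := by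
    have hρ0 : 0 < ρ := hr.trans_le hρ
    have hinv : (‖b‖ / ρ) ^ 2 ≤ 1 / r ^ 2 * ‖b‖ ^ 2 := by
      rw [one_div_mul_eq_div, ← div_pow]
      gcongr
    have hcs : inner ℝ b p / ρ ≤ ‖b‖ / ρ * ‖p‖ := by
      rw [div_mul_eq_mul_div]
      gcongr
      exact real_inner_le_norm b p
    linear_combination 2 * hcs + (1 / 2) * sq_nonneg (‖p‖ - 2 * (‖b‖ / ρ)) + 2 * hinv
  have hab : (2 * τ - κ) * inner ℝ a b ≤ ‖a‖ ^ 2 / 2 + (2 * τ + κ₁) ^ 2 / 2 * ‖b‖ ^ 2 := by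
    have hcoeff : |2 * τ - κ| ≤ 2 * τ + κ₁ := abs_le.2 ⟨by linarith, by linarith⟩
    have hcs : (2 * τ - κ) * inner ℝ a b ≤ (2 * τ + κ₁) * (‖a‖ * ‖b‖) := by
      refine (le_abs_self _).trans ?_
      rw [abs_mul]
      exact mul_le_mul hcoeff (abs_real_inner_le_norm a b) (abs_nonneg _)
        ((abs_nonneg _).trans hcoeff)
    linear_combination hcs + (1 / 2) * sq_nonneg (‖a‖ - (2 * τ + κ₁) * ‖b‖)
  have hb : ε / τ * (2 / r ^ 2 + (2 * τ + κ₁) ^ 2 / 2) ≤ κ / 2 := by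
    rw [div_mul_eq_mul_div, div_le_iff₀ hτ]
    linarith [mul_le_mul_of_nonneg_left hκl hτ.le]
  have hdiff : 2 * ε * κ + ε / 2 * κ ≤ 3 / 2 * κ := by nlinarith
  have : 0 ≤ ε / τ := by positivity
  calc -2 * κ * ‖b‖ ^ 2 + ε / τ * (‖p‖ ^ 2 - ‖a‖ ^ 2 - κ * inner ℝ a b)
        - 2 * ε * (‖p‖ ^ 2 / τ - inner ℝ b p / (ρ * τ) - inner ℝ a b - κ * ‖b‖ ^ 2)
      = -2 * κ * ‖b‖ ^ 2 + 2 * ε * κ * ‖b‖ ^ 2 + ε / τ * (2 * (inner ℝ b p / ρ) +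
          (2 * τ - κ) * inner ℝ a b - ‖p‖ ^ 2 - ‖a‖ ^ 2) := by
        field_simp
        ring
    _ ≤ -2 * κ * ‖b‖ ^ 2 + 2 * ε * κ * ‖b‖ ^ 2 + ε / τ * (‖p‖ ^ 2 / 2 + 2 / r ^ 2 * ‖b‖ ^ 2 +
          (‖a‖ ^ 2 / 2 + (2 * τ + κ₁) ^ 2 / 2 * ‖b‖ ^ 2) - ‖p‖ ^ 2 - ‖a‖ ^ 2) := by gcongr
    _ ≤ -(ε / τ / 2) * (‖p‖ ^ 2 + ‖a‖ ^ 2) - ε / 2 * κ * ‖b‖ ^ 2 := by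
        linear_combination ‖b‖ ^ 2 * hb + ‖b‖ ^ 2 * hdiff
    _ = _ := by
        field_simp
        ring

/-- The energy `|p|² + |a|² + τ κ |b|²` only dissipates `b`; the multipliers `b` and `a` for the
equation of `p`, of order `ρ⁻¹`, recover `p` and `a`. -/
theorem exists_damped_system_decay {τ r κ₀ κ₁ : ℝ} (hτ : 0 < τ) (hr : 0 < r) (hκ₀ : 0 < κ₀) :
    ∃ m : ℝ, 0 < m ∧ ∀ ρ κ : ℝ, r ≤ ρ → κ₀ ≤ κ → κ ≤ κ₁ → ∀ a b p : ℝ → V,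
      (∀ t, HasDerivAt a (ρ • p t) t) → (∀ t, HasDerivAt b (τ⁻¹ • (ρ • p t - b t)) t) →
      (∀ t, HasDerivAt p (-(ρ • (a t + κ • b t))) t) →
      ∀ t, 0 ≤ t → ‖p t‖ ^ 2 + ‖a t‖ ^ 2 + τ * κ * ‖b t‖ ^ 2 ≤
        4 * Real.exp (-m * t) * (‖p 0‖ ^ 2 + ‖a 0‖ ^ 2 + τ * κ * ‖b 0‖ ^ 2) := by
  obtain ⟨ε, hε, hε₁, hε₂, hε₃, hε₄⟩ := (eventually_mem_nhdsWithin.and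
    ((eventually_mul_le 4 one_pos).and
    ((eventually_mul_le (2 / r ^ 2 + (2 * τ + κ₁) ^ 2 / 2) (show 0 < τ * κ₀ / 2 by positivity)).and
    ((eventually_mul_le (1 + 2 * τ) (show 0 < r * τ by positivity)).and
    (eventually_mul_le 2 (show 0 < r * (τ * κ₀) by positivity)))))).exists
  rw [Set.mem_Ioi] at hε
  refine ⟨ε / (4 * τ), by positivity, fun ρ κ hρ hκl hκu a b p ha hb hp t ht ↦ ?_⟩
  have hρ0 : 0 < ρ := hr.trans_le hρ
  have hκ : 0 < κ := hκ₀.trans_le hκl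
  have hcorr (s : ℝ) : 2 * |ε / ρ * (inner ℝ (a s) (p s) / τ - 2 * inner ℝ (b s) (p s))| ≤
      ‖p s‖ ^ 2 + ‖a s‖ ^ 2 + τ * κ * ‖b s‖ ^ 2 := by
    exact two_mul_abs_correction_le hτ hr hε.le hε₃ (hε₄.trans (by gcongr)) hρ (a s) (b s) (p s)
  refine le_exp_neg_mul_of_lyapunov (m := ε / (4 * τ))
    (E := fun s ↦ ‖p s‖ ^ 2 + ‖a s‖ ^ 2 + τ * κ * ‖b s‖ ^ 2)
    (F := fun s ↦ ‖p s‖ ^ 2 + ‖a s‖ ^ 2 + τ * κ * ‖b s‖ ^ 2 +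
      ε / ρ * (inner ℝ (a s) (p s) / τ - 2 * inner ℝ (b s) (p s)))
    (fun s ↦ (((hp s).norm_sq.add (ha s).norm_sq).add ((hb s).norm_sq.const_mul (τ * κ))).add
      (((((ha s).inner ℝ (hp s)).div_const τ).sub
        (((hb s).inner ℝ (hp s)).const_mul 2)).const_mul (ε / ρ)))
    (by positivity) (fun s ↦ ?_) (fun s ↦ ?_) (fun s ↦ ?_) ht
  · linarith [hcorr s, neg_abs_le (ε / ρ * (inner ℝ (a s) (p s) / τ - 2 * inner ℝ (b s) (p s))),
      norm_nonneg (p s)]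
  · nlinarith [hcorr s, le_abs_self (ε / ρ * (inner ℝ (a s) (p s) / τ - 2 * inner ℝ (b s) (p s))),
      mul_nonneg (mul_nonneg hτ.le hκ.le) (sq_nonneg ‖b s‖)]
  · simp only [inner_neg_right, inner_add_right, inner_sub_right, inner_smul_right, inner_smul_left,
      real_inner_self_eq_norm_sq, real_inner_comm (a s) (p s), real_inner_comm (b s) (p s),
      inner_sub_left, real_inner_comm (a s) (b s), RCLike.conj_to_real]
    convert dissipation_le hτ hr hκ₀ hε.le hε₁ hε₂ hρ hκl hκu (a s) (b s) (p s) using 1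
    field_simp
    ring

end HighFrequencyEnergy

/-! ### The equation of a single frequency -/

theorem norm_le_of_hasDerivAt_sub_smul {V : Type*} [NormedAddCommGroup V] [NormedSpace ℝ V]
    {y q : ℝ → V} {k c Q : ℝ} (hy : ∀ t, HasDerivAt y (q t - k • y t) t) (hck : c < k)
    (hQ : 0 ≤ Q) (hq : ∀ t, 0 ≤ t → ‖q t‖ ≤ Q * Real.exp (-c * t)) {t : ℝ} (ht : 0 ≤ t) :
    ‖y t‖ ≤ Real.exp (-c * t) * (‖y 0‖ + Q / (k - c)) := by
  have hkc : 0 < k - c := sub_pos.2 hck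
  have hB (r : ℝ) : HasDerivAt (fun r ↦ ‖y 0‖ + Q / (k - c) * Real.exp ((k - c) * r))
      (Q * Real.exp ((k - c) * r)) r :=
    (((((hasDerivAt_id r).const_mul (k - c)).exp).const_mul (Q / (k - c))).const_add
      ‖y 0‖).congr_deriv (by simp only [id]; field_simp)
  have hz (r : ℝ) : HasDerivAt (fun r ↦ Real.exp (k * r) • y r) (Real.exp (k * r) • q r) r :=
    ((((hasDerivAt_id r).const_mul k).exp).smul (hy r)).congr_deriv (by
      simp only [id]
      module)
  have h : ‖Real.exp (k * t) • y t‖ ≤ ‖y 0‖ + Q / (k - c) * Real.exp ((k - c) * t) := by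
    refine image_norm_le_of_norm_deriv_right_le_deriv_boundary
      (fun r _ ↦ (hz r).continuousAt.continuousWithinAt) (fun r _ ↦ (hz r).hasDerivWithinAt)
      ?_ hB (fun r hr ↦ ?_) ⟨ht, le_rfl⟩
    · simp only [mul_zero, Real.exp_zero, one_smul, mul_one]
      linarith [show 0 ≤ Q / (k - c) by positivity]
    · rw [norm_smul, Real.norm_of_nonneg (Real.exp_pos _).le]
      calc Real.exp (k * r) * ‖q r‖ ≤ Real.exp (k * r) * (Q * Real.exp (-c * r)) := by
            gcongr
            exact hq r hr.1
        _ = Q * Real.exp ((k - c) * r) := by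
            rw [mul_left_comm, ← Real.exp_add]
            ring_nf
  rw [norm_smul, Real.norm_of_nonneg (Real.exp_pos _).le] at h
  calc ‖y t‖ = Real.exp (-k * t) * (Real.exp (k * t) * ‖y t‖) := by
        rw [← mul_assoc, ← Real.exp_add]
        simp
    _ ≤ Real.exp (-k * t) * (‖y 0‖ + Q / (k - c) * Real.exp ((k - c) * t)) := by gcongr
    _ = Real.exp (-k * t) * ‖y 0‖ + Real.exp (-c * t) * (Q / (k - c)) := by
        rw [mul_add, mul_left_comm, ← Real.exp_add, mul_comm (Q / (k - c))]
        ring_nf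
    _ ≤ Real.exp (-c * t) * ‖y 0‖ + Real.exp (-c * t) * (Q / (k - c)) := by gcongr
    _ = _ := by ring

section ModeEquation

variable {V : Type*} [NormedAddCommGroup V] [InnerProductSpace ℝ V]

/-- `u 0` solves `τ u''' + u'' + (γ + (δ + τ) x) u' + x u = 0`, and `u 1`, `u 2` are its first two
derivatives. This is the equation of a Fourier mode, with `x` the square of the angular
frequency. -/
structure IsModeSolution (τ δ γ x : ℝ) (u : Fin 3 → ℝ → V) : Prop where
  deriv_zero : ∀ t, HasDerivAt (u 0) (u 1 t) t
  deriv_one : ∀ t, HasDerivAt (u 1) (u 2 t) t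
  deriv_two : ∀ t,
    HasDerivAt (u 2) (-(τ⁻¹ • (u 2 t + (γ + (δ + τ) * x) • u 1 t + x • u 0 t))) t

namespace IsModeSolution

variable {τ δ γ x : ℝ} {u : Fin 3 → ℝ → V}

theorem hasDerivAt_acceleration (hu : IsModeSolution τ δ γ x u) (hτ : τ ≠ 0) (t : ℝ) :
    HasDerivAt (fun t ↦ u 1 t + τ • u 2 t) (-((γ + (δ + τ) * x) • u 1 t + x • u 0 t)) t :=
  ((hu.deriv_one t).add ((hu.deriv_two t).const_smul τ)).congr_deriv (by
    rw [smul_neg, smul_inv_smul₀ hτ]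
    module)

end IsModeSolution

theorem exists_mode_energy_decay {τ δ γ e : ℝ} (hτ : 0 < τ) (hδ : 0 < δ) (hγ : 0 < γ)
    (he : 0 < e) :
    ∃ m : ℝ, 0 < m ∧ ∀ ρ : ℝ, 0 < ρ → e ≤ ρ ^ 2 → ∀ u : Fin 3 → ℝ → V,
      IsModeSolution τ δ γ (ρ ^ 2) u → ∀ t : ℝ, 0 ≤ t →
      ‖u 1 t + τ • u 2 t‖ ^ 2 + ‖ρ • (u 0 t + τ • u 1 t)‖ ^ 2 +
          τ * (δ + γ / ρ ^ 2) * ‖ρ • u 1 t‖ ^ 2 ≤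
        4 * Real.exp (-m * t) * (‖u 1 0 + τ • u 2 0‖ ^ 2 + ‖ρ • (u 0 0 + τ • u 1 0)‖ ^ 2 +
          τ * (δ + γ / ρ ^ 2) * ‖ρ • u 1 0‖ ^ 2) := by
  obtain ⟨m, hm, H⟩ :=
    exists_damped_system_decay (V := V) (κ₁ := δ + γ / e) hτ (Real.sqrt_pos.2 he) hδ
  refine ⟨m, hm, fun ρ hρ heρ u hu t ht ↦ H ρ (δ + γ / ρ ^ 2) (Real.sqrt_le_iff.2 ⟨hρ.le, heρ⟩)
    (by linarith [show 0 < γ / ρ ^ 2 by positivity]) (by gcongr)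
    (fun t ↦ ρ • (u 0 t + τ • u 1 t)) (fun t ↦ ρ • u 1 t) (fun t ↦ u 1 t + τ • u 2 t)
    (fun r ↦ ?_) (fun r ↦ ?_) (fun r ↦ ?_) t ht⟩
  · exact ((hu.deriv_zero r).add ((hu.deriv_one r).const_smul τ)).const_smul ρ
  · refine ((hu.deriv_one r).const_smul ρ).congr_deriv ?_
    match_scalars <;> field_simp
    ring
  · refine (hu.hasDerivAt_acceleration hτ.ne' r).congr_deriv ?_
    match_scalars <;> field_simp
    ring

theorem le_one_div_sqrt_mul {e ρ y : ℝ} (he : 0 < e) (hρ : 0 < ρ) (heρ : e ≤ ρ ^ 2) (hy : 0 ≤ y) :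
    y ≤ 1 / √e * (ρ * y) := by
  rw [← mul_assoc, one_div_mul_eq_div]
  exact le_mul_of_one_le_left hy
    ((one_le_div (Real.sqrt_pos.2 he)).2 (Real.sqrt_le_iff.2 ⟨hρ.le, heρ⟩))

theorem mode_energy_le {τ κ κ₁ e ρ : ℝ} (hτ : 0 < τ) (he : 0 < e) (hρ : 0 < ρ) (heρ : e ≤ ρ ^ 2)
    (hκ : 0 ≤ κ) (hκ₁ : κ ≤ κ₁) (a b p : V) :
    ‖b + τ • p‖ ^ 2 + ‖ρ • (a + τ • b)‖ ^ 2 + τ * κ * ‖ρ • b‖ ^ 2 ≤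
      ((1 / √e + τ) ^ 2 + (1 + τ) ^ 2 + τ * κ₁) * (ρ * ‖a‖ + ρ * ‖b‖ + ‖p‖) ^ 2 := by
  set N : ℝ := ρ * ‖a‖ + ρ * ‖b‖ + ‖p‖
  have hρa : 0 ≤ ρ * ‖a‖ := by positivity
  have hρb : 0 ≤ ρ * ‖b‖ := by positivity
  have haN : ρ * ‖a‖ ≤ N := by linarith [norm_nonneg p]
  have hbN : ρ * ‖b‖ ≤ N := by linarith [norm_nonneg p]
  have hpN : ‖p‖ ≤ N := by linarith
  have hb : ‖b‖ ≤ 1 / √e * (ρ * ‖b‖) := le_one_div_sqrt_mul he hρ heρ (norm_nonneg b)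
  have h₁ : ‖b + τ • p‖ ≤ (1 / √e + τ) * N := by
    calc ‖b + τ • p‖ ≤ ‖b‖ + τ * ‖p‖ := by
          simpa only [norm_smul, Real.norm_of_nonneg hτ.le] using norm_add_le b (τ • p)
      _ ≤ 1 / √e * N + τ * N := by
          gcongr
          exact hb.trans (by gcongr)
      _ = _ := by ring
  have h₂ : ‖ρ • (a + τ • b)‖ ≤ (1 + τ) * N := by
    calc ‖ρ • (a + τ • b)‖ ≤ ρ * (‖a‖ + τ * ‖b‖) := by
          rw [norm_smul, Real.norm_of_nonneg hρ.le]
          gcongr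
          simpa only [norm_smul, Real.norm_of_nonneg hτ.le] using norm_add_le a (τ • b)
      _ = ρ * ‖a‖ + τ * (ρ * ‖b‖) := by ring
      _ ≤ N + τ * N := by gcongr
      _ = _ := by ring
  have h₃ : ‖ρ • b‖ ≤ N := by rwa [norm_smul, Real.norm_of_nonneg hρ.le]
  have : 0 ≤ κ₁ := hκ.trans hκ₁
  calc ‖b + τ • p‖ ^ 2 + ‖ρ • (a + τ • b)‖ ^ 2 + τ * κ * ‖ρ • b‖ ^ 2
      ≤ ((1 / √e + τ) * N) ^ 2 + ((1 + τ) * N) ^ 2 + τ * κ₁ * N ^ 2 := by gcongr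
    _ = _ := by ring

theorem exists_mode_velocity_decay {τ δ γ e : ℝ} (hτ : 0 < τ) (hδ : 0 < δ) (hγ : 0 < γ)
    (he : 0 < e) :
    ∃ C c : ℝ, 0 < C ∧ 0 < c ∧ ∀ ρ : ℝ, 0 < ρ → e ≤ ρ ^ 2 → ∀ u : Fin 3 → ℝ → V,
      IsModeSolution τ δ γ (ρ ^ 2) u → ∀ t : ℝ, 0 ≤ t →
      ‖u 1 t + τ • u 2 t‖ ≤
          C * Real.exp (-c * t) * (ρ * ‖u 0 0‖ + ρ * ‖u 1 0‖ + ‖u 2 0‖) ∧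
        ρ * ‖u 1 t‖ ≤ C * Real.exp (-c * t) * (ρ * ‖u 0 0‖ + ρ * ‖u 1 0‖ + ‖u 2 0‖) := by
  obtain ⟨m, hm, H⟩ := exists_mode_energy_decay (V := V) hτ hδ hγ he
  set K : ℝ := (1 / √e + τ) ^ 2 + (1 + τ) ^ 2 + τ * (δ + γ / e)
  have : 0 < K := by positivity
  set L : ℝ := 1 + 1 / (τ * δ)
  have : 0 < L := by positivity
  refine ⟨2 * √(K * L), m / 2, by positivity, by positivity, fun ρ hρ heρ u hu t ht ↦ ?_⟩
  set N : ℝ := ρ * ‖u 0 0‖ + ρ * ‖u 1 0‖ + ‖u 2 0‖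
  have hexp : Real.exp (-(m / 2) * t) ^ 2 = Real.exp (-m * t) := by
    rw [← Real.exp_nat_mul]
    push_cast
    ring_nf
  have hsq : (2 * √(K * L) * Real.exp (-(m / 2) * t) * N) ^ 2 =
      L * (4 * Real.exp (-m * t) * (K * N ^ 2)) := by
    rw [mul_pow, mul_pow, mul_pow, hexp, Real.sq_sqrt (by positivity)]
    ring
  have henergy : ‖u 1 t + τ • u 2 t‖ ^ 2 + ‖ρ • (u 0 t + τ • u 1 t)‖ ^ 2 +
      τ * (δ + γ / ρ ^ 2) * ‖ρ • u 1 t‖ ^ 2 ≤ 4 * Real.exp (-m * t) * (K * N ^ 2) := by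
    refine (H ρ hρ heρ u hu t ht).trans ?_
    gcongr
    exact mode_energy_le hτ he hρ heρ (by positivity) (by gcongr) _ _ _
  have hposa : 0 ≤ ‖ρ • (u 0 t + τ • u 1 t)‖ ^ 2 := by positivity
  have hposb : 0 ≤ τ * (δ + γ / ρ ^ 2) * ‖ρ • u 1 t‖ ^ 2 := by positivity
  constructor
  · refine le_of_sq_le_sq ?_ (by positivity)
    rw [hsq]
    have hL₁ : 1 ≤ L := le_add_of_nonneg_right (by positivity)
    exact le_trans (by linarith) (le_mul_of_one_le_left (by positivity) hL₁)
  · refine le_of_sq_le_sq ?_ (by positivity)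
    rw [hsq, ← Real.norm_of_nonneg hρ.le, ← norm_smul]
    have hvel : τ * δ * ‖ρ • u 1 t‖ ^ 2 ≤ 4 * Real.exp (-m * t) * (K * N ^ 2) := by
      have : τ * δ * ‖ρ • u 1 t‖ ^ 2 ≤ τ * (δ + γ / ρ ^ 2) * ‖ρ • u 1 t‖ ^ 2 := by
        gcongr
        exact le_add_of_nonneg_right (by positivity)
      linarith [sq_nonneg ‖u 1 t + τ • u 2 t‖]
    calc ‖ρ • u 1 t‖ ^ 2 = 1 / (τ * δ) * (τ * δ * ‖ρ • u 1 t‖ ^ 2) := by field_simp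
      _ ≤ L * (4 * Real.exp (-m * t) * (K * N ^ 2)) := by
        gcongr
        exact le_add_of_nonneg_left zero_le_one

end ModeEquation

section ModeHigh

variable {V : Type*} [NormedAddCommGroup V] [InnerProductSpace ℝ V]

/-- `Y = (δ + τ) x u + (u' + τ u'')` satisfies the relaxation equation
`Y' = (δ + τ)⁻¹ (u' + τ u'') - γ u' - (δ + τ)⁻¹ Y`. -/
theorem IsModeSolution.displacement_le {τ δ γ x c A B : ℝ} {u : Fin 3 → ℝ → V}
    (hu : IsModeSolution τ δ γ x u) (hτ : 0 < τ) (hδ : 0 < δ) (hγ : 0 ≤ γ) (hx : 0 ≤ x)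
    (hc : c < (δ + τ)⁻¹)
    (hA : ∀ t, 0 ≤ t → ‖u 1 t + τ • u 2 t‖ ≤ A * Real.exp (-c * t))
    (hB : ∀ t, 0 ≤ t → ‖u 1 t‖ ≤ B * Real.exp (-c * t)) {t : ℝ} (ht : 0 ≤ t) :
    (δ + τ) * x * ‖u 0 t‖ ≤ Real.exp (-c * t) * ((δ + τ) * x * ‖u 0 0‖ +
      (2 * A + ((δ + τ)⁻¹ * A + γ * B) / ((δ + τ)⁻¹ - c))) := by
  set D : ℝ := δ + τ
  have hD : 0 < D := add_pos hδ hτ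
  set Y : ℝ → V := fun r ↦ (D * x) • u 0 r + (u 1 r + τ • u 2 r)
  have hY (r : ℝ) :
      HasDerivAt Y (D⁻¹ • (u 1 r + τ • u 2 r) - γ • u 1 r - D⁻¹ • Y r) r := by
    refine (((hu.deriv_zero r).const_smul (D * x)).add
      (hu.hasDerivAt_acceleration hτ.ne' r)).congr_deriv ?_
    simp only [Y, smul_add, smul_smul, inv_mul_cancel_left₀ hD.ne']
    module
  have hforce (r : ℝ) (hr : 0 ≤ r) : ‖D⁻¹ • (u 1 r + τ • u 2 r) - γ • u 1 r‖ ≤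
      (D⁻¹ * A + γ * B) * Real.exp (-c * r) := by
    calc _ ≤ D⁻¹ * ‖u 1 r + τ • u 2 r‖ + γ * ‖u 1 r‖ := by
          refine (norm_sub_le _ _).trans_eq ?_
          rw [norm_smul, norm_smul, Real.norm_of_nonneg (by positivity), Real.norm_of_nonneg hγ]
      _ ≤ D⁻¹ * (A * Real.exp (-c * r)) + γ * (B * Real.exp (-c * r)) := by
          gcongr
          exacts [hA r hr, hB r hr]
      _ = _ := by ring
  have hA₀ : ‖u 1 0 + τ • u 2 0‖ ≤ A := by simpa using hA 0 le_rfl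
  have hB₀ : ‖u 1 0‖ ≤ B := by simpa using hB 0 le_rfl
  have : 0 ≤ A := (norm_nonneg _).trans hA₀
  have : 0 ≤ B := (norm_nonneg _).trans hB₀
  have hnorm (r : ℝ) : ‖(D * x) • u 0 r‖ = D * x * ‖u 0 r‖ := by
    rw [norm_smul, Real.norm_of_nonneg (by positivity)]
  have hY₀ : ‖Y 0‖ ≤ D * x * ‖u 0 0‖ + A :=
    (norm_add_le _ _).trans (add_le_add (hnorm 0).le hA₀)
  calc D * x * ‖u 0 t‖ ≤ ‖Y t‖ + ‖u 1 t + τ • u 2 t‖ := by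
        rw [← hnorm]
        exact norm_le_add_norm_add _ _
    _ ≤ Real.exp (-c * t) * (‖Y 0‖ + (D⁻¹ * A + γ * B) / (D⁻¹ - c)) + A * Real.exp (-c * t) := by
        gcongr
        exacts [norm_le_of_hasDerivAt_sub_smul hY hc (by positivity) hforce ht, hA t ht]
    _ ≤ Real.exp (-c * t) * (D * x * ‖u 0 0‖ + A + (D⁻¹ * A + γ * B) / (D⁻¹ - c)) +
          A * Real.exp (-c * t) := by gcongr
    _ = _ := by ring

theorem exists_mode_displacement_decay {τ δ γ e : ℝ} (hτ : 0 < τ) (hδ : 0 < δ) (hγ : 0 < γ)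
    (he : 0 < e) :
    ∃ C c : ℝ, 0 < C ∧ 0 < c ∧ ∀ ρ : ℝ, 0 < ρ → e ≤ ρ ^ 2 → ∀ u : Fin 3 → ℝ → V,
      IsModeSolution τ δ γ (ρ ^ 2) u → ∀ t : ℝ, 0 ≤ t →
      ρ ^ 2 * ‖u 0 t‖ ≤ C * Real.exp (-c * t) *
        (ρ ^ 2 * ‖u 0 0‖ + (ρ * ‖u 0 0‖ + ρ * ‖u 1 0‖ + ‖u 2 0‖)) := by
  obtain ⟨C, c, hC, hc, H⟩ := exists_mode_velocity_decay (V := V) hτ hδ hγ he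
  have hD : 0 < δ + τ := add_pos hδ hτ
  set c' : ℝ := min c ((δ + τ)⁻¹ / 2)
  have hcD : c' < (δ + τ)⁻¹ := (min_le_right _ _).trans_lt (half_lt_self (inv_pos.2 hD))
  have hcc : c' ≤ c := min_le_left _ _
  set B : ℝ := 2 * C + ((δ + τ)⁻¹ * C + γ * (1 / √e * C)) / ((δ + τ)⁻¹ - c')
  have : 0 < (δ + τ)⁻¹ - c' := sub_pos.2 hcD
  have : 0 < B := by positivity
  refine ⟨((δ + τ) + B) / (δ + τ), c', by positivity, by positivity, fun ρ hρ heρ u hu t ht ↦ ?_⟩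
  set N : ℝ := ρ * ‖u 0 0‖ + ρ * ‖u 1 0‖ + ‖u 2 0‖
  have hp (r : ℝ) (hr : 0 ≤ r) : ‖u 1 r + τ • u 2 r‖ ≤ C * N * Real.exp (-c' * r) := by
    rw [mul_right_comm]
    exact (H ρ hρ heρ u hu r hr).1.trans (by gcongr)
  have hv (r : ℝ) (hr : 0 ≤ r) : ‖u 1 r‖ ≤ 1 / √e * C * N * Real.exp (-c' * r) := by
    calc ‖u 1 r‖ ≤ 1 / √e * (ρ * ‖u 1 r‖) := le_one_div_sqrt_mul he hρ heρ (norm_nonneg _)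
      _ ≤ 1 / √e * (C * Real.exp (-c * r) * N) :=
          mul_le_mul_of_nonneg_left (H ρ hρ heρ u hu r hr).2 (by positivity)
      _ ≤ 1 / √e * (C * Real.exp (-c' * r) * N) := by gcongr
      _ = _ := by ring
  have hu₀ := hu.displacement_le hτ hδ hγ.le (sq_nonneg ρ) hcD hp hv ht
  rw [div_mul_eq_mul_div, div_mul_eq_mul_div, le_div_iff₀ hD]
  calc ρ ^ 2 * ‖u 0 t‖ * (δ + τ) = (δ + τ) * ρ ^ 2 * ‖u 0 t‖ := by ring
    _ ≤ Real.exp (-c' * t) * ((δ + τ) * (ρ ^ 2 * ‖u 0 0‖) + B * N) :=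
        hu₀.trans_eq (by ring)
    _ ≤ Real.exp (-c' * t) * (((δ + τ) + B) * (ρ ^ 2 * ‖u 0 0‖) + ((δ + τ) + B) * N) := by
        have hDB : δ + τ ≤ (δ + τ) + B := le_add_of_nonneg_right (by positivity)
        have hBD : B ≤ (δ + τ) + B := le_add_of_nonneg_left hD.le
        exact mul_le_mul_of_nonneg_left (add_le_add (mul_le_mul_of_nonneg_right hDB
          (by positivity)) (mul_le_mul_of_nonneg_right hBD (by positivity))) (by positivity)
    _ = _ := by ring

theorem exists_mode_decay_high {τ δ γ e : ℝ} (hτ : 0 < τ) (hδ : 0 < δ) (hγ : 0 < γ)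
    (he : 0 < e) (j : Fin 3) :
    ∃ C c : ℝ, 0 < C ∧ 0 < c ∧ ∀ ρ : ℝ, 0 < ρ → e ≤ ρ ^ 2 → ∀ u : Fin 3 → ℝ → V,
      IsModeSolution τ δ γ (ρ ^ 2) u → ∀ t : ℝ, 0 ≤ t →
      ρ ^ (2 - ((j : ℕ) : ℝ)) * ‖u j t‖ ≤ C * Real.exp (-c * t) *
        (ρ ^ max 1 (2 - ((j : ℕ) : ℝ)) * ‖u 0 0‖ + ρ * ‖u 1 0‖ + ‖u 2 0‖) := by
  obtain ⟨C, c, hC, hc, H⟩ := exists_mode_velocity_decay (V := V) hτ hδ hγ he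
  match j with
  | 0 =>
    obtain ⟨C₀, c₀, hC₀, hc₀, H₀⟩ := exists_mode_displacement_decay (V := V) hτ hδ hγ he
    refine ⟨C₀ * (1 + 1 / √e), c₀, by positivity, hc₀, fun ρ hρ heρ u hu t ht ↦ ?_⟩
    have hexp : max (1 : ℝ) 2 = 2 := max_eq_right one_le_two
    simp only [Fin.val_zero, Nat.cast_zero, sub_zero, hexp, Real.rpow_two]
    have hρ₀ : ρ * ‖u 0 0‖ ≤ 1 / √e * (ρ ^ 2 * ‖u 0 0‖) := by
      rw [sq, mul_assoc]
      exact le_one_div_sqrt_mul he hρ heρ (by positivity)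
    have hdata : ρ ^ 2 * ‖u 0 0‖ + (ρ * ‖u 0 0‖ + ρ * ‖u 1 0‖ + ‖u 2 0‖) ≤
        (1 + 1 / √e) * (ρ ^ 2 * ‖u 0 0‖ + ρ * ‖u 1 0‖ + ‖u 2 0‖) := by
      have : 0 ≤ 1 / √e * (ρ * ‖u 1 0‖ + ‖u 2 0‖) := by positivity
      linear_combination hρ₀ + this
    rw [mul_right_comm C₀, mul_assoc _ (1 + 1 / √e)]
    exact (H₀ ρ hρ heρ u hu t ht).trans (by gcongr)
  | 1 =>
    refine ⟨C, c, hC, hc, fun ρ hρ heρ u hu t ht ↦ ?_⟩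
    have hexp : (2 : ℝ) - 1 = 1 := by norm_num
    simp only [Fin.val_one, Nat.cast_one, hexp, max_self, Real.rpow_one]
    exact (H ρ hρ heρ u hu t ht).2
  | 2 =>
    refine ⟨τ⁻¹ * (C + 1 / √e * C), c, by positivity, hc, fun ρ hρ heρ u hu t ht ↦ ?_⟩
    have hexp : max (1 : ℝ) 0 = 1 := max_eq_left zero_le_one
    simp only [Fin.val_two, Nat.cast_ofNat, sub_self, hexp, Real.rpow_one, Real.rpow_zero, one_mul]
    obtain ⟨hp, hv⟩ := H ρ hρ heρ u hu t ht
    calc ‖u 2 t‖ = τ⁻¹ * ‖u 1 t + τ • u 2 t - u 1 t‖ := by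
          rw [add_sub_cancel_left, norm_smul, Real.norm_of_nonneg hτ.le,
            inv_mul_cancel_left₀ hτ.ne']
      _ ≤ τ⁻¹ * (‖u 1 t + τ • u 2 t‖ + 1 / √e * (ρ * ‖u 1 t‖)) := by
          gcongr
          exact (norm_sub_le _ _).trans
            (by gcongr; exact le_one_div_sqrt_mul he hρ heρ (norm_nonneg _))
      _ ≤ τ⁻¹ * (C * Real.exp (-c * t) * _ + 1 / √e * (C * Real.exp (-c * t) * _)) := by
          gcongr
      _ = _ := by ring

end ModeHigh

section SlowRoot

/-- `-μ` is the root of the characteristic polynomial `τ r³ + r² + (γ + (δ + τ) x) r + x` of the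
mode equation which tends to `0` with `x`, and `x` is small enough to separate it from the other
two. -/
structure IsSlowRoot (τ δ γ x μ : ℝ) : Prop where
  root : -τ * μ ^ 3 + μ ^ 2 - (γ + (δ + τ) * x) * μ + x = 0
  lower : x / (2 * γ) ≤ μ
  upper : μ ≤ 2 / γ * x
  mul_le_half : τ * μ ≤ 1 / 2
  le_quarter : μ ≤ γ / 4

theorem eventually_exists_isSlowRoot {τ δ γ : ℝ} (hτ : 0 < τ) (hδ : 0 < δ) (hγ : 0 < γ) :
    ∀ᶠ x : ℝ in 𝓝[>] 0, ∃ μ, IsSlowRoot τ δ γ x μ := by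
  filter_upwards [eventually_mem_nhdsWithin,
    eventually_mul_le (2 / γ) (show 0 < γ / 4 by positivity),
    eventually_mul_le (τ * (2 / γ)) one_half_pos,
    eventually_mul_le (δ + τ) (half_pos hγ)] with x hx hx₁ hx₂ hx₃
  rw [Set.mem_Ioi] at hx
  set P : ℝ → ℝ := fun μ ↦ -τ * μ ^ 3 + μ ^ 2 - (γ + (δ + τ) * x) * μ + x
  have hend : P (2 / γ * x) ≤ 0 := by
    have hcancel : γ * (2 / γ * x) = 2 * x := by field_simp
    have hsmall : (2 / γ * x) * (2 / γ * x) ≤ γ / 4 * (2 / γ * x) := by gcongr; linarith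
    have hcube : 0 ≤ τ * (2 / γ * x) ^ 3 := by positivity
    have hprod : 0 ≤ (δ + τ) * x * (2 / γ * x) := by positivity
    linear_combination hsmall + hcube + hprod - (3 / 4) * hcancel + (1 / 2) * hx.le
  obtain ⟨μ, ⟨hμ₀, hμx⟩, hμ⟩ := intermediate_value_Icc' (f := P) (by positivity)
    (by fun_prop) ⟨hend, by simpa [P] using hx.le⟩
  have hroot : -τ * μ ^ 3 + μ ^ 2 - (γ + (δ + τ) * x) * μ + x = 0 := hμ
  have hτμ : τ * μ ≤ 1 / 2 :=
    (mul_le_mul_of_nonneg_left hμx hτ.le).trans (by linarith)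
  have hμγ : μ ≤ γ / 4 := hμx.trans (by linarith)
  refine ⟨μ, hroot, ?_, hμx, hτμ, hμγ⟩
  rw [div_le_iff₀ (by positivity)]
  have hτμ₂ : τ * μ * μ ≤ 1 / 2 * (γ / 4) := by gcongr
  calc x ≤ μ * (γ + (δ + τ) * x + τ * μ * μ) := by
        linear_combination hroot + sq_nonneg μ
    _ ≤ μ * (2 * γ) := by gcongr; linarith

theorem abs_neg_pow_mul_exp_sub_le {l a b t : ℝ} (hl : 0 < l) (ha : a ∈ Set.Icc l (4 * l))
    (hb : b ∈ Set.Icc l (4 * l)) (ht : 0 ≤ t) (j : ℕ) :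
    |(-a) ^ j * Real.exp (-a * t) - (-b) ^ j * Real.exp (-b * t)| ≤
      (j + 8) * (4 * l) ^ j / (4 * l) * Real.exp (-(l / 2) * t) * |a - b| := by
  have hderiv (y : ℝ) : HasDerivAt (fun y ↦ (-y) ^ j * Real.exp (-y * t))
      (j * (-y) ^ (j - 1) * -1 * Real.exp (-y * t) +
        (-y) ^ j * (Real.exp (-y * t) * (-1 * t))) y :=
    ((hasDerivAt_id y).neg.pow j).mul (((hasDerivAt_id y).neg.mul_const t).exp)
  refine (convex_Icc l (4 * l)).norm_image_sub_le_of_norm_hasDerivWithin_le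
    (fun y _ ↦ (hderiv y).hasDerivWithinAt) (fun y hy ↦ ?_) hb ha
  have hy₀ : 0 < y := hl.trans_le hy.1
  have hpow : j * (4 * l) ^ (j - 1) = j * (4 * l) ^ j / (4 * l) := by
    rcases j with - | j
    · simp
    · rw [Nat.add_sub_cancel, pow_succ, ← mul_assoc, mul_div_cancel_right₀ _ (by positivity)]
  have hexp : Real.exp (-y * t) ≤ Real.exp (-l * t) := by gcongr; exact hy.1
  have hexp' : Real.exp (-l * t) ≤ Real.exp (-(l / 2) * t) := by gcongr; linarith
  have htexp : t * Real.exp (-l * t) ≤ 8 / (4 * l) * Real.exp (-(l / 2) * t) := by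
    have hsplit : Real.exp (-l * t) = Real.exp (-(l / 2) * t) / Real.exp (l / 2 * t) := by
      rw [← Real.exp_sub]
      ring_nf
    rw [hsplit, ← mul_div_assoc, div_le_iff₀ (Real.exp_pos _)]
    calc _ = 8 / (4 * l) * Real.exp (-(l / 2) * t) * (l / 2 * t) := by field_simp; ring
      _ ≤ _ := by
        gcongr
        linarith [Real.add_one_le_exp (l / 2 * t)]
  calc _ ≤ j * y ^ (j - 1) * Real.exp (-y * t) + y ^ j * (Real.exp (-y * t) * t) := by
        refine (norm_add_le _ _).trans_eq ?_
        simp [abs_of_pos hy₀, abs_of_nonneg ht]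
    _ ≤ j * (4 * l) ^ (j - 1) * Real.exp (-(l / 2) * t) +
          (4 * l) ^ j * (t * Real.exp (-l * t)) := by
        rw [mul_comm t]
        exact add_le_add (mul_le_mul (by gcongr; exact hy.2) (hexp.trans hexp')
          (Real.exp_pos _).le (by positivity)) (mul_le_mul (by gcongr; exact hy.2)
          (by gcongr) (by positivity) (by positivity))
    _ ≤ j * (4 * l) ^ j / (4 * l) * Real.exp (-(l / 2) * t) +
          (4 * l) ^ j * (8 / (4 * l) * Real.exp (-(l / 2) * t)) := by
        rw [hpow]
        gcongr
    _ = _ := by ring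

namespace IsSlowRoot

variable {τ δ γ x μ : ℝ}

theorem pos (h : IsSlowRoot τ δ γ x μ) (hγ : 0 < γ) (hx : 0 < x) : 0 < μ :=
  lt_of_lt_of_le (by positivity) h.lower

theorem div_sub_eq (h : IsSlowRoot τ δ γ x μ) (hμ : μ ≠ 0) :
    x / μ - γ = (δ + τ) * x - μ + τ * μ ^ 2 := by
  rw [sub_eq_iff_eq_add, div_eq_iff hμ]
  linear_combination h.root

theorem half_le_div (h : IsSlowRoot τ δ γ x μ) (hγ : 0 < γ) (hx : 0 < x) : γ / 2 ≤ x / μ := by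
  rw [le_div_iff₀ (h.pos hγ hx)]
  calc γ / 2 * μ ≤ γ / 2 * (2 / γ * x) := by gcongr; exact h.upper
    _ = x := by field_simp

theorem div_le (h : IsSlowRoot τ δ γ x μ) (hγ : 0 < γ) (hx : 0 < x) : x / μ ≤ 2 * γ := by
  rw [div_le_iff₀ (h.pos hγ hx), mul_comm, ← div_le_iff₀ (by positivity)]
  exact h.lower

theorem abs_div_sub_le (h : IsSlowRoot τ δ γ x μ) (hτ : 0 ≤ τ) (hδ : 0 ≤ δ) (hγ : 0 < γ)
    (hx : 0 < x) : |x / μ - γ| ≤ ((δ + τ) + 3 / γ) * x := by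
  have hμ : 0 < μ := h.pos hγ hx
  have hDx : 0 ≤ (δ + τ) * x := by positivity
  have hτμ : τ * μ ^ 2 ≤ 1 / 2 * μ := by
    rw [sq, ← mul_assoc]
    exact mul_le_mul_of_nonneg_right h.mul_le_half hμ.le
  have hμx : 3 / 2 * μ ≤ 3 / γ * x := (mul_le_mul_of_nonneg_left h.upper (by norm_num)).trans_eq
    (by ring)
  have : 0 ≤ τ * μ ^ 2 := by positivity
  rw [h.div_sub_eq hμ.ne', abs_le]
  constructor <;> linarith

theorem abs_sub_le (h : IsSlowRoot τ δ γ x μ) (hτ : 0 ≤ τ) (hδ : 0 ≤ δ) (hγ : 0 < γ)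
    (hx : 0 < x) : |μ - x / γ| ≤ 2 / γ ^ 2 * ((δ + τ) + 3 / γ) * x ^ 2 := by
  have hμ : 0 < μ := h.pos hγ hx
  have hfactor : μ - x / γ = -(μ / γ * (x / μ - γ)) := by
    field_simp
    ring
  rw [hfactor, abs_neg, abs_mul, abs_of_pos (by positivity)]
  calc μ / γ * |x / μ - γ| ≤ 2 / γ * x / γ * (((δ + τ) + 3 / γ) * x) := by
        gcongr
        exacts [h.upper, h.abs_div_sub_le hτ hδ hγ hx]
    _ = _ := by ring

theorem abs_mode_sub_le (h : IsSlowRoot τ δ γ x μ) (hτ : 0 ≤ τ) (hδ : 0 ≤ δ) (hγ : 0 < γ)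
    (hx : 0 < x) {t : ℝ} (ht : 0 ≤ t) (j : ℕ) :
    |(-μ) ^ j * Real.exp (-μ * t) - (-(x / γ)) ^ j * Real.exp (-(x / γ) * t)| ≤
      (j + 8) * (2 / γ) ^ j * (((δ + τ) + 3 / γ) / γ) *
        (x ^ (j + 1) * Real.exp (-(1 / (4 * γ)) * x * t)) := by
  have hl : 4 * (x / (2 * γ)) = 2 / γ * x := by field_simp; ring
  have hx₀ : 0 ≤ x / γ := by positivity
  refine (abs_neg_pow_mul_exp_sub_le (l := x / (2 * γ)) (by positivity)
    ⟨h.lower, h.upper.trans_eq hl.symm⟩ ⟨?_, ?_⟩ ht j).trans ?_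
  · rw [div_mul_eq_div_div_swap]
    linarith
  · rw [hl, div_mul_eq_mul_div, mul_div_assoc]
    linarith
  calc _ ≤ (j + 8) * (4 * (x / (2 * γ))) ^ j / (4 * (x / (2 * γ))) *
        Real.exp (-(x / (2 * γ) / 2) * t) * (2 / γ ^ 2 * ((δ + τ) + 3 / γ) * x ^ 2) := by
        gcongr
        exact h.abs_sub_le hτ hδ hγ hx
    _ = _ := by
        rw [hl, mul_pow, show x / (2 * γ) / 2 = 1 / (4 * γ) * x by field_simp; norm_num,
          pow_succ x j]
        field_simp

end IsSlowRoot

end SlowRoot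

section LowFrequency

variable {V : Type*} [NormedAddCommGroup V] [InnerProductSpace ℝ V]

theorem exists_oscillator_norm_decay {b₀ b₁ d₀ d₁ : ℝ} (hb₀ : 0 < b₀) (hb₁ : 0 ≤ b₁)
    (hd₀ : 0 < d₀) (hd₁ : 0 ≤ d₁) :
    ∃ C c : ℝ, 0 < C ∧ 0 < c ∧ ∀ b d : ℝ, b₀ ≤ b → b ≤ b₁ → d₀ ≤ d → d ≤ d₁ → ∀ y z : ℝ → V,
      (∀ t, HasDerivAt y (z t) t) → (∀ t, HasDerivAt z (-(b • z t + d • y t)) t) →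
      ∀ t, 0 ≤ t → ‖y t‖ + ‖z t‖ + ‖b • z t + d • y t‖ ≤
        C * Real.exp (-c * t) * (‖y 0‖ + ‖z 0‖) := by
  obtain ⟨m, hm, H⟩ := exists_oscillator_decay (V := V) (b₁ := b₁) hb₀ hd₀
  set K : ℝ := 8 * (1 + 1 / d₀) * (1 + d₁)
  refine ⟨(1 + b₁ + d₁) * √K, m / 2, by positivity, by positivity,
    fun b d hbl hbu hdl hdu y z hy hz t ht ↦ ?_⟩
  set N : ℝ := ‖y 0‖ + ‖z 0‖
  have hb : 0 < b := hb₀.trans_le hbl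
  have hd : 0 < d := hd₀.trans_le hdl
  have hinit : ‖z 0‖ ^ 2 + d * ‖y 0‖ ^ 2 ≤ (1 + d₁) * N ^ 2 := by
    have hyN : ‖y 0‖ ≤ N := le_add_of_nonneg_right (norm_nonneg _)
    have hzN : ‖z 0‖ ≤ N := le_add_of_nonneg_left (norm_nonneg _)
    calc _ ≤ N ^ 2 + d₁ * N ^ 2 := by gcongr
      _ = _ := by ring
  have hsq : (‖y t‖ + ‖z t‖) ^ 2 ≤ 2 * (1 + 1 / d₀) * (‖z t‖ ^ 2 + d * ‖y t‖ ^ 2) := by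
    have hyd : ‖y t‖ ^ 2 ≤ 1 / d₀ * (d * ‖y t‖ ^ 2) := by
      rw [← mul_assoc, one_div_mul_eq_div]
      exact le_mul_of_one_le_left (sq_nonneg _) ((one_le_div hd₀).2 hdl)
    have : 0 ≤ 1 / d₀ * ‖z t‖ ^ 2 + d * ‖y t‖ ^ 2 := by positivity
    linear_combination 2 * hyd + 2 * this + sq_nonneg (‖y t‖ - ‖z t‖)
  have hyz : ‖y t‖ + ‖z t‖ ≤ √K * Real.exp (-(m / 2) * t) * N := by
    refine le_of_sq_le_sq ?_ (by positivity)
    calc _ ≤ 2 * (1 + 1 / d₀) * (4 * Real.exp (-m * t) * ((1 + d₁) * N ^ 2)) :=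
          hsq.trans (mul_le_mul_of_nonneg_left ((H b d hbl hbu hdl y z hy hz t ht).trans
            (mul_le_mul_of_nonneg_left hinit (by positivity))) (by positivity))
      _ = K * Real.exp (-(m / 2) * t) ^ 2 * N ^ 2 := by
          rw [← Real.exp_nat_mul, Nat.cast_ofNat, ← mul_assoc 2 (-(m / 2)), mul_neg,
            mul_div_cancel₀ m two_ne_zero]
          ring
      _ = _ := by rw [mul_pow, mul_pow, Real.sq_sqrt (by positivity)]
  calc ‖y t‖ + ‖z t‖ + ‖b • z t + d • y t‖
      ≤ ‖y t‖ + ‖z t‖ + (b * ‖z t‖ + d * ‖y t‖) := by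
        gcongr
        refine (norm_add_le _ _).trans_eq ?_
        rw [norm_smul, norm_smul, Real.norm_of_nonneg hb.le, Real.norm_of_nonneg hd.le]
    _ ≤ ‖y t‖ + ‖z t‖ + (b₁ * (‖y t‖ + ‖z t‖) + d₁ * (‖y t‖ + ‖z t‖)) := by
        gcongr <;> simp
    _ = (1 + b₁ + d₁) * (‖y t‖ + ‖z t‖) := by ring
    _ ≤ (1 + b₁ + d₁) * (√K * Real.exp (-(m / 2) * t) * N) := by gcongr
    _ = _ := by ring

/-- The coefficient of `exp (-μ t)` in a solution of the mode equation, for `-μ` a root of the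
characteristic polynomial. -/
noncomputable def slowCoefficient (τ x μ : ℝ) (u : Fin 3 → ℝ → V) : V :=
  (2 * τ * μ ^ 2 - μ + x / μ)⁻¹ • (τ • u 2 0 + (1 - τ * μ) • u 1 0 + (x / μ) • u 0 0)

/-- The `j`-th time derivative of a solution of the mode equation without its component along
`exp (-μ t)`. -/
noncomputable def fastPart (τ x μ : ℝ) (u : Fin 3 → ℝ → V) (j : Fin 3) (t : ℝ) : V :=
  u j t - ((-μ) ^ (j : ℕ) * Real.exp (-μ * t)) • slowCoefficient τ x μ u

/-- The limit of `slowCoefficient` at zero frequency. -/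
noncomputable def slowMean (τ γ : ℝ) (u : Fin 3 → ℝ → V) : V :=
  γ⁻¹ • (γ • u 0 0 + u 1 0 + τ • u 2 0)

variable {τ δ γ x μ : ℝ} {u : Fin 3 → ℝ → V}

theorem IsSlowRoot.quarter_le (h : IsSlowRoot τ δ γ x μ) (hτ : 0 ≤ τ) (hγ : 0 < γ) (hx : 0 < x) :
    γ / 4 ≤ 2 * τ * μ ^ 2 - μ + x / μ := by
  have : 0 ≤ 2 * τ * μ ^ 2 := by positivity
  linarith [h.half_le_div hγ hx, h.le_quarter]

/-- The factor of the mode equation complementary to the root `-μ` applied to a solution. -/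
theorem IsModeSolution.firstIntegral_eq (hu : IsModeSolution τ δ γ x u) (hτ : τ ≠ 0)
    (hμ : μ ≠ 0) (hroot : -τ * μ ^ 3 + μ ^ 2 - (γ + (δ + τ) * x) * μ + x = 0) (t : ℝ) :
    τ • u 2 t + (1 - τ * μ) • u 1 t + (x / μ) • u 0 t =
      Real.exp (-μ * t) • (τ • u 2 0 + (1 - τ * μ) • u 1 0 + (x / μ) • u 0 0) := by
  set q : ℝ → V := fun t ↦ τ • u 2 t + (1 - τ * μ) • u 1 t + (x / μ) • u 0 t
  have hxμ : x / μ = γ + (δ + τ) * x - μ + τ * μ ^ 2 := by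
    rw [div_eq_iff hμ]
    linear_combination hroot
  have hq (t : ℝ) : HasDerivAt q (-μ • q t) t := by
    refine ((((hu.deriv_two t).const_smul τ).add ((hu.deriv_one t).const_smul (1 - τ * μ))).add
      ((hu.deriv_zero t).const_smul (x / μ))).congr_deriv ?_
    rw [smul_neg, smul_inv_smul₀ hτ]
    have hx : x = x / μ * μ := (div_mul_cancel₀ x hμ).symm
    simp only [q]
    match_scalars
    · ring
    · linear_combination hxμ
    · linear_combination -hx
  have hconst (t : ℝ) : HasDerivAt (fun t ↦ Real.exp (μ * t) • q t) 0 t :=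
    ((((hasDerivAt_id t).const_mul μ).exp).smul (hq t)).congr_deriv (by
      simp only [id]
      module)
  have h : Real.exp (μ * t) • q t = q 0 := by
    have := is_const_of_deriv_eq_zero (fun t ↦ (hconst t).differentiableAt)
      (fun t ↦ (hconst t).deriv) t 0
    simpa using this
  change q t = Real.exp (-μ * t) • q 0
  rw [← h, smul_smul, ← Real.exp_add]
  simp

theorem IsModeSolution.hasDerivAt_fastPart_zero (hu : IsModeSolution τ δ γ x u) (t : ℝ) :
    HasDerivAt (fastPart τ x μ u 0) (fastPart τ x μ u 1 t) t :=
  ((hu.deriv_zero t).sub (((((hasDerivAt_id t).const_mul (-μ)).exp).const_mul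
    ((-μ) ^ 0)).smul_const (slowCoefficient τ x μ u))).congr_deriv (by
      simp [fastPart, mul_comm])

theorem IsModeSolution.hasDerivAt_fastPart_one (hu : IsModeSolution τ δ γ x u) (hτ : τ ≠ 0)
    (hμ : μ ≠ 0) (hroot : -τ * μ ^ 3 + μ ^ 2 - (γ + (δ + τ) * x) * μ + x = 0)
    (hQ : 2 * τ * μ ^ 2 - μ + x / μ ≠ 0) (t : ℝ) :
    fastPart τ x μ u 2 t = -(((1 - τ * μ) / τ) • fastPart τ x μ u 1 t +
        (x / μ / τ) • fastPart τ x μ u 0 t) ∧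
      HasDerivAt (fastPart τ x μ u 1) (fastPart τ x μ u 2 t) t := by
  constructor
  · have hK : τ • u 2 t + (1 - τ * μ) • u 1 t + (x / μ) • u 0 t =
        Real.exp (-μ * t) • (2 * τ * μ ^ 2 - μ + x / μ) • slowCoefficient τ x μ u := by
      rw [hu.firstIntegral_eq hτ hμ hroot, slowCoefficient, smul_inv_smul₀ hQ]
    have hfactor : τ • fastPart τ x μ u 2 t + (1 - τ * μ) • fastPart τ x μ u 1 t +
        (x / μ) • fastPart τ x μ u 0 t = 0 := by
      simp only [fastPart, Fin.val_zero, Fin.val_one, Fin.val_two]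
      rw [← sub_eq_zero] at hK
      refine Eq.trans ?_ hK
      module
    refine smul_right_injective V hτ ?_
    simp only [smul_neg, smul_add, smul_smul, mul_div_cancel₀ _ hτ]
    rwa [eq_neg_iff_add_eq_zero, ← add_assoc]
  · refine ((hu.deriv_one t).sub (((((hasDerivAt_id t).const_mul (-μ)).exp).const_mul
      ((-μ) ^ 1)).smul_const (slowCoefficient τ x μ u))).congr_deriv ?_
    simp only [fastPart, Fin.val_two, id]
    module

theorem IsSlowRoot.norm_slowCoefficient_le (h : IsSlowRoot τ δ γ x μ) (hτ : 0 ≤ τ) (hγ : 0 < γ)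
    (hx : 0 < x) (u : Fin 3 → ℝ → V) :
    ‖slowCoefficient τ x μ u‖ ≤ 4 / γ * (τ + 1 + 2 * γ) * (‖u 0 0‖ + ‖u 1 0‖ + ‖u 2 0‖) := by
  set S : ℝ := ‖u 0 0‖ + ‖u 1 0‖ + ‖u 2 0‖
  have : 0 ≤ τ * μ := mul_nonneg hτ (h.pos hγ hx).le
  have : 0 ≤ 1 - τ * μ := by linarith [h.mul_le_half]
  have : 0 ≤ x / μ := by linarith [h.half_le_div hγ hx]
  have hQ : (2 * τ * μ ^ 2 - μ + x / μ)⁻¹ ≤ 4 / γ :=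
    (inv_anti₀ (by positivity) (h.quarter_le hτ hγ hx)).trans_eq (inv_div γ 4)
  have hq : ‖τ • u 2 0 + (1 - τ * μ) • u 1 0 + (x / μ) • u 0 0‖ ≤ (τ + 1 + 2 * γ) * S := by
    calc _ ≤ τ * ‖u 2 0‖ + (1 - τ * μ) * ‖u 1 0‖ + x / μ * ‖u 0 0‖ := by
          refine (norm_add₃_le).trans_eq ?_
          rw [norm_smul, norm_smul, norm_smul, Real.norm_of_nonneg, Real.norm_of_nonneg,
            Real.norm_of_nonneg] <;> assumption
      _ ≤ τ * S + 1 * S + 2 * γ * S := by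
          gcongr ?_ * ?_ + ?_ * ?_ + ?_ * ?_
          · linarith [norm_nonneg (u 0 0), norm_nonneg (u 1 0)]
          · linarith
          · linarith [norm_nonneg (u 0 0), norm_nonneg (u 2 0)]
          · exact h.div_le hγ hx
          · linarith [norm_nonneg (u 1 0), norm_nonneg (u 2 0)]
      _ = _ := by ring
  have hpos : 0 ≤ (2 * τ * μ ^ 2 - μ + x / μ)⁻¹ :=
    inv_nonneg.2 (by linarith [h.quarter_le hτ hγ hx])
  rw [slowCoefficient, norm_smul, Real.norm_of_nonneg hpos, mul_assoc (4 / γ)]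
  exact mul_le_mul hQ hq (norm_nonneg _) (by positivity)

theorem exists_fastPart_decay (hτ : 0 < τ) (hγ : 0 < γ) (δ : ℝ) :
    ∃ C c : ℝ, 0 < C ∧ 0 < c ∧ ∀ x μ, 0 < x → IsSlowRoot τ δ γ x μ → ∀ u : Fin 3 → ℝ → V,
      IsModeSolution τ δ γ x u → ∀ t, 0 ≤ t → ∀ j,
        ‖fastPart τ x μ u j t‖ ≤ C * Real.exp (-c * t) * (‖u 0 0‖ + ‖u 1 0‖ + ‖u 2 0‖) := by
  obtain ⟨C, c, hC, hc, H⟩ := exists_oscillator_norm_decay (V := V) (b₀ := 1 / (2 * τ))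
    (b₁ := 1 / τ) (d₀ := γ / 2 / τ) (d₁ := 2 * γ / τ) (by positivity) (by positivity)
    (by positivity) (by positivity)
  set D : ℝ := 4 / γ * (τ + 1 + 2 * γ)
  refine ⟨C * (1 + (1 + γ / 4) * D), c, by positivity, hc, fun x μ hx h u hu t ht j ↦ ?_⟩
  set S : ℝ := ‖u 0 0‖ + ‖u 1 0‖ + ‖u 2 0‖
  have hμ : 0 < μ := h.pos hγ hx
  have hQ : 0 < 2 * τ * μ ^ 2 - μ + x / μ := by linarith [h.quarter_le hτ.le hγ hx]
  have hone := hu.hasDerivAt_fastPart_one hτ.ne' hμ.ne' h.root hQ.ne'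
  have hosc := H ((1 - τ * μ) / τ) (x / μ / τ)
    (by rw [← div_div]; gcongr; linarith [h.mul_le_half])
    (by gcongr; linarith [mul_pos hτ hμ])
    (div_le_div_of_nonneg_right (h.half_le_div hγ hx) hτ.le)
    (div_le_div_of_nonneg_right (h.div_le hγ hx) hτ.le) _ _ hu.hasDerivAt_fastPart_zero
    (fun t ↦ (hone t).1 ▸ (hone t).2) t ht
  have hinit : ‖fastPart τ x μ u 0 0‖ + ‖fastPart τ x μ u 1 0‖ ≤ (1 + (1 + γ / 4) * D) * S := by
    have hK : ‖slowCoefficient τ x μ u‖ ≤ D * S := h.norm_slowCoefficient_le hτ.le hγ hx u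
    have h0 : ‖fastPart τ x μ u 0 0‖ ≤ ‖u 0 0‖ + D * S := by
      refine (norm_sub_le _ _).trans (add_le_add le_rfl ?_)
      simpa using hK
    have h1 : ‖fastPart τ x μ u 1 0‖ ≤ ‖u 1 0‖ + γ / 4 * (D * S) := by
      refine (norm_sub_le _ _).trans (add_le_add le_rfl ?_)
      rw [norm_smul]
      refine mul_le_mul ?_ hK (norm_nonneg _) (by positivity)
      simpa [abs_of_pos hμ] using h.le_quarter
    linarith [norm_nonneg (u 2 0)]
  rw [← norm_neg (_ + _), ← (hone t).1] at hosc
  calc ‖fastPart τ x μ u j t‖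
      ≤ ‖fastPart τ x μ u 0 t‖ + ‖fastPart τ x μ u 1 t‖ + ‖fastPart τ x μ u 2 t‖ := by
        fin_cases j
        · exact (le_add_of_nonneg_right (norm_nonneg _)).trans
            (le_add_of_nonneg_right (norm_nonneg _))
        · exact (le_add_of_nonneg_left (norm_nonneg _)).trans
            (le_add_of_nonneg_right (norm_nonneg _))
        · exact le_add_of_nonneg_left (by positivity)
    _ ≤ C * Real.exp (-c * t) * ((1 + (1 + γ / 4) * D) * S) :=
        hosc.trans (mul_le_mul_of_nonneg_left hinit (by positivity))
    _ = _ := by ring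

theorem norm_slowMean_le (hτ : 0 ≤ τ) (hγ : 0 < γ) (u : Fin 3 → ℝ → V) :
    ‖slowMean τ γ u‖ ≤ (1 + (1 + τ) / γ) * (‖u 0 0‖ + ‖u 1 0‖ + ‖u 2 0‖) := by
  have hsum : ‖γ • u 0 0 + u 1 0 + τ • u 2 0‖ ≤
      (γ + 1 + τ) * (‖u 0 0‖ + ‖u 1 0‖ + ‖u 2 0‖) := by
    calc _ ≤ γ * ‖u 0 0‖ + ‖u 1 0‖ + τ * ‖u 2 0‖ := by
          refine norm_add₃_le.trans_eq ?_
          rw [norm_smul, norm_smul, Real.norm_of_nonneg hγ.le, Real.norm_of_nonneg hτ]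
      _ ≤ _ := by nlinarith [norm_nonneg (u 0 0), norm_nonneg (u 1 0), norm_nonneg (u 2 0)]
  rw [slowMean, norm_smul, Real.norm_of_nonneg (inv_nonneg.2 hγ.le)]
  refine (mul_le_mul_of_nonneg_left hsum (inv_nonneg.2 hγ.le)).trans_eq ?_
  field_simp
  ring

theorem IsSlowRoot.norm_slowCoefficient_sub_slowMean_le (h : IsSlowRoot τ δ γ x μ) (hτ : 0 ≤ τ)
    (hδ : 0 ≤ δ) (hγ : 0 < γ) (hx : 0 < x) (u : Fin 3 → ℝ → V) :
    ‖slowCoefficient τ x μ u - slowMean τ γ u‖ ≤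
      4 / γ * ((δ + τ + 3 / γ + 2 * τ / γ) + (δ + τ + 5 / γ) * (1 + (1 + τ) / γ)) *
        (x * (‖u 0 0‖ + ‖u 1 0‖ + ‖u 2 0‖)) := by
  set S : ℝ := ‖u 0 0‖ + ‖u 1 0‖ + ‖u 2 0‖
  set Q : ℝ := 2 * τ * μ ^ 2 - μ + x / μ
  have hμ : 0 < μ := h.pos hγ hx
  have hQ : γ / 4 ≤ Q := h.quarter_le hτ hγ hx
  have hQpos : 0 < Q := by linarith
  have hdiv := h.abs_div_sub_le hτ hδ hγ hx
  have hsplit : slowCoefficient τ x μ u - slowMean τ γ u =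
      Q⁻¹ • ((x / μ - γ) • u 0 0 - (τ * μ) • u 1 0 + (γ - Q) • slowMean τ γ u) := by
    have hA : γ • slowMean τ γ u = γ • u 0 0 + u 1 0 + τ • u 2 0 := smul_inv_smul₀ hγ.ne' _
    have hnum : τ • u 2 0 + (1 - τ * μ) • u 1 0 + (x / μ) • u 0 0 =
        (x / μ - γ) • u 0 0 - (τ * μ) • u 1 0 + γ • slowMean τ γ u := by
      rw [hA]
      module
    rw [slowCoefficient, hnum, eq_inv_smul_iff₀ hQpos.ne', smul_sub, smul_inv_smul₀ hQpos.ne']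
    module
  have hQγ : |γ - Q| ≤ (δ + τ + 5 / γ) * x := by
    have hlow : 0 ≤ 2 * τ * μ ^ 2 := by positivity
    have hhigh : 2 * τ * μ ^ 2 ≤ μ := by nlinarith [h.mul_le_half]
    have hupper : μ ≤ 2 / γ * x := h.upper
    have h5 : (δ + τ + 5 / γ) * x = (δ + τ + 3 / γ) * x + 2 / γ * x := by ring
    rw [abs_le] at hdiv ⊢
    constructor <;> linarith [hdiv.1, hdiv.2]
  rw [hsplit, norm_smul, Real.norm_of_nonneg (inv_nonneg.2 hQpos.le), mul_assoc (4 / γ)]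
  refine mul_le_mul ((inv_anti₀ (by positivity) hQ).trans_eq (inv_div γ 4)) ?_
    (norm_nonneg _) (by positivity)
  calc _ ≤ |x / μ - γ| * ‖u 0 0‖ + τ * μ * ‖u 1 0‖ + |γ - Q| * ‖slowMean τ γ u‖ := by
        refine (norm_add_le _ _).trans (add_le_add ((norm_sub_le _ _).trans_eq ?_)
          (norm_smul _ _).le)
        rw [norm_smul, norm_smul, Real.norm_eq_abs, Real.norm_of_nonneg (by positivity)]
    _ ≤ (δ + τ + 3 / γ) * x * S + τ * (2 / γ * x) * S +
          (δ + τ + 5 / γ) * x * ((1 + (1 + τ) / γ) * S) := by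
        gcongr ?_ * ?_ + τ * ?_ * ?_ + ?_ * ?_
        · linarith [norm_nonneg (u 1 0), norm_nonneg (u 2 0)]
        · exact h.upper
        · linarith [norm_nonneg (u 0 0), norm_nonneg (u 2 0)]
        · exact norm_slowMean_le hτ hγ u
    _ = _ := by ring

theorem IsSlowRoot.norm_slow_sub_le (h : IsSlowRoot τ δ γ x μ) (hτ : 0 ≤ τ) (hδ : 0 ≤ δ)
    (hγ : 0 < γ) (hx : 0 < x) (u : Fin 3 → ℝ → V) {t : ℝ} (ht : 0 ≤ t) (j : ℕ) :
    ‖((-μ) ^ j * Real.exp (-μ * t)) • slowCoefficient τ x μ u -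
        ((-(x / γ)) ^ j * Real.exp (-(x / γ) * t)) • slowMean τ γ u‖ ≤
      (2 / γ) ^ j * (4 / γ * ((δ + τ + 3 / γ + 2 * τ / γ) + (δ + τ + 5 / γ) * (1 + (1 + τ) / γ)) +
          (j + 8) * (((δ + τ) + 3 / γ) / γ) * (1 + (1 + τ) / γ)) *
        (x ^ (j + 1) * Real.exp (-(1 / (4 * γ)) * x * t)) * (‖u 0 0‖ + ‖u 1 0‖ + ‖u 2 0‖) := by
  set m : ℝ := (-μ) ^ j * Real.exp (-μ * t)
  set a : ℝ := (-(x / γ)) ^ j * Real.exp (-(x / γ) * t)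
  set D : ℝ := 4 / γ * ((δ + τ + 3 / γ + 2 * τ / γ) + (δ + τ + 5 / γ) * (1 + (1 + τ) / γ))
  set S : ℝ := ‖u 0 0‖ + ‖u 1 0‖ + ‖u 2 0‖
  have hμ : 0 < μ := h.pos hγ hx
  have hm : |m| ≤ (2 / γ * x) ^ j * Real.exp (-(1 / (4 * γ)) * x * t) := by
    have hrate : 1 / (4 * γ) * x ≤ μ :=
      calc 1 / (4 * γ) * x = x / (2 * γ) / 2 := by ring
        _ ≤ x / (2 * γ) := half_le_self (by positivity)
        _ ≤ μ := h.lower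
    rw [abs_mul, abs_pow, abs_neg, abs_of_pos hμ, Real.abs_exp]
    refine mul_le_mul (pow_le_pow_left₀ hμ.le h.upper j) (Real.exp_le_exp.2 ?_)
      (Real.exp_nonneg _) (by positivity)
    rw [neg_mul, neg_mul, neg_mul, neg_le_neg_iff]
    gcongr
  calc ‖m • slowCoefficient τ x μ u - a • slowMean τ γ u‖
      = ‖m • (slowCoefficient τ x μ u - slowMean τ γ u) + (m - a) • slowMean τ γ u‖ := by
        congr 1
        module
    _ ≤ |m| * ‖slowCoefficient τ x μ u - slowMean τ γ u‖ + |m - a| * ‖slowMean τ γ u‖ :=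
        (norm_add_le _ _).trans_eq (by rw [norm_smul, norm_smul, Real.norm_eq_abs,
          Real.norm_eq_abs])
    _ ≤ (2 / γ * x) ^ j * Real.exp (-(1 / (4 * γ)) * x * t) * (D * (x * S)) +
          (j + 8) * (2 / γ) ^ j * (((δ + τ) + 3 / γ) / γ) *
            (x ^ (j + 1) * Real.exp (-(1 / (4 * γ)) * x * t)) * ((1 + (1 + τ) / γ) * S) := by
        gcongr ?_ * ?_ + ?_ * ?_
        · exact h.norm_slowCoefficient_sub_slowMean_le hτ hδ hγ hx u
        · exact h.abs_mode_sub_le hτ hδ hγ hx ht j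
        · exact norm_slowMean_le hτ hγ u
    _ = _ := by ring

/-- The heat-like mode `exp (-x t / γ)` is the leading term of every solution at low frequency:
the slow root is `-x / γ` up to `O(x²)`, and the other two roots stay away from the imaginary
axis. -/
theorem exists_mode_asymptotics_low (hτ : 0 < τ) (hδ : 0 < δ) (hγ : 0 < γ) :
    ∃ e C c : ℝ, 0 < e ∧ 0 < C ∧ 0 < c ∧ ∀ x, 0 < x → x ≤ e → ∀ u : Fin 3 → ℝ → V,
      IsModeSolution τ δ γ x u → ∀ t, 0 ≤ t → ∀ j : Fin 3,
        ‖u j t - ((-(x / γ)) ^ (j : ℕ) * Real.exp (-(x / γ) * t)) • slowMean τ γ u‖ ≤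
          C * (x ^ ((j : ℕ) + 1) * Real.exp (-c * x * t) + Real.exp (-c * t)) *
            (‖u 0 0‖ + ‖u 1 0‖ + ‖u 2 0‖) := by
  obtain ⟨e, he, hroot⟩ := mem_nhdsGT_iff_exists_Ioc_subset.1
    (eventually_exists_isSlowRoot hτ hδ hγ)
  obtain ⟨C₁, c₁, hC₁, hc₁, hfast⟩ := exists_fastPart_decay (V := V) hτ hγ δ
  set D : ℕ → ℝ := fun j ↦ (2 / γ) ^ j *
    (4 / γ * ((δ + τ + 3 / γ + 2 * τ / γ) + (δ + τ + 5 / γ) * (1 + (1 + τ) / γ)) +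
      (j + 8) * (((δ + τ) + 3 / γ) / γ) * (1 + (1 + τ) / γ))
  have hDpos (j : ℕ) : 0 < D j := by positivity
  refine ⟨e, ∑ k : Fin 3, D k + C₁, min (1 / (4 * γ)) c₁, he,
    add_pos_of_nonneg_of_pos (Finset.sum_nonneg fun k _ ↦ (hDpos k).le) hC₁, by positivity,
    fun x hx hxe u hu t ht j ↦ ?_⟩
  obtain ⟨μ, h⟩ := hroot ⟨hx, hxe⟩
  set c : ℝ := min (1 / (4 * γ)) c₁
  have hDj : D j ≤ ∑ k : Fin 3, D k :=
    Finset.single_le_sum (f := fun k : Fin 3 ↦ D k) (fun k _ ↦ (hDpos k).le) (Finset.mem_univ j)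
  generalize hS : ‖u 0 0‖ + ‖u 1 0‖ + ‖u 2 0‖ = S
  have hS0 : 0 ≤ S := hS ▸ by positivity
  have hexp {a b y : ℝ} (hab : a ≤ b) (hy : 0 ≤ y) : Real.exp (-b * y) ≤ Real.exp (-a * y) :=
    Real.exp_le_exp.2 (mul_le_mul_of_nonneg_right (neg_le_neg hab) hy)
  calc _ ≤ ‖fastPart τ x μ u j t‖ +
          ‖((-μ) ^ (j : ℕ) * Real.exp (-μ * t)) • slowCoefficient τ x μ u -
            ((-(x / γ)) ^ (j : ℕ) * Real.exp (-(x / γ) * t)) • slowMean τ γ u‖ := by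
        refine (congrArg norm ?_).trans_le (norm_add_le _ _)
        rw [fastPart]
        abel
    _ ≤ C₁ * Real.exp (-c₁ * t) * S +
          D j * (x ^ ((j : ℕ) + 1) * Real.exp (-(1 / (4 * γ)) * x * t)) * S :=
        hS ▸ add_le_add (hfast x μ hx h u hu t ht j) (h.norm_slow_sub_le hτ.le hδ.le hγ hx u ht j)
    _ ≤ C₁ * Real.exp (-c * t) * S +
          (∑ k : Fin 3, D k) * (x ^ ((j : ℕ) + 1) * Real.exp (-c * x * t)) * S := by
        have hslow := hexp (min_le_left (1 / (4 * γ)) c₁) (mul_nonneg hx.le ht)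
        rw [← mul_assoc, ← mul_assoc] at hslow
        gcongr ?_ * ?_ * _ + ?_ * (_ * ?_) * _
        exact hexp (min_le_right _ _) ht
    _ ≤ (∑ k : Fin 3, D k + C₁) *
          (x ^ ((j : ℕ) + 1) * Real.exp (-c * x * t) + Real.exp (-c * t)) * S := by
        have hE : 0 ≤ Real.exp (-c * t) := by positivity
        have hX : 0 ≤ x ^ ((j : ℕ) + 1) * Real.exp (-c * x * t) := by positivity
        rw [← add_mul]
        refine mul_le_mul_of_nonneg_right ?_ hS0
        linarith [mul_nonneg hC₁.le hX, mul_nonneg ((hDpos j).le.trans hDj) hE]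

end LowFrequency

/-! ### Fourier transforms that are functions -/

section FourierFunctions

variable {n : ℕ}

/-- A smooth real function of compact support, as a complex Schwartz function. -/
noncomputable def schwartzOfTestFunction {θ : Rn n → ℝ} (hθ : HasCompactSupport θ)
    (hθ' : ContDiff ℝ (↑(⊤ : ℕ∞)) θ) : 𝓢(Rn n, ℂ) :=
  HasCompactSupport.toSchwartzMap (hθ.comp_left (g := Complex.ofRealCLM) rfl)
    (Complex.ofRealCLM.contDiff.comp hθ')

@[simp]
theorem schwartzOfTestFunction_apply {θ : Rn n → ℝ} (hθ : HasCompactSupport θ)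
    (hθ' : ContDiff ℝ (↑(⊤ : ℕ∞)) θ) (ξ : Rn n) :
    schwartzOfTestFunction hθ hθ' ξ = θ ξ := rfl

namespace HasFourierFunction

theorem locallyIntegrable {u : 𝓢'(Rn n, ℂ)} {g : Rn n → ℂ} (h : HasFourierFunction u g) :
    LocallyIntegrable g := by
  rw [MeasureTheory.locallyIntegrable_iff]
  intro k hk
  obtain ⟨R, hR0, hR⟩ := hk.isBounded.subset_closedBall_lt 0 0
  let b : ContDiffBump (0 : Rn n) := ⟨R, R + 1, hR0, by linarith⟩
  refine ((h (schwartzOfTestFunction b.hasCompactSupport b.contDiff)).1.integrableOn).congr_fun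
    (fun ξ hξ ↦ ?_) hk.measurableSet
  simp [b.one_of_mem_closedBall (hR hξ)]

theorem ae_unique {u : 𝓢'(Rn n, ℂ)} {g₁ g₂ : Rn n → ℂ} (h₁ : HasFourierFunction u g₁)
    (h₂ : HasFourierFunction u g₂) : g₁ =ᵐ[volume] g₂ := by
  have hzero := ae_eq_zero_of_integral_contDiff_smul_eq_zero
    (h₁.locallyIntegrable.sub h₂.locallyIntegrable) (fun θ hθ hθ' ↦ ?_)
  · filter_upwards [hzero] with ξ hξ using sub_eq_zero.1 hξ
  · have e₁ := h₁ (schwartzOfTestFunction hθ' hθ)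
    have e₂ := h₂ (schwartzOfTestFunction hθ' hθ)
    simp only [schwartzOfTestFunction_apply] at e₁ e₂
    simp only [Pi.sub_apply, Complex.real_smul, mul_sub]
    rw [integral_sub e₁.1 e₂.1, ← e₁.2, ← e₂.2, sub_self]

theorem weightedFourierNorm_eq {u : 𝓢'(Rn n, ℂ)} {g : Rn n → ℂ} (h : HasFourierFunction u g)
    (w : Rn n → ℝ) :
    weightedFourierNorm w u = eLpNorm (fun ξ ↦ (w ξ : ℂ) * g ξ) 2 volume := by
  refine le_antisymm (iInf₂_le g h) (le_iInf₂ fun g' h' ↦ (eLpNorm_congr_ae ?_).le)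
  filter_upwards [h.ae_unique h'] with ξ hξ
  rw [hξ]

theorem congr_ae {u : 𝓢'(Rn n, ℂ)} {g₁ g₂ : Rn n → ℂ} (h : HasFourierFunction u g₁)
    (hg : g₁ =ᵐ[volume] g₂) : HasFourierFunction u g₂ := fun θ ↦ by
  have hθ : (fun ξ ↦ θ ξ * g₁ ξ) =ᵐ[volume] fun ξ ↦ θ ξ * g₂ ξ := by
    filter_upwards [hg] with ξ hξ
    rw [hξ]
  exact ⟨(h θ).1.congr hθ, (h θ).2.trans (integral_congr_ae hθ)⟩

theorem sub {u v : 𝓢'(Rn n, ℂ)} {g k : Rn n → ℂ} (hu : HasFourierFunction u g)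
    (hv : HasFourierFunction v k) : HasFourierFunction (u - v) (fun ξ ↦ g ξ - k ξ) := fun θ ↦ by
  simp only [mul_sub]
  refine ⟨(hu θ).1.sub (hv θ).1, ?_⟩
  rw [integral_sub (hu θ).1 (hv θ).1, ← (hu θ).2, ← (hv θ).2]
  rfl

theorem smul {u : 𝓢'(Rn n, ℂ)} {g : Rn n → ℂ} (hu : HasFourierFunction u g) (c : ℂ) :
    HasFourierFunction (c • u) (fun ξ ↦ c * g ξ) := fun θ ↦ by
  simp only [mul_left_comm _ c]
  refine ⟨(hu θ).1.const_mul c, ?_⟩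
  rw [integral_const_mul, ← (hu θ).2]
  rfl

theorem neg_laplacian {u : 𝓢'(Rn n, ℂ)} {g : Rn n → ℂ} (hu : HasFourierFunction u g) :
    HasFourierFunction (-Δ u) (fun ξ ↦ (((2 * Real.pi * ‖ξ‖) ^ 2 : ℝ) : ℂ) * g ξ) := fun θ ↦ by
  set m : Rn n → ℂ := fun ξ ↦ ((‖ξ‖ ^ 2 : ℝ) : ℂ)
  have hm : m.HasTemperateGrowth := by fun_prop
  set θ' : 𝓢(Rn n, ℂ) := SchwartzMap.smulLeftCLM ℂ m θ
  have hθ (ξ : Rn n) : θ ξ * ((((2 * Real.pi * ‖ξ‖) ^ 2 : ℝ) : ℂ) * g ξ) =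
      (((2 * Real.pi) ^ 2 : ℝ) : ℂ) * (θ' ξ * g ξ) := by
    rw [SchwartzMap.smulLeftCLM_apply_apply hm, smul_eq_mul]
    push_cast [m]
    ring
  simp_rw [hθ]
  refine ⟨(hu θ').1.const_mul _, ?_⟩
  rw [integral_const_mul, ← (hu θ').2, TemperedDistribution.laplacian_eq_fourierMultiplierCLM,
    TemperedDistribution.fourier_apply, TemperedDistribution.fourierMultiplierCLM_apply, neg_smul,
    neg_neg]
  change (2 * Real.pi) ^ 2 •
    (𝓕⁻ (TemperedDistribution.smulLeftCLM ℂ m (𝓕 u))) (𝓕 θ) = _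
  rw [TemperedDistribution.fourierInv_apply, FourierTransform.fourierInv_fourier_eq,
    TemperedDistribution.smulLeftCLM_apply_apply, Complex.real_smul]

end HasFourierFunction

theorem hasFourierFunction_of_Lp_one (f : Lp ℂ 1 (volume : Measure (Rn n))) :
    HasFourierFunction (f : 𝓢'(Rn n, ℂ)) (Real.Lp.fourierTransform f) := fun θ ↦ by
  refine ⟨θ.integrable.mul_bdd (c := ‖Real.Lp.fourierTransform f‖)
    (Real.Lp.fourierTransform f).continuous.aestronglyMeasurable
    (Eventually.of_forall fun ξ ↦ (Real.Lp.fourierTransform f).norm_coe_le_norm ξ), ?_⟩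
  rw [TemperedDistribution.fourier_apply, Lp.toTemperedDistribution_apply]
  have hflip := VectorFourier.integral_fourierIntegral_smul_eq_flip (μ := volume) (ν := volume)
    (L := innerₗ (Rn n)) (f := θ) (g := (f : Rn n → ℂ)) Real.continuous_fourierChar
    (by exact continuous_inner) θ.integrable (L1.integrable_coeFn f)
  simp only [smul_eq_mul, flip_innerₗ] at hflip ⊢
  exact hflip

theorem one_add_two_pi_mul_sq_rpow_le (ρ r : ℝ) :
    (1 + (2 * Real.pi * ρ) ^ 2) ^ r ≤ (1 + (2 * Real.pi) ^ 2) ^ |r| * (1 + ρ ^ 2) ^ r := by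
  have hone : 1 ≤ (1 + (2 * Real.pi * ρ) ^ 2) / (1 + ρ ^ 2) := by
    have : 1 ≤ (2 * Real.pi) ^ 2 := one_le_pow₀ (by linarith [Real.pi_gt_three])
    rw [le_div_iff₀ (by positivity), mul_pow]
    nlinarith [sq_nonneg ρ]
  have hle : (1 + (2 * Real.pi * ρ) ^ 2) / (1 + ρ ^ 2) ≤ 1 + (2 * Real.pi) ^ 2 := by
    rw [div_le_iff₀ (by positivity), mul_pow]
    nlinarith [sq_nonneg ρ]
  rw [← div_le_iff₀ (by positivity), ← Real.div_rpow (by positivity) (by positivity)]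
  exact (Real.rpow_le_rpow_of_exponent_le hone (le_abs_self r)).trans
    (Real.rpow_le_rpow (by positivity) hle (abs_nonneg r))

/-- Membership in `H^r` is stated in Mathlib through the weight `(1 + |ξ|²)^{r/2}` in the ordinary
frequency, and `sobolevNorm` uses the angular frequency `2 π ξ`. -/
theorem exists_hasFourierFunction_of_memSobolev {r : ℝ} {u : 𝓢'(Rn n, ℂ)}
    (hu : TemperedDistribution.MemSobolev r 2 u) :
    ∃ g : Rn n → ℂ, HasFourierFunction u g ∧ sobolevNorm r u ≠ ∞ := by
  obtain ⟨F, hF⟩ := TemperedDistribution.memSobolev_iff_exists_smulLeftCLM_fourier.1 hu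
  have hpos : (fun ξ : Rn n ↦ (((1 + ‖ξ‖ ^ 2) ^ (r / 2) : ℝ) : ℂ)).HasTemperateGrowth := by
    fun_prop
  have hneg : (fun ξ : Rn n ↦ (((1 + ‖ξ‖ ^ 2) ^ (-(r / 2)) : ℝ) : ℂ)).HasTemperateGrowth := by
    fun_prop
  have hcancel (ξ : Rn n) : (1 + ‖ξ‖ ^ 2) ^ (r / 2) * (1 + ‖ξ‖ ^ 2) ^ (-(r / 2)) = 1 := by
    rw [← Real.rpow_add (by positivity), add_neg_cancel, Real.rpow_zero]
  have hg : HasFourierFunction u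
      (fun ξ ↦ (((1 + ‖ξ‖ ^ 2) ^ (-(r / 2)) : ℝ) : ℂ) * F ξ) := fun θ ↦ by
    set θ' : 𝓢(Rn n, ℂ) :=
      SchwartzMap.smulLeftCLM ℂ (fun ξ : Rn n ↦ (((1 + ‖ξ‖ ^ 2) ^ (-(r / 2)) : ℝ) : ℂ)) θ with hθ'
    have hθ (ξ : Rn n) : θ ξ * ((((1 + ‖ξ‖ ^ 2) ^ (-(r / 2)) : ℝ) : ℂ) * F ξ) = θ' ξ * F ξ := by
      rw [hθ', SchwartzMap.smulLeftCLM_apply_apply hneg, smul_eq_mul]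
      ring
    simp_rw [hθ]
    refine ⟨(θ'.memLp 2).integrable_mul (Lp.memLp F), ?_⟩
    have hFθ : (F : 𝓢'(Rn n, ℂ)) θ' = ∫ ξ, θ' ξ * F ξ := Lp.toTemperedDistribution_apply ..
    rw [← hFθ, ← hF, TemperedDistribution.smulLeftCLM_apply_apply]
    congr 1
    ext ξ
    rw [SchwartzMap.smulLeftCLM_apply_apply hpos, hθ', SchwartzMap.smulLeftCLM_apply_apply hneg,
      smul_smul, ← Complex.ofReal_mul, hcancel, Complex.ofReal_one, one_smul]
  refine ⟨_, hg, ne_top_of_le_ne_top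
    (ENNReal.mul_ne_top ENNReal.ofReal_ne_top (Lp.memLp F).eLpNorm_ne_top)
    ((hg.weightedFourierNorm_eq _).trans_le (eLpNorm_le_mul_eLpNorm_of_ae_le_mul
      (c := (1 + (2 * Real.pi) ^ 2) ^ |r / 2|) (Eventually.of_forall fun ξ ↦ ?_) 2))⟩
  rw [← mul_assoc, ← Complex.ofReal_mul, norm_mul, Complex.norm_real,
    Real.norm_of_nonneg (by positivity)]
  refine mul_le_mul_of_nonneg_right ?_ (norm_nonneg _)
  rw [Real.rpow_neg (by positivity), ← div_eq_mul_inv, div_le_iff₀ (by positivity)]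
  exact one_add_two_pi_mul_sq_rpow_le ‖ξ‖ (r / 2)

theorem gaussianProfile_eq (γ t : ℝ) : gaussianProfile n γ t = fun x ↦
    ((γ⁻¹ * (γ / (4 * Real.pi * t)) ^ ((n : ℝ) / 2) : ℝ) : ℂ) *
      Complex.exp (-((γ / (4 * t) : ℝ) : ℂ) * (‖x‖ : ℂ) ^ 2) := by
  funext x
  rw [gaussianProfile, Complex.ofReal_mul, Complex.ofReal_exp]
  congr 2
  push_cast
  ring

theorem hasFourierFunction_gaussianDistribution {γ t : ℝ} (hγ : 0 < γ) (ht : 0 < t) :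
    HasFourierFunction (gaussianDistribution n γ t)
      (fun ξ ↦ ((γ⁻¹ * Real.exp (-((2 * Real.pi * ‖ξ‖) ^ 2 / γ) * t) : ℝ) : ℂ)) := by
  rw [gaussianDistribution, dif_pos ⟨hγ, ht⟩]
  refine (hasFourierFunction_of_Lp_one _).congr_ae (Eventually.of_forall fun ξ ↦ ?_)
  rw [Real.fourierTransform_toLp, gaussianProfile_eq]
  set b : ℝ := γ / (4 * t) with hb
  have hb0 : 0 < b := by positivity
  have hpow : ((Real.pi : ℂ) / (b : ℂ)) ^ ((n : ℂ) / 2) =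
      (((Real.pi / b) ^ ((n : ℝ) / 2) : ℝ) : ℂ) := by
    rw [Complex.ofReal_cpow (by positivity)]
    push_cast
    rfl
  have hexp : Complex.exp (-(Real.pi : ℂ) ^ 2 * (‖ξ‖ : ℂ) ^ 2 / (b : ℂ)) =
      ((Real.exp (-((2 * Real.pi * ‖ξ‖) ^ 2 / γ) * t) : ℝ) : ℂ) := by
    have hreal : -Real.pi ^ 2 * ‖ξ‖ ^ 2 / b = -((2 * Real.pi * ‖ξ‖) ^ 2 / γ) * t := by
      rw [hb]
      field_simp
      ring
    rw [← hreal]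
    push_cast
    rfl
  have hscale : (γ / (4 * Real.pi * t)) ^ ((n : ℝ) / 2) * (Real.pi / b) ^ ((n : ℝ) / 2) = 1 := by
    rw [← Real.mul_rpow (by positivity) (by positivity),
      show γ / (4 * Real.pi * t) * (Real.pi / b) = 1 by rw [hb]; field_simp, Real.one_rpow]
  calc _ = ((γ⁻¹ * (γ / (4 * Real.pi * t)) ^ ((n : ℝ) / 2) : ℝ) : ℂ) *
        𝓕 (fun x : Rn n ↦ Complex.exp (-(b : ℂ) * (‖x‖ : ℂ) ^ 2)) ξ := by
        rw [Real.fourier_eq, Real.fourier_eq, ← integral_const_mul]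
        simp only [mul_smul_comm]
    _ = _ := by
        rw [fourier_gaussian_innerProductSpace (by simpa using hb0), finrank_euclideanSpace_fin,
          hpow, hexp, ← Complex.ofReal_mul, ← Complex.ofReal_mul, mul_assoc,
          ← mul_assoc _ _ (Real.exp _), hscale, one_mul]

/-- The symbol `∂_t^j exp (-ρ² t / γ)` of the diffusive part at the angular frequency `ρ`. -/
noncomputable def diffusionMultiplier (γ : ℝ) (j : ℕ) (t ρ : ℝ) : ℝ :=
  (-(ρ ^ 2 / γ)) ^ j * Real.exp (-(ρ ^ 2 / γ) * t)

theorem hasFourierFunction_diffusionProfile {γ t : ℝ} (hγ : 0 < γ) (ht : 0 < t) (j : ℕ) :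
    HasFourierFunction (diffusionProfile n γ j t)
      (fun ξ ↦ diffusionMultiplier γ j t (2 * Real.pi * ‖ξ‖) • ((γ⁻¹ : ℝ) : ℂ)) := by
  have hiter (j : ℕ) : HasFourierFunction
      ((fun u : 𝓢'(Rn n, ℂ) ↦ -Δ u)^[j] (gaussianDistribution n γ t))
      (fun ξ ↦ ((((2 * Real.pi * ‖ξ‖) ^ 2) ^ j *
        (γ⁻¹ * Real.exp (-((2 * Real.pi * ‖ξ‖) ^ 2 / γ) * t)) : ℝ) : ℂ)) := by
    induction j with
    | zero =>
      simpa only [pow_zero, one_mul, Function.iterate_zero_apply] using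
        hasFourierFunction_gaussianDistribution hγ ht
    | succ j ih =>
      rw [Function.iterate_succ_apply']
      refine ih.neg_laplacian.congr_ae (Eventually.of_forall fun ξ ↦ ?_)
      push_cast
      ring
  refine ((hiter j).smul _).congr_ae (Eventually.of_forall fun ξ ↦ ?_)
  have hpow : (-((2 * Real.pi * ‖ξ‖) ^ 2 / γ)) ^ j =
      (-γ)⁻¹ ^ j * ((2 * Real.pi * ‖ξ‖) ^ 2) ^ j := by
    rw [← mul_pow, inv_neg, neg_mul, inv_mul_eq_div]
  simp only [diffusionMultiplier, hpow, Complex.real_smul]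
  push_cast
  ring

end FourierFunctions

section Localization

variable {n : ℕ}

/-- Lebesgue measure on the ball of radius `R` in frequency space, where the symbol of `-Δ` is
bounded. -/
noncomputable abbrev ballMeasure (n : ℕ) (R : ℝ) : Measure (Rn n) :=
  volume.restrict (Metric.ball 0 R)

instance isFiniteMeasure_ballMeasure (R : ℝ) : IsFiniteMeasure (ballMeasure n R) :=
  ⟨by simpa using measure_ball_lt_top⟩

theorem HasFourierFunction.eLpNorm_ball_le {u : 𝓢'(Rn n, ℂ)} {g : Rn n → ℂ}
    (hu : HasFourierFunction u g) (R r : ℝ) :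
    eLpNorm g 2 (ballMeasure n R) ≤
      ENNReal.ofReal ((1 + (2 * Real.pi * R) ^ 2) ^ |r / 2|) * sobolevNorm r u := by
  rw [sobolevNorm, hu.weightedFourierNorm_eq]
  refine le_trans (eLpNorm_le_mul_eLpNorm_of_ae_le_mul ?_ 2) (mul_le_mul_right
    (eLpNorm_mono_measure _ (Measure.restrict_le_self (s := Metric.ball 0 R))) _)
  filter_upwards [ae_restrict_mem measurableSet_ball] with ξ hξ
  rw [norm_mul, Complex.norm_real, Real.norm_of_nonneg (by positivity), ← mul_assoc]
  refine le_mul_of_one_le_left (norm_nonneg _) ?_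
  have hξR : ‖ξ‖ ≤ R := (mem_ball_zero_iff.1 hξ).le
  set a : ℝ := 1 + (2 * Real.pi * ‖ξ‖) ^ 2
  have ha : 1 ≤ a := le_add_of_nonneg_right (sq_nonneg _)
  calc (1 : ℝ) ≤ a ^ (|r / 2| + r / 2) :=
        Real.one_le_rpow ha (by linarith [neg_abs_le (r / 2)])
    _ = a ^ |r / 2| * a ^ (r / 2) := Real.rpow_add (by positivity) _ _
    _ ≤ _ := by simp only [a]; gcongr

theorem HasFourierFunction.memLp_ball {u : 𝓢'(Rn n, ℂ)} {g : Rn n → ℂ}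
    (hu : HasFourierFunction u g) {r : ℝ} (hr : sobolevNorm r u ≠ ∞) (R : ℝ) :
    MemLp g 2 (ballMeasure n R) :=
  ⟨hu.locallyIntegrable.aestronglyMeasurable.restrict,
    (hu.eLpNorm_ball_le R r).trans_lt (ENNReal.mul_lt_top ENNReal.ofReal_lt_top hr.lt_top)⟩

theorem HasFourierFunction.enorm_le_sobolevNorm {u : 𝓢'(Rn n, ℂ)} {g : Rn n → ℂ}
    (hu : HasFourierFunction u g) {R : ℝ} {y : Lp ℂ 2 (ballMeasure n R)}
    (hy : y =ᵐ[ballMeasure n R] g) (r : ℝ) :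
    ‖y‖ₑ ≤ ENNReal.ofReal ((1 + (2 * Real.pi * R) ^ 2) ^ |r / 2|) * sobolevNorm r u := by
  rw [Lp.enorm_def, eLpNorm_congr_ae hy]
  exact hu.eLpNorm_ball_le R r

/-- Testing an `L²` function on a ball against a Schwartz function. -/
noncomputable def ballPairing (R : ℝ) (θ : 𝓢(Rn n, ℂ)) : Lp ℂ 2 (ballMeasure n R) →L[ℝ] ℂ :=
  ((ContinuousLinearMap.mul ℂ ℂ).lpPairing (ballMeasure n R) 2 2
    (((θ.memLp 2).restrict _).toLp θ)).restrictScalars ℝ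

theorem ballPairing_apply (R : ℝ) (θ : 𝓢(Rn n, ℂ)) (y : Lp ℂ 2 (ballMeasure n R)) :
    ballPairing R θ y = ∫ ξ, θ ξ * y ξ ∂(ballMeasure n R) := by
  rw [ballPairing, ContinuousLinearMap.coe_restrictScalars',
    ContinuousLinearMap.lpPairing_eq_integral]
  refine integral_congr_ae ?_
  filter_upwards [((θ.memLp 2).restrict (Metric.ball 0 R)).coeFn_toLp] with ξ hξ
  rw [hξ]
  rfl

theorem ballPairing_eq_integral {R : ℝ} {θ : 𝓢(Rn n, ℂ)} (hθ : tsupport θ ⊆ Metric.ball 0 R)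
    {g : Rn n → ℂ} {y : Lp ℂ 2 (ballMeasure n R)} (hy : y =ᵐ[ballMeasure n R] g) :
    ballPairing R θ y = ∫ ξ, θ ξ * g ξ := by
  have hout (ξ : Rn n) (hξ : ξ ∉ Metric.ball 0 R) : θ ξ * g ξ = 0 := by
    rw [image_eq_zero_of_notMem_tsupport fun h ↦ hξ (hθ h), zero_mul]
  rw [ballPairing_apply, ← setIntegral_eq_integral_of_forall_compl_eq_zero hout]
  refine integral_congr_ae ?_
  filter_upwards [hy] with ξ hξ
  rw [hξ]

theorem ballPairing_eq_fourier {R : ℝ} {θ : 𝓢(Rn n, ℂ)} (hθ : tsupport θ ⊆ Metric.ball 0 R)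
    {u : 𝓢'(Rn n, ℂ)} {g : Rn n → ℂ} (hu : HasFourierFunction u g)
    {y : Lp ℂ 2 (ballMeasure n R)} (hy : y =ᵐ[ballMeasure n R] g) :
    ballPairing R θ y = u (𝓕 θ) := by
  rw [← TemperedDistribution.fourier_apply, (hu θ).2, ballPairing_eq_integral hθ hy]

theorem eq_zero_of_ballPairing_eq_zero {R : ℝ} {y : Lp ℂ 2 (ballMeasure n R)}
    (hy : ∀ θ : {θ : 𝓢(Rn n, ℂ) // tsupport θ ⊆ Metric.ball 0 R}, ballPairing R θ.1 y = 0) :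
    y = 0 := by
  rw [Lp.eq_zero_iff_ae_eq_zero]
  refine (ae_restrict_iff' measurableSet_ball).2 ?_
  have hint : IntegrableOn y (Metric.ball 0 R) := (Lp.memLp y).integrable (by norm_num)
  refine Metric.isOpen_ball.ae_eq_zero_of_integral_contDiff_smul_eq_zero
    hint.locallyIntegrableOn fun θ hθ hθ' hsupp ↦ ?_
  have hsupp' : tsupport (schwartzOfTestFunction hθ' hθ) ⊆ Metric.ball 0 R :=
    (closure_mono fun ξ hξ ↦ by simpa using hξ).trans hsupp
  rw [← hy ⟨_, hsupp'⟩, ballPairing_eq_integral hsupp' ae_eq_rfl]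
  rfl

/-- The symbol of `-Δ`, truncated to a bounded function outside the ball of radius `R`. -/
noncomputable def truncatedSymbol (n : ℕ) (R : ℝ) : BoundedContinuousFunction (Rn n) ℂ :=
  BoundedContinuousFunction.ofNormedAddCommGroup
    (fun ξ ↦ ((min ((2 * Real.pi * ‖ξ‖) ^ 2) ((2 * Real.pi * R) ^ 2) : ℝ) : ℂ))
    (Complex.continuous_ofReal.comp (by fun_prop)) ((2 * Real.pi * R) ^ 2) fun ξ ↦ by
      rw [Complex.norm_real, Real.norm_of_nonneg (by positivity)]
      exact min_le_right _ _

theorem truncatedSymbol_apply {R : ℝ} {ξ : Rn n} (hξ : ξ ∈ Metric.ball 0 R) :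
    truncatedSymbol n R ξ = (((2 * Real.pi * ‖ξ‖) ^ 2 : ℝ) : ℂ) := by
  have hξR : ‖ξ‖ ≤ R := (mem_ball_zero_iff.1 hξ).le
  exact congrArg Complex.ofReal (min_eq_left (by gcongr))

/-- Multiplication by the truncated symbol on `L²` of a ball. -/
noncomputable def ballMul (n : ℕ) (R : ℝ) :
    Lp ℂ 2 (ballMeasure n R) →L[ℝ] Lp ℂ 2 (ballMeasure n R) :=
  ((ContinuousLinearMap.mul ℂ ℂ).holderL (ballMeasure n R) ∞ 2 2
    ((truncatedSymbol n R).memLp_top.toLp _)).restrictScalars ℝ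

theorem ballMul_apply (R : ℝ) (y : Lp ℂ 2 (ballMeasure n R)) :
    ballMul n R y =ᵐ[ballMeasure n R] fun ξ ↦ truncatedSymbol n R ξ * y ξ := by
  rw [ballMul, ContinuousLinearMap.coe_restrictScalars', ContinuousLinearMap.holderL_apply_apply]
  filter_upwards [(ContinuousLinearMap.mul ℂ ℂ).coeFn_holder (r := 2)
    ((truncatedSymbol n R).memLp_top.toLp _) y,
    (truncatedSymbol n R).memLp_top.coeFn_toLp (μ := ballMeasure n R)] with ξ hmul hsymbol
  rw [hmul, hsymbol]
  rfl

theorem ballMul_ae_eq_symbol (R : ℝ) {y : Lp ℂ 2 (ballMeasure n R)} {g : Rn n → ℂ}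
    (hy : y =ᵐ[ballMeasure n R] g) :
    ballMul n R y =ᵐ[ballMeasure n R] fun ξ ↦ (((2 * Real.pi * ‖ξ‖) ^ 2 : ℝ) : ℂ) * g ξ := by
  filter_upwards [ballMul_apply R y, hy, ae_restrict_mem measurableSet_ball] with ξ hmul hξ hmem
  rw [hmul, hξ, truncatedSymbol_apply hmem]

theorem ballMul_toLp (R : ℝ) (a : BoundedContinuousFunction (Rn n) ℂ) :
    ballMul n R (BoundedContinuousFunction.toLp 2 (ballMeasure n R) ℝ a) =
      BoundedContinuousFunction.toLp 2 (ballMeasure n R) ℝ (truncatedSymbol n R * a) := by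
  refine Lp.ext ?_
  filter_upwards [ballMul_apply R (BoundedContinuousFunction.toLp 2 (ballMeasure n R) ℝ a),
    BoundedContinuousFunction.coeFn_toLp 2 (ballMeasure n R) ℝ a,
    BoundedContinuousFunction.coeFn_toLp 2 (ballMeasure n R) ℝ (truncatedSymbol n R * a)]
    with ξ hmul ha hprod
  rw [hmul, ha, hprod]
  rfl

end Localization

/-! ### From the Sobolev solution to its Fourier modes -/

section AbstractModeSystem

variable {E F : Type*} [NormedAddCommGroup E] [NormedSpace ℝ E] [NormedAddCommGroup F]
  [NormedSpace ℝ F]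

/-- The generator of the first order system of the mode equation, with a bounded operator `M` in
place of the squared frequency. -/
noncomputable def modeGenerator (τ δ γ : ℝ) (M : E →L[ℝ] E) : (Fin 3 → E) →L[ℝ] (Fin 3 → E) :=
  ContinuousLinearMap.pi ![ContinuousLinearMap.proj 1, ContinuousLinearMap.proj 2,
    -(τ⁻¹ • (ContinuousLinearMap.proj 2 + γ • ContinuousLinearMap.proj 1
      + (δ + τ) • M ∘L ContinuousLinearMap.proj 1 + M ∘L ContinuousLinearMap.proj 0))]

@[simp]
theorem modeGenerator_apply_two (τ δ γ : ℝ) (M : E →L[ℝ] E) (w : Fin 3 → E) :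
    modeGenerator τ δ γ M w 2 =
      -(τ⁻¹ • (w 2 + γ • w 1 + (δ + τ) • M (w 1) + M (w 0))) := rfl

theorem hasDerivAt_modeGenerator_map {τ δ γ : ℝ} {M : E →L[ℝ] E} {M' : F →L[ℝ] F} (T : E →L[ℝ] F)
    (hT : ∀ y, T (M y) = M' (T y)) {U : ℝ → Fin 3 → E} {t : ℝ}
    (hU : HasDerivAt U (modeGenerator τ δ γ M (U t)) t) :
    HasDerivAt (fun r l ↦ T (U r l)) (modeGenerator τ δ γ M' fun l ↦ T (U t l)) t := by
  rw [hasDerivAt_pi]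
  intro l
  refine (T.hasFDerivAt.comp_hasDerivAt t (hasDerivAt_pi.1 hU l)).congr_deriv ?_
  fin_cases l
  · rfl
  · rfl
  · simp [hT]

theorem isModeSolution_of_hasDerivAt {V : Type*} [NormedAddCommGroup V] [InnerProductSpace ℝ V]
    {τ δ γ x : ℝ} {M : V →L[ℝ] V} (hM : ∀ y, M y = x • y) {U : ℝ → Fin 3 → V}
    (hU : ∀ t, HasDerivAt U (modeGenerator τ δ γ M (U t)) t) :
    IsModeSolution τ δ γ x (fun l t ↦ U t l) where
  deriv_zero t := hasDerivAt_pi.1 (hU t) 0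
  deriv_one t := hasDerivAt_pi.1 (hU t) 1
  deriv_two t := (hasDerivAt_pi.1 (hU t) 2).congr_deriv (by
    rw [modeGenerator_apply_two, hM, hM]
    module)

theorem exists_linear_flow [CompleteSpace E] (G : E →L[ℝ] E) (a : E) :
    ∃ U : ℝ → E, U 0 = a ∧ ∀ t, HasDerivAt U (G (U t)) t :=
  ⟨fun t ↦ NormedSpace.exp (t • G) a, by simp [NormedSpace.exp_zero], fun t ↦
    (ContinuousLinearMap.apply ℝ E a).hasFDerivAt.comp_hasDerivAt t
      (hasDerivAt_exp_smul_const' (𝕂 := ℝ) G t)⟩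

theorem linear_flow_unique (G : E →L[ℝ] E) {U W : ℝ → E} (h0 : U 0 = W 0)
    (hU : ∀ t, 0 ≤ t → HasDerivWithinAt U (G (U t)) (Set.Ici 0) t)
    (hW : ∀ t, 0 ≤ t → HasDerivWithinAt W (G (W t)) (Set.Ici 0) t) {t : ℝ} (ht : 0 ≤ t) :
    U t = W t := by
  refine ODE_solution_unique_of_mem_Icc_right (v := fun _ ↦ G) (s := fun _ ↦ Set.univ)
    (K := ‖G‖₊) (a := 0) (b := t) (fun _ _ ↦ G.lipschitz.lipschitzOnWith) ?_ ?_
    (fun _ _ ↦ Set.mem_univ _) ?_ ?_ (fun _ _ ↦ Set.mem_univ _) h0 ⟨ht, le_rfl⟩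
  · exact fun r hr ↦ ((hU r hr.1).continuousWithinAt).mono Set.Icc_subset_Ici_self
  · exact fun r hr ↦ (hU r hr.1).mono (Set.Ici_subset_Ici.2 hr.1)
  · exact fun r hr ↦ ((hW r hr.1).continuousWithinAt).mono Set.Icc_subset_Ici_self
  · exact fun r hr ↦ (hW r hr.1).mono (Set.Ici_subset_Ici.2 hr.1)

/-- A continuous function with a continuous derivative in the weak sense, with respect to a
separating family of functionals, is differentiable: both sides of the fundamental theorem of
calculus agree against every functional. -/
theorem hasDerivWithinAt_of_separating [CompleteSpace E] {ι : Type*} (ℓ : ι → E →L[ℝ] ℂ)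
    (hℓ : ∀ y, (∀ i, ℓ i y = 0) → y = 0) {w v : ℝ → E} (hw : ContinuousOn w (Set.Ici 0))
    (hv : ContinuousOn v (Set.Ici 0))
    (h : ∀ i t, 0 < t → HasDerivAt (fun r ↦ ℓ i (w r)) (ℓ i (v t)) t) {t : ℝ} (ht : 0 ≤ t) :
    HasDerivWithinAt w (v t) (Set.Ici 0) t := by
  set v' : ℝ → E := fun r ↦ v (max r 0)
  have hv'c : Continuous v' :=
    hv.comp_continuous (by fun_prop) fun r ↦ Set.mem_Ici.2 (le_max_right _ _)
  have hv'v (r : ℝ) (hr : 0 ≤ r) : v' r = v r := congrArg v (max_eq_left hr)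
  have hftc (r : ℝ) (hr : 0 ≤ r) : w r = w 0 + ∫ y in (0 : ℝ)..r, v' y := by
    rw [← sub_eq_zero]
    refine hℓ _ fun i ↦ ?_
    have hint : ∫ y in (0 : ℝ)..r, ℓ i (v' y) = ℓ i (w r) - ℓ i (w 0) :=
      intervalIntegral.integral_eq_sub_of_hasDerivAt_of_le hr
        ((ℓ i).continuous.comp_continuousOn (hw.mono Set.Icc_subset_Ici_self))
        (fun y hy ↦ by rw [hv'v y hy.1.le]; exact h i y hy.1)
        (((ℓ i).continuous.comp hv'c).intervalIntegrable _ _)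
    rw [(ℓ i).intervalIntegral_comp_comm (hv'c.intervalIntegrable _ _)] at hint
    rw [map_sub, map_add, hint]
    ring
  have hd : HasDerivAt (fun r ↦ w 0 + ∫ y in (0 : ℝ)..r, v' y) (v t) t := by
    rw [← hv'v t ht]
    exact ((hv'c.integral_hasStrictDerivAt 0 t).hasDerivAt).const_add _
  exact hd.hasDerivWithinAt.congr hftc (hftc t ht)

end AbstractModeSystem

section Representation

variable {n : ℕ}

theorem ContinuousInSobolev.continuousOn_ball {r R : ℝ} {u : ℝ → 𝓢'(Rn n, ℂ)}
    (hu : ContinuousInSobolev r u) {g : ℝ → Rn n → ℂ}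
    (hg : ∀ t, 0 ≤ t → HasFourierFunction (u t) (g t)) {w : ℝ → Lp ℂ 2 (ballMeasure n R)}
    (hw : ∀ t, 0 ≤ t → w t =ᵐ[ballMeasure n R] g t) : ContinuousOn w (Set.Ici 0) := by
  intro t ht
  rw [ContinuousWithinAt, tendsto_iff_edist_tendsto_0]
  have hlim := ENNReal.Tendsto.const_mul ((hu t ht).2)
    (Or.inr (ENNReal.ofReal_ne_top (r := (1 + (2 * Real.pi * R) ^ 2) ^ |r / 2|)))
  rw [mul_zero] at hlim
  refine tendsto_of_tendsto_of_tendsto_of_le_of_le' tendsto_const_nhds hlim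
    (Eventually.of_forall fun _ ↦ zero_le) ?_
  filter_upwards [self_mem_nhdsWithin] with t' ht'
  rw [edist_eq_enorm_sub]
  refine ((hg t' ht').sub (hg t ht)).enorm_le_sobolevNorm ?_ r
  filter_upwards [Lp.coeFn_sub (w t') (w t), hw t' ht', hw t ht] with ξ hsub ht' ht
  rw [hsub, Pi.sub_apply, ht', ht]

theorem HasTimeDerivInSobolev.hasDerivWithinAt_ball {r R : ℝ} {u v : ℝ → 𝓢'(Rn n, ℂ)}
    (hu : HasTimeDerivInSobolev r u v) {g k : ℝ → Rn n → ℂ}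
    (hg : ∀ t, 0 ≤ t → HasFourierFunction (u t) (g t))
    (hk : ∀ t, 0 ≤ t → HasFourierFunction (v t) (k t))
    {w y : ℝ → Lp ℂ 2 (ballMeasure n R)} (hw : ∀ t, 0 ≤ t → w t =ᵐ[ballMeasure n R] g t)
    (hy : ∀ t, 0 ≤ t → y t =ᵐ[ballMeasure n R] k t) {t : ℝ} (ht : 0 ≤ t) :
    HasDerivWithinAt w (y t) (Set.Ici 0) t := by
  rw [hasDerivWithinAt_iff_tendsto_slope, tendsto_iff_edist_tendsto_0]
  have hlim := ENNReal.Tendsto.const_mul (hu t ht)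
    (Or.inr (ENNReal.ofReal_ne_top (r := (1 + (2 * Real.pi * R) ^ 2) ^ |r / 2|)))
  rw [mul_zero] at hlim
  refine tendsto_of_tendsto_of_tendsto_of_le_of_le' tendsto_const_nhds hlim
    (Eventually.of_forall fun _ ↦ zero_le) ?_
  filter_upwards [self_mem_nhdsWithin] with t' ht'
  rw [edist_eq_enorm_sub]
  refine ((((hg t' ht'.1).sub (hg t ht)).smul _).sub (hk t ht)).enorm_le_sobolevNorm ?_ r
  rw [slope_def_module]
  filter_upwards [Lp.coeFn_sub ((t' - t)⁻¹ • (w t' - w t)) (y t),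
    Lp.coeFn_smul (t' - t)⁻¹ (w t' - w t), Lp.coeFn_sub (w t') (w t), hw t' ht'.1, hw t ht,
    hy t ht] with ξ hslope hsmul hsub ht' ht hyt
  rw [hslope, Pi.sub_apply, hsmul, Pi.smul_apply, hsub, Pi.sub_apply, ht', ht, hyt,
    Complex.real_smul]

namespace IsSobolevSolution

variable {τ δ γ s R : ℝ}

theorem hasDerivAt_ballPairing (hτ : τ ≠ 0)
    {f : Fin 3 → 𝓢'(Rn n, ℂ)} {φ : Fin 3 → ℝ → 𝓢'(Rn n, ℂ)} (hφ : IsSobolevSolution τ δ γ s f φ)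
    {g : Fin 3 → ℝ → Rn n → ℂ} (hg : ∀ k t, 0 ≤ t → HasFourierFunction (φ k t) (g k t))
    {w : ℝ → Fin 3 → Lp ℂ 2 (ballMeasure n R)}
    (hw : ∀ k t, 0 ≤ t → w t k =ᵐ[ballMeasure n R] g k t)
    {θ : 𝓢(Rn n, ℂ)} (hθ : tsupport θ ⊆ Metric.ball 0 R) {t : ℝ} (ht : 0 < t) :
    HasDerivAt (fun r ↦ ballPairing R θ (w r 2))
      (ballPairing R θ (modeGenerator τ δ γ (ballMul n R) (w t) 2)) t := by
  obtain ⟨d, hd, heq⟩ := hφ.equation (𝓕 θ) t ht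
  have hloc : (fun r ↦ ballPairing R θ (w r 2)) =ᶠ[𝓝 t] fun r ↦ (φ 2 r) (𝓕 θ) := by
    filter_upwards [lt_mem_nhds ht] with r hr
    exact ballPairing_eq_fourier hθ (hg 2 r hr.le) (hw 2 r hr.le)
  refine (hd.congr_of_eventuallyEq hloc).congr_deriv ?_
  have hlap (k : Fin 3) : ballPairing R θ (ballMul n R (w t k)) = -(Δ (φ k t)) (𝓕 θ) :=
    ballPairing_eq_fourier hθ (hg k t ht.le).neg_laplacian (ballMul_ae_eq_symbol R (hw k t ht.le))
  rw [modeGenerator_apply_two, map_neg, map_smul, map_add, map_add, map_add, map_smul, map_smul,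
    hlap, hlap, ballPairing_eq_fourier hθ (hg 2 t ht.le) (hw 2 t ht.le),
    ballPairing_eq_fourier hθ (hg 1 t ht.le) (hw 1 t ht.le)]
  simp only [Complex.real_smul]
  have hτc : (τ : ℂ) ≠ 0 := by exact_mod_cast hτ
  rw [Complex.ofReal_inv]
  field_simp
  linear_combination heq

theorem hasDerivWithinAt_ball (hτ : τ ≠ 0) {f : Fin 3 → 𝓢'(Rn n, ℂ)}
    {φ : Fin 3 → ℝ → 𝓢'(Rn n, ℂ)} (hφ : IsSobolevSolution τ δ γ s f φ)
    {g : Fin 3 → ℝ → Rn n → ℂ} (hg : ∀ k t, 0 ≤ t → HasFourierFunction (φ k t) (g k t))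
    {w : ℝ → Fin 3 → Lp ℂ 2 (ballMeasure n R)}
    (hw : ∀ k t, 0 ≤ t → w t k =ᵐ[ballMeasure n R] g k t) {t : ℝ} (ht : 0 ≤ t) :
    HasDerivWithinAt w (modeGenerator τ δ γ (ballMul n R) (w t)) (Set.Ici 0) t := by
  set G := modeGenerator τ δ γ (ballMul n R)
  have hcont : ContinuousOn w (Set.Ici 0) :=
    continuousOn_pi.2 fun k ↦ (hφ.cont k).continuousOn_ball (hg k) (hw k)
  rw [hasDerivWithinAt_pi]
  intro i
  fin_cases i
  · exact hφ.deriv_zero.hasDerivWithinAt_ball (hg 0) (hg 1) (hw 0) (hw 1) ht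
  · exact hφ.deriv_one.hasDerivWithinAt_ball (hg 1) (hg 2) (hw 1) (hw 2) ht
  · exact hasDerivWithinAt_of_separating (w := fun t ↦ w t 2) (v := fun t ↦ G (w t) 2)
      (fun θ : {θ : 𝓢(Rn n, ℂ) // tsupport θ ⊆ Metric.ball 0 R} ↦ ballPairing R θ.1)
      (fun y hy ↦ eq_zero_of_ballPairing_eq_zero hy) ((continuous_apply 2).comp_continuousOn hcont)
      ((continuous_apply 2).comp_continuousOn (G.continuous.comp_continuousOn hcont))
      (fun θ t ht ↦ hφ.hasDerivAt_ballPairing hτ hg hw θ.2 ht) ht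

/-- On a ball of frequencies the generator is bounded, both on `L²` and on bounded continuous
functions. The flow of the latter gives the modes at each single frequency, and uniqueness in `L²`
identifies it with the Fourier transform of the solution. -/
theorem ae_mode_ball (hτ : τ ≠ 0) {f : Fin 3 → Lp ℂ 1 (volume : Measure (Rn n))}
    {φ : Fin 3 → ℝ → 𝓢'(Rn n, ℂ)}
    (hφ : IsSobolevSolution τ δ γ s (fun k ↦ (f k : 𝓢'(Rn n, ℂ))) φ)
    {g : Fin 3 → ℝ → Rn n → ℂ} (hg : ∀ k t, 0 ≤ t → HasFourierFunction (φ k t) (g k t))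
    (hg2 : ∀ k t, 0 ≤ t → MemLp (g k t) 2 (ballMeasure n R)) {t : ℝ} (ht : 0 ≤ t) (k : Fin 3) :
    ∀ᵐ ξ ∂(ballMeasure n R), ∃ u : Fin 3 → ℝ → ℂ,
      IsModeSolution τ δ γ ((2 * Real.pi * ‖ξ‖) ^ 2) u ∧
      (∀ l, u l 0 = Real.Lp.fourierTransform (f l) ξ) ∧ g k t ξ = u k t := by
  classical
  set w : ℝ → Fin 3 → Lp ℂ 2 (ballMeasure n R) :=
    fun t k ↦ if h : 0 ≤ t then (hg2 k t h).toLp (g k t) else 0 with hwdef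
  have hw (k : Fin 3) (t : ℝ) (h : 0 ≤ t) : w t k =ᵐ[ballMeasure n R] g k t := by
    simp only [hwdef, dif_pos h]
    exact (hg2 k t h).coeFn_toLp
  set M := ContinuousLinearMap.mul ℝ (BoundedContinuousFunction (Rn n) ℂ) (truncatedSymbol n R)
  obtain ⟨U, hU0, hU⟩ := exists_linear_flow (modeGenerator τ δ γ M)
    fun l ↦ Real.Lp.fourierTransform (f l)
  set T := BoundedContinuousFunction.toLp 2 (ballMeasure n R) ℝ (E := ℂ)
  have hTU (t : ℝ) (_ : 0 ≤ t) : HasDerivWithinAt (fun r l ↦ T (U r l))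
      (modeGenerator τ δ γ (ballMul n R) fun l ↦ T (U t l)) (Set.Ici 0) t :=
    (hasDerivAt_modeGenerator_map T (fun a ↦ (ballMul_toLp R a).symm) (hU t)).hasDerivWithinAt
  have hinit : w 0 = fun l ↦ T (U 0 l) := by
    funext l
    refine Lp.ext ?_
    have hdata : g l 0 =ᵐ[volume] Real.Lp.fourierTransform (f l) :=
      (hg l 0 le_rfl).ae_unique (hφ.initial l ▸ hasFourierFunction_of_Lp_one (f l))
    filter_upwards [hw l 0 le_rfl, ae_restrict_of_ae hdata,
      BoundedContinuousFunction.coeFn_toLp 2 (ballMeasure n R) ℝ (U 0 l)] with ξ hwξ hξ hTξ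
    rw [hwξ, hξ, hTξ, hU0]
  have hflow : w t = fun l ↦ T (U t l) := linear_flow_unique _ (W := fun t l ↦ T (U t l)) hinit
    (fun t ht ↦ hφ.hasDerivWithinAt_ball hτ hg hw ht) hTU ht
  filter_upwards [hw k t ht, BoundedContinuousFunction.coeFn_toLp 2 (ballMeasure n R) ℝ (U t k),
    ae_restrict_mem measurableSet_ball] with ξ hwξ hTξ hmem
  refine ⟨fun l r ↦ U r l ξ, isModeSolution_of_hasDerivAt
    (M := (2 * Real.pi * ‖ξ‖) ^ 2 • ContinuousLinearMap.id ℝ ℂ) (fun _ ↦ rfl) fun r ↦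
      hasDerivAt_modeGenerator_map (BoundedContinuousFunction.evalCLM ℝ ξ) (fun a ↦ ?_) (hU r),
    fun l ↦ by simp only [hU0], by rw [← hwξ, hflow]; exact hTξ⟩
  exact (congrArg (· * a ξ) (truncatedSymbol_apply hmem)).trans (Complex.real_smul ..).symm

theorem exists_ae_mode (hτ : τ ≠ 0)
    {f : Fin 3 → Lp ℂ 1 (volume : Measure (Rn n))} {φ : Fin 3 → ℝ → 𝓢'(Rn n, ℂ)}
    (hφ : IsSobolevSolution τ δ γ s (fun k ↦ (f k : 𝓢'(Rn n, ℂ))) φ) {t : ℝ} (ht : 0 ≤ t)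
    (k : Fin 3) :
    ∃ g : Rn n → ℂ, HasFourierFunction (φ k t) g ∧ ∀ᵐ ξ, ∃ u : Fin 3 → ℝ → ℂ,
      IsModeSolution τ δ γ ((2 * Real.pi * ‖ξ‖) ^ 2) u ∧
      (∀ l, u l 0 = Real.Lp.fourierTransform (f l) ξ) ∧ g ξ = u k t := by
  have hex (k : Fin 3) (t : ℝ) : ∃ g : Rn n → ℂ, 0 ≤ t → HasFourierFunction (φ k t) g ∧
      ∀ R, MemLp g 2 (ballMeasure n R) := by
    by_cases h : 0 ≤ t
    · obtain ⟨g, hg, hfin⟩ := exists_hasFourierFunction_of_memSobolev (hφ.cont k t h).1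
      exact ⟨g, fun _ ↦ ⟨hg, hg.memLp_ball hfin⟩⟩
    · exact ⟨0, fun h' ↦ absurd h' h⟩
  choose g hg using hex
  refine ⟨g k t, (hg k t ht).1, ?_⟩
  have hball (N : ℕ) := (ae_restrict_iff' measurableSet_ball).1
    (hφ.ae_mode_ball hτ (fun k t h ↦ (hg k t h).1) (fun k t h ↦ (hg k t h).2 N) ht k)
  filter_upwards [ae_all_iff.2 hball] with ξ hξ
  obtain ⟨N, hN⟩ := exists_nat_gt ‖ξ‖
  exact hξ N (mem_ball_zero_iff.2 hN)

end IsSobolevSolution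

end Representation

/-! ### Gaussian weights -/

section GaussianWeights

theorem exists_exp_neg_le_rpow (β : ℝ) {c : ℝ} (hc : 0 < c) :
    ∃ C : ℝ, 0 < C ∧ ∀ t : ℝ, 0 ≤ t → Real.exp (-c * t) ≤ C * (1 + t) ^ (-β) := by
  obtain ⟨N, hN⟩ := exists_nat_ge β
  refine ⟨N.factorial / c ^ N * Real.exp c, by positivity, fun t ht ↦ ?_⟩
  have hpow : (1 + t) ^ β ≤ (1 + t) ^ N := by
    rw [← Real.rpow_natCast]
    exact Real.rpow_le_rpow_of_exponent_le (by linarith) hN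
  have hfact := Real.pow_div_factorial_le_exp (c * (1 + t)) (by positivity) N
  rw [div_le_iff₀ (by positivity), mul_pow] at hfact
  rw [Real.rpow_neg (by positivity), ← div_eq_mul_inv, le_div_iff₀ (by positivity)]
  calc Real.exp (-c * t) * (1 + t) ^ β ≤ Real.exp (-c * t) * (1 + t) ^ N := by gcongr
    _ = Real.exp (-c * t) * (c ^ N * (1 + t) ^ N) / c ^ N := by field_simp
    _ ≤ Real.exp (-c * t) * (Real.exp (c * (1 + t)) * N.factorial) / c ^ N := by gcongr
    _ = N.factorial / c ^ N * Real.exp (-c * t + c * (1 + t)) := by rw [Real.exp_add]; ring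
    _ = N.factorial / c ^ N * Real.exp c := by ring_nf

theorem eLpNorm_comp_const_smul {E F : Type*} [NormedAddCommGroup E] [NormedSpace ℝ E]
    [FiniteDimensional ℝ E] [MeasurableSpace E] [BorelSpace E] [NormedAddCommGroup F]
    (μ : Measure E) [μ.IsAddHaarMeasure] {p : ℝ≥0∞} (hp : p ≠ ∞) (h : E → F) {R : ℝ}
    (hR : 0 < R) :
    eLpNorm (fun x ↦ h (R • x)) p μ =
      ENNReal.ofReal (R ^ (-(Module.finrank ℝ E : ℝ) / p.toReal)) * eLpNorm h p μ := by
  have hemb : MeasurableEmbedding (fun x : E ↦ R • x) :=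
    (Homeomorph.smulOfNeZero R hR.ne').measurableEmbedding
  have hmap := hemb.eLpNorm_map_measure (g := h) (p := p) (μ := μ)
  rw [Measure.map_addHaar_smul μ hR.ne', eLpNorm_smul_measure_of_ne_top hp] at hmap
  refine hmap.symm.trans ?_
  rw [smul_eq_mul, ENNReal.ofReal_rpow_of_nonneg (abs_nonneg _) ENNReal.toReal_nonneg,
    abs_of_pos (by positivity), ← Real.rpow_natCast, ← Real.rpow_neg hR.le, ← Real.rpow_mul hR.le,
    ENNReal.toReal_div, ENNReal.toReal_one, mul_one_div]

theorem tendsto_eLpNorm_zero_of_dominated {α ι E F : Type*} [MeasurableSpace α]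
    [NormedAddCommGroup E] [NormedAddCommGroup F] {μ : Measure α} {l : Filter ι}
    [l.IsCountablyGenerated] {p : ℝ≥0∞} (hp₀ : p ≠ 0) (hp : p ≠ ∞) {f : ι → α → E} {g : α → F}
    (hf : ∀ᶠ i in l, AEStronglyMeasurable (f i) μ) (hg : MemLp g p μ)
    (hfg : ∀ᶠ i in l, ∀ᵐ x ∂μ, ‖f i x‖ ≤ ‖g x‖)
    (hlim : ∀ᵐ x ∂μ, Tendsto (fun i ↦ f i x) l (𝓝 0)) :
    Tendsto (fun i ↦ eLpNorm (f i) p μ) l (𝓝 0) := by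
  have hp' : 0 < p.toReal := ENNReal.toReal_pos hp₀ hp
  have hint : Tendsto (fun i ↦ ∫⁻ x, ‖f i x‖ₑ ^ p.toReal ∂μ) l (𝓝 (∫⁻ _, 0 ∂μ)) := by
    refine tendsto_lintegral_filter_of_dominated_convergence' (fun x ↦ ‖g x‖ₑ ^ p.toReal)
      (hf.mono fun i hi ↦ hi.enorm.pow_const _) (hfg.mono fun i hi ↦ hi.mono fun x hx ↦ ?_)
      ((eLpNorm_lt_top_iff_lintegral_rpow_enorm_lt_top hp₀ hp).1 hg.2).ne
      (hlim.mono fun x hx ↦ ?_)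
    · exact ENNReal.rpow_le_rpow (enorm_le_iff_norm_le.2 hx) hp'.le
    · simpa [Function.comp_def, hp'] using
        ((ENNReal.continuous_rpow_const (y := p.toReal)).tendsto _).comp hx.enorm
  rw [lintegral_zero] at hint
  simpa [eLpNorm_eq_lintegral_rpow_enorm_toReal hp₀ hp, Function.comp_def, hp'] using
    ((ENNReal.continuous_rpow_const (y := 1 / p.toReal)).tendsto _).comp hint

/-- The weight `ρ^a exp (-κ ρ²)` at the angular frequency `ρ = 2 π |ξ|`. The diffusive part of the
solution is dominated by such weights with `κ` proportional to the time. -/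
noncomputable def gaussianWeight (a κ ρ : ℝ) : ℝ := ρ ^ a * Real.exp (-κ * ρ ^ 2)

theorem gaussianWeight_nonneg {ρ : ℝ} (hρ : 0 ≤ ρ) (a κ : ℝ) : 0 ≤ gaussianWeight a κ ρ := by
  unfold gaussianWeight; positivity

theorem measurable_gaussianWeight (a κ : ℝ) : Measurable (gaussianWeight a κ) := by
  unfold gaussianWeight; fun_prop

theorem gaussianWeight_mul_time {ρ T : ℝ} (hρ : 0 ≤ ρ) (hT : 0 < T) (a κ : ℝ) :
    gaussianWeight a (κ * T) ρ = T ^ (-a / 2) * gaussianWeight a κ (√T * ρ) := by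
  have hscale : T ^ (-a / 2) * √T ^ a = 1 := by
    rw [Real.sqrt_eq_rpow, ← Real.rpow_mul hT.le, ← Real.rpow_add hT]
    ring_nf
    exact Real.rpow_zero _
  rw [gaussianWeight, gaussianWeight, Real.mul_rpow (Real.sqrt_nonneg _) hρ, mul_pow √T,
    Real.sq_sqrt hT.le, ← mul_assoc, ← mul_assoc, hscale, one_mul]
  ring_nf

variable {n : ℕ}

theorem measurable_gaussianWeight_norm (a κ : ℝ) :
    Measurable fun ξ : Rn n ↦ gaussianWeight a κ (2 * Real.pi * ‖ξ‖) :=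
  (measurable_gaussianWeight a κ).comp (by fun_prop)

theorem nontrivial_Rn (hn : 1 ≤ n) : Nontrivial (Rn n) :=
  Module.nontrivial_of_finrank_pos (R := ℝ) (by rw [finrank_euclideanSpace_fin]; exact hn)

theorem memLp_gaussianWeight (hn : 1 ≤ n) {a κ : ℝ} (ha : 0 < (n : ℝ) + 2 * a) (hκ : 0 < κ) :
    MemLp (fun ξ : Rn n ↦ gaussianWeight a κ (2 * Real.pi * ‖ξ‖)) 2 volume := by
  rw [memLp_two_iff_integrable_sq (measurable_gaussianWeight_norm a κ).aestronglyMeasurable]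
  have := nontrivial_Rn hn
  refine (integrable_fun_norm_addHaar (volume : Measure (Rn n))
    (f := fun y : ℝ ↦ gaussianWeight a κ (2 * Real.pi * y) ^ 2)).2 ?_
  have hradial := integrableOn_rpow_mul_exp_neg_mul_sq (b := 2 * κ * (2 * Real.pi) ^ 2)
    (by positivity) (s := (n : ℝ) - 1 + 2 * a) (by linarith)
  refine IntegrableOn.congr_fun (hradial.const_mul ((2 * Real.pi) ^ (2 * a)))
    (fun y (hy : 0 < y) ↦ ?_) measurableSet_Ioi
  have hpow : y ^ ((n : ℝ) - 1 + 2 * a) = y ^ (n - 1) * y ^ (2 * a) := by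
    rw [Real.rpow_add hy, ← Real.rpow_natCast, Nat.cast_sub hn, Nat.cast_one]
  have hsq : ((2 * Real.pi * y) ^ a) ^ 2 = (2 * Real.pi) ^ (2 * a) * y ^ (2 * a) := by
    rw [← Real.rpow_mul_natCast (by positivity), Real.mul_rpow (by positivity) hy.le,
      Nat.cast_ofNat, mul_comm a 2]
  have hexp : Real.exp (-κ * (2 * Real.pi * y) ^ 2) ^ 2 =
      Real.exp (-(2 * κ * (2 * Real.pi) ^ 2) * y ^ 2) := by
    rw [← Real.exp_nat_mul]; ring_nf
  simp only [smul_eq_mul, finrank_euclideanSpace_fin]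
  rw [gaussianWeight, mul_pow ((2 * Real.pi * y) ^ a), hpow, hsq, hexp]
  ring

theorem eLpNorm_gaussianWeight_smul {F : Type*} [NormedAddCommGroup F] [NormedSpace ℝ F]
    (a κ : ℝ) {T : ℝ} (hT : 0 < T) (h : Rn n → F) :
    eLpNorm (fun ξ ↦ gaussianWeight a (κ * T) (2 * Real.pi * ‖ξ‖) • h ξ) 2 volume =
      ENNReal.ofReal (T ^ (-(((n : ℝ) + 2 * a) / 4))) *
        eLpNorm (fun ξ ↦ gaussianWeight a κ (2 * Real.pi * ‖ξ‖) • h ((√T)⁻¹ • ξ)) 2 volume := by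
  have hs : 0 < √T := Real.sqrt_pos.2 hT
  set G : Rn n → F := fun η ↦ gaussianWeight a κ (2 * Real.pi * ‖η‖) • h ((√T)⁻¹ • η) with hG
  have hcomp : (fun ξ ↦ gaussianWeight a (κ * T) (2 * Real.pi * ‖ξ‖) • h ξ) =
      T ^ (-a / 2) • fun ξ ↦ G (√T • ξ) := by
    funext ξ
    simp only [Pi.smul_apply, hG]
    rw [inv_smul_smul₀ hs.ne', gaussianWeight_mul_time (by positivity) hT, mul_smul, norm_smul,
      Real.norm_of_nonneg hs.le, mul_left_comm √T]
  rw [hcomp, eLpNorm_const_smul, eLpNorm_comp_const_smul volume (by norm_num) G hs,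
    ← mul_assoc, Real.enorm_of_nonneg (by positivity), ← ENNReal.ofReal_mul (by positivity),
    finrank_euclideanSpace_fin, Real.sqrt_eq_rpow, ← Real.rpow_mul hT.le, ← Real.rpow_add hT]
  congr 3
  norm_num
  ring

/-- The `L²` norm of a Gaussian weight on `ℝⁿ`; it is finite for `n + 2 a > 0`. -/
noncomputable def gaussianWeightNorm (n : ℕ) (a κ : ℝ) : ℝ :=
  (eLpNorm (fun ξ : Rn n ↦ gaussianWeight a κ (2 * Real.pi * ‖ξ‖)) 2 volume).toReal

theorem eLpNorm_gaussianWeight (hn : 1 ≤ n) {a κ T : ℝ} (ha : 0 < (n : ℝ) + 2 * a) (hκ : 0 < κ)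
    (hT : 0 < T) :
    eLpNorm (fun ξ : Rn n ↦ gaussianWeight a (κ * T) (2 * Real.pi * ‖ξ‖)) 2 volume =
      ENNReal.ofReal (T ^ (-(((n : ℝ) + 2 * a) / 4)) * gaussianWeightNorm n a κ) := by
  rw [ENNReal.ofReal_mul (by positivity), gaussianWeightNorm,
    ENNReal.ofReal_toReal (memLp_gaussianWeight hn ha hκ).2.ne]
  simpa using eLpNorm_gaussianWeight_smul a κ hT fun _ : Rn n ↦ (1 : ℝ)

theorem tendsto_eLpNorm_gaussianWeight_smul_sub {F : Type*} [NormedAddCommGroup F]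
    [NormedSpace ℝ F] (hn : 1 ≤ n) {a κ : ℝ} (ha : 0 < (n : ℝ) + 2 * a) (hκ : 0 < κ)
    (h : BoundedContinuousFunction (Rn n) F) :
    Tendsto (fun T : ℝ ↦ ENNReal.ofReal (T ^ (((n : ℝ) + 2 * a) / 4)) *
      eLpNorm (fun ξ ↦ gaussianWeight a (κ * T) (2 * Real.pi * ‖ξ‖) • (h ξ - h 0)) 2 volume)
      atTop (𝓝 0) := by
  have hlim : Tendsto (fun T : ℝ ↦ eLpNorm (fun ξ ↦ gaussianWeight a κ (2 * Real.pi * ‖ξ‖) •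
      (h ((√T)⁻¹ • ξ) - h 0)) 2 volume) atTop (𝓝 0) := by
    refine tendsto_eLpNorm_zero_of_dominated (by norm_num) (by norm_num)
      (Eventually.of_forall fun T ↦ ?_) ((memLp_gaussianWeight hn ha hκ).mul_const (2 * ‖h‖))
      (Eventually.of_forall fun T ↦ Eventually.of_forall fun ξ ↦ ?_)
      (Eventually.of_forall fun ξ ↦ ?_)
    · exact (measurable_gaussianWeight_norm a κ).aestronglyMeasurable.smul
        (((h.continuous.comp (continuous_const_smul _)).sub
          continuous_const).aestronglyMeasurable)
    · rw [norm_smul, norm_mul]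
      gcongr
      rw [Real.norm_of_nonneg (by positivity), ← dist_eq_norm]
      exact h.dist_le_two_norm _ _
    · have harg : Tendsto (fun T : ℝ ↦ (√T)⁻¹ • ξ) atTop (𝓝 0) := by
        simpa using (tendsto_inv_atTop_zero.comp Real.tendsto_sqrt_atTop).smul_const ξ
      simpa using (((h.continuous.tendsto 0).comp harg).sub_const (h 0)).const_smul
        (gaussianWeight a κ (2 * Real.pi * ‖ξ‖))
  refine hlim.congr' ?_
  filter_upwards [eventually_gt_atTop 0] with T hT
  rw [eLpNorm_gaussianWeight_smul a κ hT fun ξ ↦ h ξ - h 0, ← mul_assoc,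
    ← ENNReal.ofReal_mul (by positivity), ← Real.rpow_add hT, add_neg_cancel, Real.rpow_zero,
    ENNReal.ofReal_one, one_mul]

end GaussianWeights

section FrequencyEnvelope

theorem rpow_mul_abs_diffusionMultiplier {γ ρ : ℝ} (hγ : 0 < γ) (hρ : 0 < ρ) (a : ℝ) (j : ℕ)
    (t : ℝ) :
    ρ ^ a * |diffusionMultiplier γ j t ρ| = γ⁻¹ ^ j * gaussianWeight (a + 2 * j) (γ⁻¹ * t) ρ := by
  have hpow : ρ ^ (a + 2 * j) = ρ ^ a * (ρ ^ 2) ^ j := by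
    rw [Real.rpow_add hρ, ← pow_mul, ← Real.rpow_natCast ρ (2 * j)]
    push_cast
    rfl
  rw [diffusionMultiplier, gaussianWeight, hpow, abs_mul, Real.abs_exp, abs_pow, abs_neg,
    abs_of_pos (by positivity), div_eq_inv_mul, mul_pow γ⁻¹]
  ring_nf

theorem gaussianWeight_add_two {ρ : ℝ} (hρ : 0 < ρ) (a κ : ℝ) :
    gaussianWeight (a + 2) κ ρ = ρ ^ 2 * gaussianWeight a κ ρ := by
  rw [gaussianWeight, gaussianWeight, Real.rpow_add hρ, Real.rpow_two]
  ring

theorem gaussianWeight_le_of_le {ρ κ κ' : ℝ} (hρ : 0 ≤ ρ) (hκ : κ ≤ κ') (a : ℝ) :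
    gaussianWeight a κ' ρ ≤ gaussianWeight a κ ρ := by
  unfold gaussianWeight
  gcongr

theorem gaussianWeight_le_exp_mul {ρ e κ : ℝ} (hρ : 0 ≤ ρ) (hρe : ρ ^ 2 ≤ e) (hκ : 0 ≤ κ)
    (a κ' : ℝ) : gaussianWeight a κ' ρ ≤ Real.exp (κ * e) * gaussianWeight a (κ' + κ) ρ := by
  have hexp : Real.exp (-κ' * ρ ^ 2) ≤ Real.exp (κ * e) * Real.exp (-(κ' + κ) * ρ ^ 2) := by
    rw [← Real.exp_add]
    gcongr
    linarith [mul_le_mul_of_nonneg_left hρe hκ]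
  rw [gaussianWeight, gaussianWeight, mul_left_comm]
  gcongr

/-- Bounds for the value `g` at time `t` of the Fourier transform of `∂_t^j φ` at the angular
frequency `ρ`: it is compared with the diffusive part of amplitude `A` for `ρ² ≤ e`, and decays
exponentially for `e ≤ ρ²`. Here `M` stands for the `L¹` size of the data, and `H` for the size
of their Fourier transforms at the given frequency. -/
structure FrequencyBounds (γ e C c r : ℝ) (j : ℕ) (t ρ M H : ℝ) (A g : ℂ) : Prop where
  pos : 0 < ρ
  mass_nonneg : 0 ≤ M
  data_nonneg : 0 ≤ H
  amplitude : ‖A‖ ≤ C * M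
  low : ρ ^ 2 ≤ e → ‖g - diffusionMultiplier γ j t ρ • A‖ ≤
    C * ((ρ ^ 2) ^ (j + 1) * Real.exp (-c * ρ ^ 2 * t) + Real.exp (-c * t)) * M
  high : e ≤ ρ ^ 2 → ρ ^ r * ‖g‖ ≤ C * Real.exp (-c * t) * H

/-- The common majorant of the solution and of its distance to the diffusive part, with `κ`
proportional to the time and `q` exponentially small. -/
noncomputable def frequencyEnvelope (a r κ q M H ρ : ℝ) : ℝ :=
  (gaussianWeight a κ ρ + q * gaussianWeight r 1 ρ) * M + q * H

theorem le_mul_frequencyEnvelope {ρ q M H K₁ K₂ K₃ : ℝ} (hρ : 0 ≤ ρ) (hq : 0 ≤ q) (hM : 0 ≤ M)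
    (hH : 0 ≤ H) (hK₁ : 0 ≤ K₁) (hK₂ : 0 ≤ K₂) (hK₃ : 0 ≤ K₃) (a r κ : ℝ) :
    (K₁ * gaussianWeight a κ ρ + K₂ * (q * gaussianWeight r 1 ρ)) * M + K₃ * (q * H) ≤
      (K₁ + K₂ + K₃) * frequencyEnvelope a r κ q M H ρ := by
  have := gaussianWeight_nonneg hρ a κ
  have := gaussianWeight_nonneg hρ r 1
  have h₁ : K₁ ≤ K₁ + K₂ + K₃ := by linarith
  have h₂ : K₂ ≤ K₁ + K₂ + K₃ := by linarith
  have h₃ : K₃ ≤ K₁ + K₂ + K₃ := by linarith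
  calc _ ≤ ((K₁ + K₂ + K₃) * gaussianWeight a κ ρ
        + (K₁ + K₂ + K₃) * (q * gaussianWeight r 1 ρ)) * M + (K₁ + K₂ + K₃) * (q * H) := by
        gcongr (?_ * _ + ?_ * _) * M + ?_ * (_ * _)
    _ = _ := by rw [frequencyEnvelope]; ring

theorem gaussianWeight_sqrt_mul_mul_rpow_le {t ρ σ z : ℝ} (ht : 0 ≤ t) (hρ : 0 < ρ) (hσ : 0 ≤ σ)
    (hz : 0 ≤ z) (b r : ℝ) :
    gaussianWeight b σ (√t * ρ) * (ρ ^ r * z) ≤ t ^ (b / 2) * (ρ ^ (r + b) * z) := by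
  have hle : gaussianWeight b σ (√t * ρ) ≤ t ^ (b / 2) * ρ ^ b := by
    rw [gaussianWeight, Real.mul_rpow (by positivity) hρ.le, Real.sqrt_eq_rpow,
      ← Real.rpow_mul ht, one_div_mul_eq_div]
    refine mul_le_of_le_one_right (by positivity) (Real.exp_le_one_iff.2 ?_)
    rw [neg_mul]
    exact neg_nonpos.2 (by positivity)
  calc gaussianWeight b σ (√t * ρ) * (ρ ^ r * z) ≤ t ^ (b / 2) * ρ ^ b * (ρ ^ r * z) := by gcongr
    _ = t ^ (b / 2) * (ρ ^ (r + b) * z) := by rw [Real.rpow_add hρ]; ring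

namespace FrequencyBounds

variable {γ e C c r : ℝ} {j : ℕ} {t ρ M H : ℝ} {A g : ℂ}

theorem rpow_mul_norm_sub_le (h : FrequencyBounds γ e C c r j t ρ M H A g) (hC : 0 < C)
    (hρe : ρ ^ 2 ≤ e) (a : ℝ) :
    ρ ^ a * ‖g - diffusionMultiplier γ j t ρ • A‖ ≤ C * (gaussianWeight (a + 2 * j + 2) (c * t) ρ
      + Real.exp (-c * t) * (Real.exp e * gaussianWeight a 1 ρ)) * M := by
  have hρ := h.pos
  have := h.mass_nonneg
  have hpow : ρ ^ (a + 2 * j + 2) = ρ ^ a * (ρ ^ 2) ^ (j + 1) := by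
    rw [add_assoc, Real.rpow_add hρ, ← pow_mul, ← Real.rpow_natCast ρ (2 * (j + 1))]
    push_cast
    ring_nf
  have hone : ρ ^ a ≤ Real.exp e * gaussianWeight a 1 ρ := by
    simpa [gaussianWeight] using gaussianWeight_le_exp_mul hρ.le hρe zero_le_one a 0
  calc ρ ^ a * ‖g - diffusionMultiplier γ j t ρ • A‖
      ≤ ρ ^ a * (C * ((ρ ^ 2) ^ (j + 1) * Real.exp (-c * ρ ^ 2 * t) + Real.exp (-c * t)) * M) :=
        mul_le_mul_of_nonneg_left (h.low hρe) (by positivity)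
    _ = C * (gaussianWeight (a + 2 * j + 2) (c * t) ρ + Real.exp (-c * t) * ρ ^ a) * M := by
        rw [gaussianWeight, hpow]; ring_nf
    _ ≤ _ := by gcongr

theorem rpow_mul_norm_diffusion_le (h : FrequencyBounds γ e C c r j t ρ M H A g) (hγ : 0 < γ)
    (a : ℝ) :
    ρ ^ a * ‖diffusionMultiplier γ j t ρ • A‖ ≤
      γ⁻¹ ^ j * C * gaussianWeight (a + 2 * j) (γ⁻¹ * t) ρ * M := by
  have hw := gaussianWeight_nonneg h.pos.le (a + 2 * j) (γ⁻¹ * t)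
  rw [norm_smul, Real.norm_eq_abs, ← mul_assoc, rpow_mul_abs_diffusionMultiplier hγ h.pos]
  calc γ⁻¹ ^ j * gaussianWeight (a + 2 * j) (γ⁻¹ * t) ρ * ‖A‖
      ≤ γ⁻¹ ^ j * gaussianWeight (a + 2 * j) (γ⁻¹ * t) ρ * (C * M) :=
        mul_le_mul_of_nonneg_left h.amplitude (by positivity)
    _ = _ := by ring

theorem rpow_mul_norm_diffusion_le_of_high (h : FrequencyBounds γ e C c r j t ρ M H A g)
    (hγ : 0 < γ) (he : 0 < e) (hC : 0 < C) (hρe : e ≤ ρ ^ 2) (a : ℝ) :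
    ρ ^ a * ‖diffusionMultiplier γ j t ρ • A‖ ≤
      γ⁻¹ ^ j * C / e * gaussianWeight (a + 2 * j + 2) (γ⁻¹ * t) ρ * M := by
  have hw := gaussianWeight_nonneg h.pos.le (a + 2 * j) (γ⁻¹ * t)
  have := h.mass_nonneg
  refine (h.rpow_mul_norm_diffusion_le hγ a).trans ?_
  rw [gaussianWeight_add_two h.pos, div_mul_eq_mul_div, mul_div_assoc]
  gcongr
  rw [le_div_iff₀ he, mul_comm]
  gcongr

theorem rpow_mul_norm_le_of_low {κ : ℝ} (h : FrequencyBounds γ e C c r j t ρ M H A g)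
    (hγ : 0 < γ) (hC : 0 < C) (hκ : 0 ≤ κ) (hκc : κ ≤ c) (hκγ : κ ≤ γ⁻¹) (ht : 0 ≤ t)
    (hρe : ρ ^ 2 ≤ e) (a : ℝ) :
    ρ ^ a * ‖g‖ ≤
      ((γ⁻¹ ^ j * C + C * e) * Real.exp (κ * e) * gaussianWeight (a + 2 * j) (κ * (1 + t)) ρ
        + C * Real.exp e * (Real.exp (-c * t) * gaussianWeight a 1 ρ)) * M := by
  have hρ := h.pos
  have hM := h.mass_nonneg
  have he : 0 ≤ e := (sq_nonneg ρ).trans hρe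
  have hshift : ∀ {κ'}, κ ≤ κ' → gaussianWeight (a + 2 * j) (κ' * t) ρ ≤
      Real.exp (κ * e) * gaussianWeight (a + 2 * j) (κ * (1 + t)) ρ := fun {κ'} hκ' ↦ by
    refine (gaussianWeight_le_of_le hρ.le (mul_le_mul_of_nonneg_right hκ' ht) _).trans ?_
    refine (gaussianWeight_le_exp_mul hρ.le hρe hκ _ _).trans_eq ?_
    rw [mul_one_add, add_comm κ]
  set w := gaussianWeight (a + 2 * j) (κ * (1 + t)) ρ
  set v := gaussianWeight a 1 ρ
  have hdiffusion : ρ ^ a * ‖diffusionMultiplier γ j t ρ • A‖ ≤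
      γ⁻¹ ^ j * C * (Real.exp (κ * e) * w) * M := by
    refine (h.rpow_mul_norm_diffusion_le hγ a).trans ?_
    gcongr
    exact hshift hκγ
  have herror : ρ ^ a * ‖g - diffusionMultiplier γ j t ρ • A‖ ≤
      C * (e * (Real.exp (κ * e) * w) + Real.exp (-c * t) * (Real.exp e * v)) * M := by
    refine (h.rpow_mul_norm_sub_le hC hρe a).trans ?_
    rw [gaussianWeight_add_two hρ]
    have := gaussianWeight_nonneg hρ.le (a + 2 * j) (c * t)
    gcongr
    exact hshift hκc
  calc ρ ^ a * ‖g‖ ≤ ρ ^ a * ‖diffusionMultiplier γ j t ρ • A‖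
        + ρ ^ a * ‖g - diffusionMultiplier γ j t ρ • A‖ := by
        rw [← mul_add]; gcongr; exact norm_le_norm_add_norm_sub' _ _
    _ ≤ _ := by linarith

theorem cutoff_mul_norm_sub_le_of_low {κ b σ : ℝ} (h : FrequencyBounds γ e C c r j t ρ M H A g)
    (hC : 0 < C) (hκc : κ ≤ c) (hσ : 0 ≤ σ) (ht : 0 ≤ t) (hρe : ρ ^ 2 ≤ e) :
    gaussianWeight b σ (√t * ρ) * (ρ ^ r * ‖g - diffusionMultiplier γ j t ρ • A‖) ≤
      t ^ (b / 2) * (C * (gaussianWeight (r + b + 2 * j + 2) (κ * t) ρ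
        + Real.exp (-c * t) * (Real.exp e * gaussianWeight (r + b) 1 ρ)) * M) := by
  have hM := h.mass_nonneg
  refine (gaussianWeight_sqrt_mul_mul_rpow_le ht h.pos hσ (norm_nonneg _) b r).trans ?_
  gcongr t ^ (b / 2) * ?_
  refine (h.rpow_mul_norm_sub_le hC hρe (r + b)).trans ?_
  gcongr
  exact gaussianWeight_le_of_le h.pos.le (mul_le_mul_of_nonneg_right hκc ht) _

theorem cutoff_mul_norm_sub_le_of_high {κ b σ B : ℝ}
    (h : FrequencyBounds γ e C c r j t ρ M H A g) (hγ : 0 < γ) (he : 0 < e) (hC : 0 < C)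
    (hκγ : κ ≤ γ⁻¹) (hb : 0 ≤ b) (hσ : 0 ≤ σ) (hcutoff : ∀ y, 0 ≤ y → gaussianWeight b σ y ≤ B)
    (ht : 1 ≤ t) (hρe : e ≤ ρ ^ 2) :
    gaussianWeight b σ (√t * ρ) * (ρ ^ r * ‖g - diffusionMultiplier γ j t ρ • A‖) ≤
      t ^ (b / 2) * (γ⁻¹ ^ j * C / e * gaussianWeight (r + b + 2 * j + 2) (κ * t) ρ * M
        + B * C * (Real.exp (-c * t) * H)) := by
  have hρ := h.pos
  have hM := h.mass_nonneg
  have hH := h.data_nonneg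
  have ht₀ : 0 ≤ t := zero_le_one.trans ht
  have hB : 0 ≤ B := (gaussianWeight_nonneg le_rfl b σ).trans (hcutoff 0 le_rfl)
  have hdiffusion : gaussianWeight b σ (√t * ρ) *
      (ρ ^ r * ‖diffusionMultiplier γ j t ρ • A‖) ≤
        t ^ (b / 2) * (γ⁻¹ ^ j * C / e * gaussianWeight (r + b + 2 * j + 2) (κ * t) ρ * M) := by
    refine (gaussianWeight_sqrt_mul_mul_rpow_le ht₀ hρ hσ (norm_nonneg _) b r).trans ?_
    gcongr t ^ (b / 2) * ?_
    refine (h.rpow_mul_norm_diffusion_le_of_high hγ he hC hρe (r + b)).trans ?_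
    gcongr
    exact gaussianWeight_le_of_le hρ.le (mul_le_mul_of_nonneg_right hκγ ht₀) _
  have hsolution : gaussianWeight b σ (√t * ρ) * (ρ ^ r * ‖g‖) ≤
      t ^ (b / 2) * (B * C * (Real.exp (-c * t) * H)) :=
    calc _ ≤ B * (C * Real.exp (-c * t) * H) :=
          mul_le_mul (hcutoff _ (by positivity)) (h.high hρe) (by positivity) hB
      _ = B * C * (Real.exp (-c * t) * H) := by ring
      _ ≤ _ := le_mul_of_one_le_left (by positivity) (Real.one_le_rpow ht (by positivity))
  have := gaussianWeight_nonneg (mul_nonneg (Real.sqrt_nonneg t) hρ.le) b σ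
  calc _ ≤ gaussianWeight b σ (√t * ρ) * (ρ ^ r * (‖g‖ + ‖diffusionMultiplier γ j t ρ • A‖)) := by
        gcongr; exact norm_sub_le _ _
    _ ≤ _ := by linarith

end FrequencyBounds

theorem exists_rpow_mul_norm_le_frequencyEnvelope {γ e C c : ℝ} (hγ : 0 < γ) (he : 0 < e)
    (hC : 0 < C) (hc : 0 < c) (r : ℝ) (j : ℕ) :
    ∃ K κ : ℝ, 0 < K ∧ 0 < κ ∧ ∀ {t ρ M H : ℝ} {A g : ℂ}, 0 ≤ t →
      FrequencyBounds γ e C c r j t ρ M H A g → ρ ^ r * ‖g‖ ≤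
        K * frequencyEnvelope (r + 2 * j) r (κ * (1 + t)) (Real.exp (-c * t)) M H ρ := by
  set κ := min c γ⁻¹
  have hκ : 0 < κ := by positivity
  refine ⟨(γ⁻¹ ^ j * C + C * e) * Real.exp (κ * e) + C * Real.exp e + C, κ, by positivity, hκ,
    fun {t ρ M H A g} ht h ↦ ?_⟩
  have hρ := h.pos
  have hM := h.mass_nonneg
  have hH := h.data_nonneg
  have := gaussianWeight_nonneg hρ.le (r + 2 * j) (κ * (1 + t))
  have := gaussianWeight_nonneg hρ.le r 1
  refine le_trans ?_ (le_mul_frequencyEnvelope hρ.le (Real.exp_nonneg _) hM hH (by positivity)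
    (by positivity) hC.le _ _ _)
  rcases le_total (ρ ^ 2) e with hρe | hρe
  · exact (h.rpow_mul_norm_le_of_low hγ hC hκ.le (min_le_left _ _) (min_le_right _ _) ht hρe
      r).trans (le_add_of_nonneg_right (by positivity))
  · refine (h.high hρe).trans ?_
    rw [mul_assoc C]
    exact le_add_of_nonneg_left (by positivity)

theorem exists_cutoff_mul_norm_sub_le_frequencyEnvelope {γ e C c b σ B : ℝ} (hγ : 0 < γ)
    (he : 0 < e) (hC : 0 < C) (hc : 0 < c) (hb : 0 ≤ b) (hσ : 0 ≤ σ)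
    (hcutoff : ∀ y, 0 ≤ y → gaussianWeight b σ y ≤ B) (r : ℝ) (j : ℕ) :
    ∃ K κ : ℝ, 0 < K ∧ 0 < κ ∧ ∀ {t ρ M H : ℝ} {A g : ℂ}, 1 ≤ t →
      FrequencyBounds γ e C c r j t ρ M H A g →
      gaussianWeight b σ (√t * ρ) * (ρ ^ r * ‖g - diffusionMultiplier γ j t ρ • A‖) ≤
        K * t ^ (b / 2) * frequencyEnvelope (r + b + 2 * j + 2) (r + b) (κ * t)
          (Real.exp (-c * t)) M H ρ := by
  have hB : 0 ≤ B := (gaussianWeight_nonneg le_rfl b σ).trans (hcutoff 0 le_rfl)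
  set κ := min c γ⁻¹
  refine ⟨C + γ⁻¹ ^ j * C / e + C * Real.exp e + B * C, κ, by positivity, by positivity,
    fun {t ρ M H A g} ht h ↦ ?_⟩
  have hρ := h.pos
  have hM := h.mass_nonneg
  have hH := h.data_nonneg
  have ht₀ : 0 ≤ t := zero_le_one.trans ht
  have := gaussianWeight_nonneg hρ.le (r + b + 2 * j + 2) (κ * t)
  have := gaussianWeight_nonneg hρ.le (r + b) 1
  rw [mul_comm _ (t ^ (b / 2)), mul_assoc (t ^ (b / 2))]
  refine le_trans ?_ (mul_le_mul_of_nonneg_left (le_mul_frequencyEnvelope hρ.le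
    (Real.exp_nonneg _) hM hH (by positivity) (by positivity) (by positivity) _ _ _)
    (by positivity))
  set w := gaussianWeight (r + b + 2 * j + 2) (κ * t) ρ
  set v := gaussianWeight (r + b) 1 ρ
  set q := Real.exp (-c * t)
  rcases le_total (ρ ^ 2) e with hρe | hρe
  · refine (h.cutoff_mul_norm_sub_le_of_low hC (min_le_left c γ⁻¹) hσ ht₀ hρe).trans ?_
    gcongr t ^ (b / 2) * ?_
    calc _ ≤ C * (w + q * (Real.exp e * v)) * M + (γ⁻¹ ^ j * C / e * w * M + B * C * (q * H)) :=
          le_add_of_nonneg_right (by positivity)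
      _ = _ := by ring
  · refine (h.cutoff_mul_norm_sub_le_of_high hγ he hC (min_le_right c γ⁻¹) hb hσ hcutoff ht
      hρe).trans ?_
    gcongr t ^ (b / 2) * ?_
    calc _ ≤ γ⁻¹ ^ j * C / e * w * M + B * C * (q * H)
          + (C * w + C * Real.exp e * (q * v)) * M := le_add_of_nonneg_right (by positivity)
      _ = _ := by ring

end FrequencyEnvelope

/-! ### The data in Fourier variables -/

section DataNorms

variable {n : ℕ}

theorem eLpNorm_frequencyEnvelope_le (hn : 1 ≤ n) {a r κ T q M : ℝ}
    (ha : 0 < (n : ℝ) + 2 * a) (hr : 0 < (n : ℝ) + 2 * r) (hκ : 0 < κ) (hT : 0 < T) (hq : 0 ≤ q)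
    (hM : 0 ≤ M) {H : Rn n → ℝ} (hH : Measurable H) {D : ℝ≥0∞} (hMD : ENNReal.ofReal M ≤ D)
    (hHD : eLpNorm H 2 volume ≤ D) :
    eLpNorm (fun ξ ↦ frequencyEnvelope a r (κ * T) q M (H ξ) (2 * Real.pi * ‖ξ‖)) 2 volume ≤
      ENNReal.ofReal (T ^ (-(((n : ℝ) + 2 * a) / 4)) * gaussianWeightNorm n a κ
        + q * (gaussianWeightNorm n r 1 + 1)) * D := by
  have hw := measurable_gaussianWeight_norm (n := n) a (κ * T)
  have hv := (measurable_gaussianWeight_norm (n := n) r 1).const_mul q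
  have hv_norm := eLpNorm_gaussianWeight hn hr one_pos one_pos
  rw [mul_one, Real.one_rpow, one_mul] at hv_norm
  have hN : ∀ b κ, 0 ≤ gaussianWeightNorm n b κ := fun _ _ ↦ ENNReal.toReal_nonneg
  have hmul : ∀ (k : ℝ), 0 ≤ k → ∀ h : Rn n → ℝ, eLpNorm (fun ξ ↦ k * h ξ) 2 volume =
      ENNReal.ofReal k * eLpNorm h 2 volume := fun k hk h ↦ by
    rw [← Real.enorm_of_nonneg hk]
    exact eLpNorm_const_smul k h 2 volume
  set X := T ^ (-(((n : ℝ) + 2 * a) / 4)) * gaussianWeightNorm n a κ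
  have hX : 0 ≤ X := mul_nonneg (by positivity) (hN _ _)
  calc eLpNorm (fun ξ ↦ frequencyEnvelope a r (κ * T) q M (H ξ) (2 * Real.pi * ‖ξ‖)) 2 volume
      ≤ eLpNorm (fun ξ : Rn n ↦ M * (gaussianWeight a (κ * T) (2 * Real.pi * ‖ξ‖)
          + q * gaussianWeight r 1 (2 * Real.pi * ‖ξ‖))) 2 volume
        + eLpNorm (fun ξ ↦ q * H ξ) 2 volume := by
        simp_rw [frequencyEnvelope, mul_comm _ M]
        exact eLpNorm_add_le ((hw.add hv).const_mul M).aestronglyMeasurable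
          (hH.const_mul q).aestronglyMeasurable one_le_two
    _ ≤ D * (ENNReal.ofReal X + ENNReal.ofReal q * ENNReal.ofReal (gaussianWeightNorm n r 1))
        + ENNReal.ofReal q * D := by
        rw [hmul M hM, hmul q hq, ← hv_norm, ← eLpNorm_gaussianWeight hn ha hκ hT]
        gcongr
        rw [← hmul q hq]
        exact eLpNorm_add_le hw.aestronglyMeasurable hv.aestronglyMeasurable one_le_two
    _ = _ := by
        rw [mul_add q, mul_one, ← add_assoc, ENNReal.ofReal_add (by have := hN r 1; positivity) hq,
          ENNReal.ofReal_add hX (mul_nonneg hq (hN r 1)), ENNReal.ofReal_mul hq]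
        ring

/-- The property of the Fourier weights `W q` of a scale of Sobolev norms of order `q` that the
norms dominate the homogeneous ones at frequencies bounded away from `0`. -/
structure IsHighFrequencyWeight (W : ℝ → Rn n → ℝ) : Prop where
  measurable : ∀ q, Measurable (W q)
  nonneg : ∀ q ξ, 0 ≤ W q ξ
  exists_rpow_le : ∀ e, 0 < e → ∀ q, ∃ K, 0 < K ∧
    ∀ ξ, e ≤ (2 * Real.pi * ‖ξ‖) ^ 2 → (2 * Real.pi * ‖ξ‖) ^ q ≤ K * W q ξ

theorem isHighFrequencyWeight_homogeneous :
    IsHighFrequencyWeight fun q (ξ : Rn n) ↦ (2 * Real.pi * ‖ξ‖) ^ q where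
  measurable q := by fun_prop
  nonneg q ξ := by positivity
  exists_rpow_le _ _ q := ⟨1, one_pos, fun ξ _ ↦ (one_mul _).ge⟩

theorem isHighFrequencyWeight_inhomogeneous :
    IsHighFrequencyWeight fun q (ξ : Rn n) ↦ (1 + (2 * Real.pi * ‖ξ‖) ^ 2) ^ (q / 2) where
  measurable q := by fun_prop
  nonneg q ξ := by positivity
  exists_rpow_le e he q := by
    refine ⟨(1 + 1 / e) ^ |q / 2|, by positivity, fun ξ hξ ↦ ?_⟩
    have hρ : 0 ≤ 2 * Real.pi * ‖ξ‖ := by positivity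
    generalize 2 * Real.pi * ‖ξ‖ = ρ at hξ hρ ⊢
    have hsq : 0 < ρ ^ 2 := he.trans_le hξ
    have hfactor : ρ ^ q = ((1 + ρ ^ 2) / ρ ^ 2) ^ (-(q / 2)) * (1 + ρ ^ 2) ^ (q / 2) := by
      rw [Real.rpow_neg (by positivity), Real.div_rpow (by positivity) hsq.le, inv_div,
        div_mul_cancel₀ _ (by positivity), ← Real.rpow_natCast, ← Real.rpow_mul hρ,
        Nat.cast_ofNat, mul_div_cancel₀ q two_ne_zero]
    have hone : 1 ≤ (1 + ρ ^ 2) / ρ ^ 2 := by rw [le_div_iff₀ hsq]; linarith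
    have hle : (1 + ρ ^ 2) / ρ ^ 2 ≤ 1 + 1 / e := by
      rw [add_div, div_self hsq.ne', add_comm]
      gcongr
    rw [hfactor]
    gcongr
    calc ((1 + ρ ^ 2) / ρ ^ 2) ^ (-(q / 2)) ≤ ((1 + ρ ^ 2) / ρ ^ 2) ^ |q / 2| :=
          Real.rpow_le_rpow_of_exponent_le hone (neg_le_abs _)
      _ ≤ _ := by gcongr

/-- The data in Fourier variables, with the weights of `dataNorm`. -/
noncomputable def dataEnvelope (W : ℝ → Rn n → ℝ) (s : ℝ) (j : Fin 3)
    (f : Fin 3 → Lp ℂ 1 (volume : Measure (Rn n))) (ξ : Rn n) : ℝ :=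
  W (s + max 1 (2 - ((j : ℕ) : ℝ))) ξ * ‖Real.Lp.fourierTransform (f 0) ξ‖
    + W (s + 1) ξ * ‖Real.Lp.fourierTransform (f 1) ξ‖
    + W s ξ * ‖Real.Lp.fourierTransform (f 2) ξ‖

variable {W : ℝ → Rn n → ℝ}

theorem IsHighFrequencyWeight.measurable_mul (hW : IsHighFrequencyWeight W) (q : ℝ)
    (f : Lp ℂ 1 (volume : Measure (Rn n))) :
    Measurable fun ξ ↦ W q ξ * ‖Real.Lp.fourierTransform f ξ‖ :=
  (hW.measurable q).mul (Real.Lp.fourierTransform f).continuous.norm.measurable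

theorem IsHighFrequencyWeight.measurable_dataEnvelope (hW : IsHighFrequencyWeight W) (s : ℝ)
    (j : Fin 3) (f : Fin 3 → Lp ℂ 1 (volume : Measure (Rn n))) :
    Measurable (dataEnvelope W s j f) :=
  ((hW.measurable_mul _ (f 0)).add (hW.measurable_mul _ (f 1))).add (hW.measurable_mul _ (f 2))

theorem IsHighFrequencyWeight.dataEnvelope_nonneg (hW : IsHighFrequencyWeight W) (s : ℝ)
    (j : Fin 3) (f : Fin 3 → Lp ℂ 1 (volume : Measure (Rn n))) (ξ : Rn n) :
    0 ≤ dataEnvelope W s j f ξ :=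
  add_nonneg (add_nonneg (mul_nonneg (hW.nonneg _ ξ) (norm_nonneg _))
    (mul_nonneg (hW.nonneg _ ξ) (norm_nonneg _))) (mul_nonneg (hW.nonneg _ ξ) (norm_nonneg _))

theorem eLpNorm_weight_mul_fourierTransform (w : Rn n → ℝ)
    (f : Lp ℂ 1 (volume : Measure (Rn n))) :
    eLpNorm (fun ξ ↦ w ξ * ‖Real.Lp.fourierTransform f ξ‖) 2 volume =
      weightedFourierNorm w (f : 𝓢'(Rn n, ℂ)) := by
  rw [(hasFourierFunction_of_Lp_one f).weightedFourierNorm_eq]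
  exact eLpNorm_congr_norm_ae (Eventually.of_forall fun ξ ↦ by simp)

theorem IsHighFrequencyWeight.eLpNorm_dataEnvelope_le (hW : IsHighFrequencyWeight W) (s : ℝ)
    (j : Fin 3) (f : Fin 3 → Lp ℂ 1 (volume : Measure (Rn n))) :
    eLpNorm (dataEnvelope W s j f) 2 volume ≤
      dataNorm (fun q ↦ weightedFourierNorm (W q)) s j f := by
  have hm := fun q f ↦ (hW.measurable_mul q f).aestronglyMeasurable (μ := volume)
  refine (eLpNorm_add_le ((hm _ (f 0)).add (hm _ (f 1))) (hm _ (f 2)) one_le_two).trans ?_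
  rw [dataNorm, eLpNorm_weight_mul_fourierTransform]
  refine add_le_add ((eLpNorm_add_le (hm _ (f 0)) (hm _ (f 1)) one_le_two).trans ?_) le_self_add
  rw [eLpNorm_weight_mul_fourierTransform, eLpNorm_weight_mul_fourierTransform]
  exact add_le_add le_self_add le_self_add

theorem ofReal_norm_add_le_dataNorm (N : ℝ → 𝓢'(Rn n, ℂ) → ℝ≥0∞) (s : ℝ) (j : Fin 3)
    (f : Fin 3 → Lp ℂ 1 (volume : Measure (Rn n))) :
    ENNReal.ofReal (‖f 0‖ + ‖f 1‖ + ‖f 2‖) ≤ dataNorm N s j f := by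
  rw [ENNReal.ofReal_add (by positivity) (by positivity),
    ENNReal.ofReal_add (by positivity) (by positivity), ofReal_norm, ofReal_norm, ofReal_norm,
    dataNorm]
  gcongr <;> exact le_add_self

theorem dataNorm_sobolevNorm_ne_top {s : ℝ} (j : Fin 3)
    {f : Fin 3 → Lp ℂ 1 (volume : Measure (Rn n))}
    (hf : ∀ k : Fin 3, TemperedDistribution.MemSobolev (s + 2 - ((k : ℕ) : ℝ)) 2
      (f k : 𝓢'(Rn n, ℂ))) : dataNorm sobolevNorm s j f ≠ ∞ := by
  have hfin : ∀ (k : Fin 3) {q : ℝ}, q ≤ s + 2 - ((k : ℕ) : ℝ) →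
      sobolevNorm q (f k : 𝓢'(Rn n, ℂ)) ≠ ∞ := fun k q hq ↦
    (exists_hasFourierFunction_of_memSobolev ((hf k).mono hq)).choose_spec.2
  have h0 : sobolevNorm (s + max 1 (2 - ((j : ℕ) : ℝ))) (f 0 : 𝓢'(Rn n, ℂ)) ≠ ∞ :=
    hfin 0 (by simp)
  have h1 : sobolevNorm (s + 1) (f 1 : 𝓢'(Rn n, ℂ)) ≠ ∞ := hfin 1 (by norm_num; linarith)
  have h2 : sobolevNorm s (f 2 : 𝓢'(Rn n, ℂ)) ≠ ∞ := hfin 2 (by norm_num)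
  simp [dataNorm, h0, h1, h2]

end DataNorms

section SlowAmplitude

variable {n : ℕ}

/-- The Fourier transform of `γ⁻¹ (γ f₀ + f₁ + τ f₂)`. -/
noncomputable def slowAmplitude (τ γ : ℝ) (f : Fin 3 → Lp ℂ 1 (volume : Measure (Rn n))) :
    BoundedContinuousFunction (Rn n) ℂ :=
  γ⁻¹ • (γ • Real.Lp.fourierTransform (f 0) + Real.Lp.fourierTransform (f 1)
    + τ • Real.Lp.fourierTransform (f 2))

theorem slowAmplitude_zero (τ γ : ℝ) (f : Fin 3 → Lp ℂ 1 (volume : Measure (Rn n))) :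
    slowAmplitude τ γ f 0 = combinedMoment τ γ f * ((γ⁻¹ : ℝ) : ℂ) := by
  have hzero : ∀ l, Real.Lp.fourierTransform (f l) 0 = ∫ x, f l x := fun l ↦ by
    rw [Real.Lp.fourierTransform_apply, Real.fourier_eq]
    simp
  have hint : ∀ l, Integrable (f l : Rn n → ℂ) := fun l ↦ L1.integrable_coeFn (f l)
  have hint₀₁ : Integrable fun x ↦ (γ : ℂ) * f 0 x + f 1 x :=
    ((hint 0).const_mul _).add (hint 1)
  rw [combinedMoment, integral_add hint₀₁ ((hint 2).const_mul _),
    integral_add ((hint 0).const_mul _) (hint 1), integral_const_mul, integral_const_mul,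
    ← hzero, ← hzero, ← hzero, mul_comm]
  rfl

theorem norm_fourierTransform_le (f : Lp ℂ 1 (volume : Measure (Rn n))) (ξ : Rn n) :
    ‖Real.Lp.fourierTransform f ξ‖ ≤ ‖f‖ := by
  rw [Real.Lp.fourierTransform_apply, L1.norm_eq_integral_norm]
  exact VectorFourier.norm_fourierIntegral_le_integral_norm _ _ _ _ _

theorem ae_norm_pos (hn : 1 ≤ n) : ∀ᵐ ξ : Rn n, 0 < ‖ξ‖ := by
  have := nontrivial_Rn hn
  filter_upwards [Measure.ae_ne volume (0 : Rn n)] with ξ hξ using norm_pos_iff.2 hξ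

end SlowAmplitude

/-! ### Estimates for the Sobolev solution -/

section SolutionBounds

theorem exists_mode_frequencyBounds {τ δ γ : ℝ} (hτ : 0 < τ) (hδ : 0 < δ) (hγ : 0 < γ)
    (j : Fin 3) :
    ∃ e C c : ℝ, 0 < e ∧ 0 < C ∧ 0 < c ∧ ∀ {ρ t M : ℝ} {u : Fin 3 → ℝ → ℂ}, 0 < ρ → 0 ≤ t →
      IsModeSolution τ δ γ (ρ ^ 2) u → ‖u 0 0‖ + ‖u 1 0‖ + ‖u 2 0‖ ≤ M →
      FrequencyBounds γ e C c (2 - ((j : ℕ) : ℝ)) j t ρ M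
        (ρ ^ max 1 (2 - ((j : ℕ) : ℝ)) * ‖u 0 0‖ + ρ * ‖u 1 0‖ + ‖u 2 0‖)
        (slowMean τ γ u) (u j t) := by
  obtain ⟨e, C₁, c₁, he, hC₁, hc₁, hlow⟩ := exists_mode_asymptotics_low (V := ℂ) hτ hδ hγ
  obtain ⟨C₂, c₂, hC₂, hc₂, hhigh⟩ := exists_mode_decay_high (V := ℂ) hτ hδ hγ he j
  set C₃ := 1 + (1 + τ) / γ
  have hC₃ : 0 < C₃ := by positivity
  refine ⟨e, C₁ + C₂ + C₃, min c₁ c₂, he, by positivity, by positivity,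
    fun {ρ t M u} hρ ht hu hM ↦ ?_⟩
  have hM₀ : 0 ≤ M := le_trans (by positivity) hM
  refine ⟨hρ, hM₀, by positivity, (norm_slowMean_le hτ.le hγ u).trans ?_, fun hρe ↦ ?_,
    fun hρe ↦ (hhigh ρ hρ hρe u hu t ht).trans ?_⟩
  · exact mul_le_mul (by linarith) hM (by positivity) (by positivity)
  · refine (hlow (ρ ^ 2) (by positivity) hρe u hu t ht j).trans ?_
    gcongr
    · linarith
    · exact min_le_left _ _
    · exact min_le_left _ _
  · gcongr
    · linarith
    · exact min_le_right _ _

theorem FrequencyBounds.rpow_mul_high {γ e C c r s t ρ M H H' K : ℝ} {j : ℕ} {A g : ℂ}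
    (h : FrequencyBounds γ e C c r j t ρ M H A g) (hC : 0 < C) (hK : 1 ≤ K) (hH' : 0 ≤ H')
    (hH : e ≤ ρ ^ 2 → ρ ^ s * H ≤ K * H') :
    FrequencyBounds γ e (C * K) c (s + r) j t ρ M H' A g where
  pos := h.pos
  mass_nonneg := h.mass_nonneg
  data_nonneg := hH'
  amplitude := by
    have := h.mass_nonneg
    refine h.amplitude.trans ?_
    gcongr
    exact le_mul_of_one_le_right hC.le hK
  low hρe := by
    have := h.pos
    have := h.mass_nonneg
    refine (h.low hρe).trans ?_
    gcongr
    exact le_mul_of_one_le_right hC.le hK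
  high hρe := by
    have := h.pos
    calc ρ ^ (s + r) * ‖g‖ = ρ ^ s * (ρ ^ r * ‖g‖) := by rw [Real.rpow_add h.pos, mul_assoc]
      _ ≤ ρ ^ s * (C * Real.exp (-c * t) * H) := by
          gcongr ρ ^ s * ?_; exact h.high hρe
      _ = C * Real.exp (-c * t) * (ρ ^ s * H) := by ring
      _ ≤ C * Real.exp (-c * t) * (K * H') := by
          gcongr C * Real.exp (-c * t) * ?_; exact hH hρe
      _ = C * K * Real.exp (-c * t) * H' := by ring

variable {n : ℕ} {W : ℝ → Rn n → ℝ}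

theorem IsHighFrequencyWeight.exists_le_dataEnvelope (hW : IsHighFrequencyWeight W) {e : ℝ}
    (he : 0 < e) (s : ℝ) (j : Fin 3) :
    ∃ K : ℝ, 1 ≤ K ∧ ∀ (f : Fin 3 → Lp ℂ 1 (volume : Measure (Rn n))) (ξ : Rn n),
      e ≤ (2 * Real.pi * ‖ξ‖) ^ 2 → (2 * Real.pi * ‖ξ‖) ^ s *
        ((2 * Real.pi * ‖ξ‖) ^ max 1 (2 - ((j : ℕ) : ℝ)) * ‖Real.Lp.fourierTransform (f 0) ξ‖
          + 2 * Real.pi * ‖ξ‖ * ‖Real.Lp.fourierTransform (f 1) ξ‖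
          + ‖Real.Lp.fourierTransform (f 2) ξ‖) ≤ K * dataEnvelope W s j f ξ := by
  set m : ℝ := max 1 (2 - ((j : ℕ) : ℝ)) with hm
  obtain ⟨K₀, hK₀, h₀⟩ := hW.exists_rpow_le e he (s + m)
  obtain ⟨K₁, hK₁, h₁⟩ := hW.exists_rpow_le e he (s + 1)
  obtain ⟨K₂, hK₂, h₂⟩ := hW.exists_rpow_le e he s
  refine ⟨1 + K₀ + K₁ + K₂, by linarith, fun f ξ hξ ↦ ?_⟩
  have hterm : ∀ {q K z : ℝ}, (2 * Real.pi * ‖ξ‖) ^ q ≤ K * W q ξ → K ≤ 1 + K₀ + K₁ + K₂ →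
      0 ≤ z → (2 * Real.pi * ‖ξ‖) ^ q * z ≤ (1 + K₀ + K₁ + K₂) * (W q ξ * z) :=
    fun {q K z} hq hK hz ↦ by
      have := hW.nonneg q ξ
      calc _ ≤ K * W q ξ * z := by gcongr
        _ ≤ (1 + K₀ + K₁ + K₂) * W q ξ * z := by gcongr
        _ = _ := mul_assoc _ _ _
  have hρ : 0 < 2 * Real.pi * ‖ξ‖ :=
    (by positivity : 0 ≤ 2 * Real.pi * ‖ξ‖).lt_of_ne' fun h ↦ by norm_num [h] at hξ; linarith
  have t₀ := hterm (h₀ ξ hξ) (by linarith) (norm_nonneg (Real.Lp.fourierTransform (f 0) ξ))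
  have t₁ := hterm (h₁ ξ hξ) (by linarith) (norm_nonneg (Real.Lp.fourierTransform (f 1) ξ))
  have t₂ := hterm (h₂ ξ hξ) (by linarith) (norm_nonneg (Real.Lp.fourierTransform (f 2) ξ))
  rw [Real.rpow_add hρ] at t₀
  rw [Real.rpow_add hρ, Real.rpow_one] at t₁
  rw [dataEnvelope, ← hm]
  linarith

theorem IsHighFrequencyWeight.exists_frequencyBounds (hW : IsHighFrequencyWeight W) (hn : 1 ≤ n)
    {τ δ γ : ℝ} (hτ : 0 < τ) (hδ : 0 < δ) (hγ : 0 < γ) (s : ℝ) (j : Fin 3) :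
    ∃ e C c : ℝ, 0 < e ∧ 0 < C ∧ 0 < c ∧
      ∀ {f : Fin 3 → Lp ℂ 1 (volume : Measure (Rn n))} {φ : Fin 3 → ℝ → 𝓢'(Rn n, ℂ)},
      IsSobolevSolution τ δ γ s (fun k ↦ (f k : 𝓢'(Rn n, ℂ))) φ → ∀ {t : ℝ}, 0 ≤ t →
      ∃ g, HasFourierFunction (φ j t) g ∧ ∀ᵐ ξ,
        FrequencyBounds γ e C c (s + 2 - ((j : ℕ) : ℝ)) j t (2 * Real.pi * ‖ξ‖)
          (‖f 0‖ + ‖f 1‖ + ‖f 2‖) (dataEnvelope W s j f ξ) (slowAmplitude τ γ f ξ) (g ξ) := by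
  obtain ⟨e, C, c, he, hC, hc, hmode⟩ := exists_mode_frequencyBounds hτ hδ hγ j
  obtain ⟨K, hK, hdata⟩ := hW.exists_le_dataEnvelope he s j
  refine ⟨e, C * K, c, he, by positivity, hc, fun {f φ} hφ {t} ht ↦ ?_⟩
  obtain ⟨g, hg, hgu⟩ := hφ.exists_ae_mode hτ.ne' ht j
  refine ⟨g, hg, ?_⟩
  filter_upwards [hgu, ae_norm_pos hn] with ξ ⟨u, hu, hinit, hgt⟩ hξ
  have hmass : ‖u 0 0‖ + ‖u 1 0‖ + ‖u 2 0‖ ≤ ‖f 0‖ + ‖f 1‖ + ‖f 2‖ := by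
    simp only [hinit]
    gcongr <;> exact norm_fourierTransform_le _ ξ
  have hamplitude : slowMean τ γ u = slowAmplitude τ γ f ξ := by
    simp only [slowMean, hinit]
    rfl
  have hbounds := hmode (by positivity) ht hu hmass
  rw [hamplitude, ← hgt] at hbounds
  simp only [hinit] at hbounds
  rw [add_sub_assoc]
  exact hbounds.rpow_mul_high hC hK (hW.dataEnvelope_nonneg s j f ξ) (hdata f ξ)

end SolutionBounds

section UpperBound

variable {n : ℕ}

theorem decayRate_eq (n : ℕ) (s : ℝ) (j : Fin 3) :
    decayRate n s j = ((n : ℝ) + 2 * (s + 2 - ((j : ℕ) : ℝ) + 2 * ((j : ℕ) : ℝ))) / 4 := by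
  rw [decayRate]; ring

theorem IsHighFrequencyWeight.exists_homSobolevNorm_le {W : ℝ → Rn n → ℝ}
    (hW : IsHighFrequencyWeight W) (hn : 1 ≤ n) {τ δ γ s : ℝ} (hτ : 0 < τ) (hδ : 0 < δ)
    (hγ : 0 < γ) {j : Fin 3} (hr : 0 < (n : ℝ) + 2 * (s + 2 - ((j : ℕ) : ℝ))) :
    ∃ C : ℝ, 0 < C ∧ ∀ {f : Fin 3 → Lp ℂ 1 (volume : Measure (Rn n))}
      {φ : Fin 3 → ℝ → 𝓢'(Rn n, ℂ)},
      IsSobolevSolution τ δ γ s (fun k ↦ (f k : 𝓢'(Rn n, ℂ))) φ → ∀ {t : ℝ}, 0 ≤ t →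
      homSobolevNorm (s + 2 - ((j : ℕ) : ℝ)) (φ j t) ≤
        ENNReal.ofReal (C * (1 + t) ^ (-decayRate n s j)) *
          dataNorm (fun q ↦ weightedFourierNorm (W q)) s j f := by
  obtain ⟨e, C, c, he, hC, hc, hbounds⟩ := hW.exists_frequencyBounds hn hτ hδ hγ s j
  set r := s + 2 - ((j : ℕ) : ℝ)
  obtain ⟨K, κ, hK, hκ, henvelope⟩ := exists_rpow_mul_norm_le_frequencyEnvelope hγ he hC hc r j
  obtain ⟨Q, hQ, hexp⟩ := exists_exp_neg_le_rpow (decayRate n s j) hc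
  have hN : ∀ a κ, 0 ≤ gaussianWeightNorm n a κ := fun _ _ ↦ ENNReal.toReal_nonneg
  set N₀ := gaussianWeightNorm n (r + 2 * ((j : ℕ) : ℝ)) κ
  have hN₀ : 0 ≤ N₀ := hN _ _
  set N₁ := gaussianWeightNorm n r 1
  have hN₁ : 0 ≤ N₁ := hN _ _
  refine ⟨K * (N₀ + Q * (N₁ + 1)), by positivity, fun {f φ} hφ {t} ht ↦ ?_⟩
  obtain ⟨g, hg, hgξ⟩ := hbounds hφ ht
  set D := dataNorm (fun q ↦ weightedFourierNorm (W q)) s j f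
  have hL2 := eLpNorm_frequencyEnvelope_le hn (a := r + 2 * ((j : ℕ) : ℝ)) (T := 1 + t)
    (by linarith [(Nat.cast_nonneg j : (0 : ℝ) ≤ ((j : ℕ) : ℝ))]) hr hκ (by linarith)
    (Real.exp_nonneg (-c * t)) (by positivity) (hW.measurable_dataEnvelope s j f)
    (ofReal_norm_add_le_dataNorm _ s j f) (hW.eLpNorm_dataEnvelope_le s j f)
  rw [← decayRate_eq] at hL2
  rw [homSobolevNorm, hg.weightedFourierNorm_eq]
  calc eLpNorm (fun ξ ↦ (((2 * Real.pi * ‖ξ‖) ^ r : ℝ) : ℂ) * g ξ) 2 volume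
      ≤ ENNReal.ofReal K * eLpNorm (fun ξ ↦ frequencyEnvelope (r + 2 * ((j : ℕ) : ℝ)) r
          (κ * (1 + t)) (Real.exp (-c * t)) (‖f 0‖ + ‖f 1‖ + ‖f 2‖) (dataEnvelope W s j f ξ)
          (2 * Real.pi * ‖ξ‖)) 2 volume := by
        refine eLpNorm_le_mul_eLpNorm_of_ae_le_mul (hgξ.mono fun ξ hξ ↦ ?_) 2
        rw [norm_mul, Complex.norm_real, Real.norm_of_nonneg (by positivity)]
        exact (henvelope ht hξ).trans (by gcongr; exact Real.le_norm_self _)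
    _ ≤ ENNReal.ofReal K * (ENNReal.ofReal ((1 + t) ^ (-decayRate n s j) * N₀
          + Q * (1 + t) ^ (-decayRate n s j) * (N₁ + 1)) * D) := by
        refine mul_le_mul_right (hL2.trans ?_) _
        gcongr
        exact hexp t ht
    _ = _ := by
        rw [← mul_assoc, ← ENNReal.ofReal_mul hK.le]
        ring_nf

end UpperBound

section Asymptotics

variable {n : ℕ}

/-- The weight `ρ ^ r` with a cut-off at the diffusive scale `√t ρ ∼ 1`. The cut-off is trivial for
`b = σ = 0`, which serves for the asymptotic profile; for large `b` it removes the singularity at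
`ρ = 0`, which serves for the lower bound with arbitrary `r`. -/
noncomputable def cutoffWeight (r b σ t : ℝ) (ξ : Rn n) : ℝ :=
  gaussianWeight b σ (√t * (2 * Real.pi * ‖ξ‖)) * (2 * Real.pi * ‖ξ‖) ^ r

theorem cutoffWeight_nonneg (r b σ t : ℝ) (ξ : Rn n) : 0 ≤ cutoffWeight r b σ t ξ :=
  mul_nonneg (gaussianWeight_nonneg (by positivity) _ _) (by positivity)

theorem measurable_cutoffWeight (r b σ t : ℝ) : Measurable (cutoffWeight r b σ t : Rn n → ℝ) :=
  ((measurable_gaussianWeight b σ).comp (by fun_prop)).mul (by fun_prop)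

theorem cutoffWeight_zero_zero (r t : ℝ) :
    cutoffWeight r 0 0 t = fun ξ : Rn n ↦ (2 * Real.pi * ‖ξ‖) ^ r := by
  ext ξ
  simp [cutoffWeight, gaussianWeight]

theorem cutoffWeight_mul_abs_diffusionMultiplier {γ t : ℝ} (hγ : 0 < γ) (ht : 0 < t)
    (r b σ : ℝ) (j : ℕ) {ξ : Rn n} (hξ : 0 < ‖ξ‖) :
    cutoffWeight r b σ t ξ * |diffusionMultiplier γ j t (2 * Real.pi * ‖ξ‖)| =
      t ^ (b / 2) * γ⁻¹ ^ j *
        gaussianWeight (r + b + 2 * j) ((γ⁻¹ + σ) * t) (2 * Real.pi * ‖ξ‖) := by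
  have hρ : 0 < 2 * Real.pi * ‖ξ‖ := by positivity
  set ρ := 2 * Real.pi * ‖ξ‖
  have hcutoff : gaussianWeight b σ (√t * ρ) = t ^ (b / 2) * gaussianWeight b (σ * t) ρ := by
    rw [gaussianWeight_mul_time hρ.le ht, ← mul_assoc (t ^ (b / 2)), ← Real.rpow_add ht, neg_div,
      add_neg_cancel, Real.rpow_zero, one_mul]
  rw [cutoffWeight, mul_assoc, rpow_mul_abs_diffusionMultiplier hγ hρ, hcutoff]
  simp only [gaussianWeight]
  rw [add_right_comm r b, Real.rpow_add hρ _ b,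
    show -((γ⁻¹ + σ) * t) * ρ ^ 2 = -(γ⁻¹ * t) * ρ ^ 2 + -(σ * t) * ρ ^ 2 by ring, Real.exp_add]
  ring

theorem tendsto_ofReal_inv_add_rpow_mul_exp_mul {c : ℝ} (hc : 0 < c) (K β N₀ N₁ : ℝ) {D : ℝ≥0∞}
    (hD : D ≠ ∞) :
    Tendsto (fun t : ℝ ↦
      ENNReal.ofReal (K * (t⁻¹ * N₀ + t ^ β * Real.exp (-c * t) * N₁)) * D) atTop (𝓝 0) := by
  have hlim := ENNReal.tendsto_ofReal (((tendsto_inv_atTop_zero (𝕜 := ℝ)).mul_const N₀).add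
    ((tendsto_rpow_mul_exp_neg_mul_atTop_nhds_zero β c hc).mul_const N₁) |>.const_mul K)
  rw [zero_mul, zero_mul, add_zero, mul_zero, ENNReal.ofReal_zero] at hlim
  simpa using ENNReal.Tendsto.mul_const hlim (Or.inr hD)

theorem tendsto_eLpNorm_cutoffWeight_mul_norm_sub {γ e C c r b σ B M : ℝ} {j : ℕ} (hn : 1 ≤ n)
    (hγ : 0 < γ) (he : 0 < e) (hC : 0 < C) (hc : 0 < c) (hb : 0 ≤ b) (hσ : 0 ≤ σ)
    (hcutoff : ∀ y, 0 ≤ y → gaussianWeight b σ y ≤ B) (hr : 0 < (n : ℝ) + 2 * (r + b))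
    (hM : 0 ≤ M) {H : Rn n → ℝ} (hHm : Measurable H) (hH : eLpNorm H 2 volume ≠ ∞) {A : Rn n → ℂ}
    {g : ℝ → Rn n → ℂ} (hg : ∀ t, 1 ≤ t → ∀ᵐ ξ,
      FrequencyBounds γ e C c r j t (2 * Real.pi * ‖ξ‖) M (H ξ) (A ξ) (g t ξ)) :
    Tendsto (fun t ↦ ENNReal.ofReal (t ^ (((n : ℝ) + 2 * (r + 2 * j)) / 4)) *
      eLpNorm (fun ξ ↦ cutoffWeight r b σ t ξ *
        ‖g t ξ - diffusionMultiplier γ j t (2 * Real.pi * ‖ξ‖) • A ξ‖) 2 volume)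
      atTop (𝓝 0) := by
  obtain ⟨K, κ, hK, hκ, henvelope⟩ :=
    exists_cutoff_mul_norm_sub_le_frequencyEnvelope hγ he hC hc hb hσ hcutoff r j
  set β := ((n : ℝ) + 2 * (r + b + 2 * j)) / 4
  set N₀ := gaussianWeightNorm n (r + b + 2 * j + 2) κ
  set N₁ := gaussianWeightNorm n (r + b) 1
  have hdecay := tendsto_ofReal_inv_add_rpow_mul_exp_mul hc K β N₀ (N₁ + 1)
    (ENNReal.add_ne_top.2 ⟨ENNReal.ofReal_ne_top, hH⟩ : ENNReal.ofReal M + eLpNorm H 2 volume ≠ ∞)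
  refine tendsto_of_tendsto_of_tendsto_of_le_of_le' tendsto_const_nhds hdecay
    (Eventually.of_forall fun _ ↦ zero_le) ?_
  filter_upwards [eventually_ge_atTop 1] with t ht
  have ht₀ : 0 < t := one_pos.trans_le ht
  have hL2 := eLpNorm_frequencyEnvelope_le hn (a := r + b + 2 * j + 2) (T := t)
    (by linarith [(Nat.cast_nonneg j : (0 : ℝ) ≤ j)]) hr hκ ht₀
    (Real.exp_nonneg (-c * t)) hM hHm le_self_add (le_add_self : _ ≤ ENNReal.ofReal M + _)
  have hrate : t ^ (((n : ℝ) + 2 * (r + 2 * j)) / 4) * t ^ (b / 2) = t ^ β := by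
    rw [← Real.rpow_add ht₀]
    congr 1
    ring
  have hgain : t ^ β * t ^ (-(((n : ℝ) + 2 * (r + b + 2 * j + 2)) / 4)) = t⁻¹ := by
    rw [← Real.rpow_add ht₀, ← Real.rpow_neg_one]
    congr 1
    ring
  calc _ ≤ ENNReal.ofReal (t ^ (((n : ℝ) + 2 * (r + 2 * j)) / 4)) *
        (ENNReal.ofReal (K * t ^ (b / 2)) * eLpNorm (fun ξ ↦ frequencyEnvelope
          (r + b + 2 * j + 2) (r + b) (κ * t) (Real.exp (-c * t)) M (H ξ)
          (2 * Real.pi * ‖ξ‖)) 2 volume) := by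
        refine mul_le_mul_right (eLpNorm_le_mul_eLpNorm_of_ae_le_mul
          ((hg t ht).mono fun ξ hξ ↦ ?_) 2) _
        rw [Real.norm_of_nonneg (mul_nonneg (cutoffWeight_nonneg _ _ _ _ _) (norm_nonneg _)),
          cutoffWeight, mul_assoc]
        exact (henvelope ht hξ).trans (by gcongr; exact Real.le_norm_self _)
    _ ≤ _ := mul_le_mul_right (mul_le_mul_right hL2 _) _
    _ = _ := by
        rw [← mul_assoc, ← mul_assoc, ← ENNReal.ofReal_mul (by positivity),
          ← ENNReal.ofReal_mul (by positivity)]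
        congr 2
        rw [← hgain, ← hrate]
        ring

theorem eLpNorm_cutoffWeight_mul_norm_diffusion {γ t : ℝ} (hn : 1 ≤ n) (hγ : 0 < γ) (ht : 0 < t)
    (r b σ : ℝ) (j : ℕ) (h : Rn n → ℂ) :
    ENNReal.ofReal (t ^ (((n : ℝ) + 2 * (r + 2 * j)) / 4)) * eLpNorm (fun ξ ↦
        cutoffWeight r b σ t ξ * ‖diffusionMultiplier γ j t (2 * Real.pi * ‖ξ‖) • h ξ‖) 2 volume =
      ENNReal.ofReal (γ⁻¹ ^ j) * (ENNReal.ofReal (t ^ (((n : ℝ) + 2 * (r + b + 2 * j)) / 4)) *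
        eLpNorm (fun ξ ↦ gaussianWeight (r + b + 2 * j) ((γ⁻¹ + σ) * t) (2 * Real.pi * ‖ξ‖) • h ξ)
          2 volume) := by
  have hweight : eLpNorm (fun ξ ↦ cutoffWeight r b σ t ξ *
      ‖diffusionMultiplier γ j t (2 * Real.pi * ‖ξ‖) • h ξ‖) 2 volume =
      eLpNorm ((t ^ (b / 2) * γ⁻¹ ^ j) • fun ξ ↦
        gaussianWeight (r + b + 2 * j) ((γ⁻¹ + σ) * t) (2 * Real.pi * ‖ξ‖) • h ξ) 2 volume := by
    refine eLpNorm_congr_norm_ae ((ae_norm_pos hn).mono fun ξ hξ ↦ ?_)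
    have := gaussianWeight_nonneg (show 0 ≤ 2 * Real.pi * ‖ξ‖ by positivity)
      (r + b + 2 * j) ((γ⁻¹ + σ) * t)
    rw [norm_smul, Real.norm_eq_abs (diffusionMultiplier _ _ _ _), ← mul_assoc,
      cutoffWeight_mul_abs_diffusionMultiplier hγ ht r b σ j hξ, Pi.smul_apply, ← mul_smul,
      norm_smul, norm_mul, norm_norm]
  have hrate : t ^ (((n : ℝ) + 2 * (r + b + 2 * j)) / 4) =
      t ^ (((n : ℝ) + 2 * (r + 2 * j)) / 4) * t ^ (b / 2) := by
    rw [← Real.rpow_add ht]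
    ring_nf
  rw [hweight, eLpNorm_const_smul, Real.enorm_of_nonneg (by positivity), hrate, ← mul_assoc,
    ← mul_assoc, ← ENNReal.ofReal_mul (by positivity), ← ENNReal.ofReal_mul (by positivity)]
  congr 2
  ring

theorem tendsto_eLpNorm_cutoffWeight_mul_norm_diffusion_sub {γ r b σ : ℝ} {j : ℕ} (hn : 1 ≤ n)
    (hγ : 0 < γ) (hσ : 0 ≤ σ) (hr : 0 < (n : ℝ) + 2 * (r + b))
    (A : BoundedContinuousFunction (Rn n) ℂ) :
    Tendsto (fun t ↦ ENNReal.ofReal (t ^ (((n : ℝ) + 2 * (r + 2 * j)) / 4)) * eLpNorm (fun ξ ↦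
      cutoffWeight r b σ t ξ * ‖diffusionMultiplier γ j t (2 * Real.pi * ‖ξ‖) • (A ξ - A 0)‖)
        2 volume) atTop (𝓝 0) := by
  have hlim := ENNReal.Tendsto.const_mul (tendsto_eLpNorm_gaussianWeight_smul_sub hn
    (a := r + b + 2 * j) (κ := γ⁻¹ + σ) (by linarith [(Nat.cast_nonneg j : (0 : ℝ) ≤ j)])
    (by positivity) A) (Or.inr (ENNReal.ofReal_ne_top (r := γ⁻¹ ^ j)))
  rw [mul_zero] at hlim
  refine hlim.congr' ?_
  filter_upwards [eventually_gt_atTop 0] with t ht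
  exact (eLpNorm_cutoffWeight_mul_norm_diffusion hn hγ ht r b σ j fun ξ ↦ A ξ - A 0).symm

theorem eLpNorm_cutoffWeight_mul_norm_sub_le (γ r b σ t : ℝ) (j : ℕ) {g : Rn n → ℂ}
    (hg : AEStronglyMeasurable g volume) (A : BoundedContinuousFunction (Rn n) ℂ) :
    eLpNorm (fun ξ ↦ cutoffWeight r b σ t ξ *
        ‖g ξ - diffusionMultiplier γ j t (2 * Real.pi * ‖ξ‖) • A 0‖) 2 volume ≤
      eLpNorm (fun ξ ↦ cutoffWeight r b σ t ξ *
          ‖g ξ - diffusionMultiplier γ j t (2 * Real.pi * ‖ξ‖) • A ξ‖) 2 volume +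
        eLpNorm (fun ξ ↦ cutoffWeight r b σ t ξ *
          ‖diffusionMultiplier γ j t (2 * Real.pi * ‖ξ‖) • (A ξ - A 0)‖) 2 volume := by
  have hm : AEStronglyMeasurable
      (fun ξ : Rn n ↦ diffusionMultiplier γ j t (2 * Real.pi * ‖ξ‖)) volume := by
    unfold diffusionMultiplier
    exact Measurable.aestronglyMeasurable (by fun_prop)
  have hw := (measurable_cutoffWeight (n := n) r b σ t).aestronglyMeasurable (μ := volume)
  refine (eLpNorm_mono_real fun ξ ↦ ?_).trans (eLpNorm_add_le
    (hw.mul (hg.sub (hm.smul A.continuous.aestronglyMeasurable)).norm)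
    (hw.mul (hm.smul (A.continuous.sub continuous_const).aestronglyMeasurable).norm) one_le_two)
  have hw₀ := cutoffWeight_nonneg r b σ t ξ
  rw [Real.norm_of_nonneg (by positivity)]
  refine (mul_le_mul_of_nonneg_left ?_ hw₀).trans_eq (mul_add _ _ _)
  rw [smul_sub]
  exact norm_sub_le_norm_sub_add_norm_sub _ _ _

theorem IsHighFrequencyWeight.tendsto_weightedFourierNorm_sub {W : ℝ → Rn n → ℝ}
    (hW : IsHighFrequencyWeight W) (hn : 1 ≤ n) {τ δ γ s b σ B : ℝ} (hτ : 0 < τ) (hδ : 0 < δ)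
    (hγ : 0 < γ) {j : Fin 3} (hb : 0 ≤ b) (hσ : 0 ≤ σ)
    (hcutoff : ∀ y, 0 ≤ y → gaussianWeight b σ y ≤ B)
    (hr : 0 < (n : ℝ) + 2 * (s + 2 - ((j : ℕ) : ℝ) + b))
    {f : Fin 3 → Lp ℂ 1 (volume : Measure (Rn n))} {φ : Fin 3 → ℝ → 𝓢'(Rn n, ℂ)}
    (hφ : IsSobolevSolution τ δ γ s (fun k ↦ (f k : 𝓢'(Rn n, ℂ))) φ)
    (hD : dataNorm (fun q ↦ weightedFourierNorm (W q)) s j f ≠ ∞) :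
    Tendsto (fun t ↦ ENNReal.ofReal (t ^ decayRate n s j) *
      weightedFourierNorm (cutoffWeight (s + 2 - ((j : ℕ) : ℝ)) b σ t)
        (φ j t - combinedMoment τ γ f • diffusionProfile n γ j t)) atTop (𝓝 0) := by
  obtain ⟨e, C, c, he, hC, hc, hbounds⟩ := hW.exists_frequencyBounds hn hτ hδ hγ s j
  set r := s + 2 - ((j : ℕ) : ℝ)
  set A := slowAmplitude τ γ f
  have hmode : ∀ t : ℝ, ∃ g, 1 ≤ t → HasFourierFunction (φ j t) g ∧ ∀ᵐ ξ,
      FrequencyBounds γ e C c r j t (2 * Real.pi * ‖ξ‖) (‖f 0‖ + ‖f 1‖ + ‖f 2‖)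
        (dataEnvelope W s j f ξ) (A ξ) (g ξ) := fun t ↦ by
    by_cases ht : 1 ≤ t
    · obtain ⟨g, hg⟩ := hbounds hφ (zero_le_one.trans ht)
      exact ⟨g, fun _ ↦ hg⟩
    · exact ⟨0, fun h ↦ absurd h ht⟩
  choose g hg using hmode
  have hmodes := tendsto_eLpNorm_cutoffWeight_mul_norm_sub hn hγ he hC hc hb hσ hcutoff hr
    (by positivity) (hW.measurable_dataEnvelope s j f)
    (ne_top_of_le_ne_top hD (hW.eLpNorm_dataEnvelope_le s j f)) fun t ht ↦ (hg t ht).2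
  have hamplitude := tendsto_eLpNorm_cutoffWeight_mul_norm_diffusion_sub (j := j) hn hγ hσ hr A
  refine tendsto_of_tendsto_of_tendsto_of_le_of_le' tendsto_const_nhds
    (add_zero (0 : ℝ≥0∞) ▸ hmodes.add hamplitude) (Eventually.of_forall fun _ ↦ zero_le) ?_
  filter_upwards [eventually_ge_atTop 1] with t ht
  have hprofile := (hg t ht).1.sub ((hasFourierFunction_diffusionProfile (n := n) hγ
    (one_pos.trans_le ht) j).smul (combinedMoment τ γ f))
  have hgm := (hg t ht).1.locallyIntegrable.aestronglyMeasurable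
  rw [hprofile.weightedFourierNorm_eq, decayRate_eq, ← mul_add]
  refine mul_le_mul_right (le_of_eq_of_le ?_
    (eLpNorm_cutoffWeight_mul_norm_sub_le γ r b σ t j hgm A)) _
  refine eLpNorm_congr_norm_ae (Eventually.of_forall fun ξ ↦ ?_)
  rw [norm_mul, norm_mul, norm_norm, Complex.norm_real, slowAmplitude_zero, mul_smul_comm]

end Asymptotics

section Profile

variable {n : ℕ}

theorem IsSobolevSolution.tendsto_homSobolevNorm_sub (hn : 1 ≤ n) {τ δ γ s : ℝ} (hτ : 0 < τ)
    (hδ : 0 < δ) (hγ : 0 < γ) {j : Fin 3} (hr : 0 < (n : ℝ) + 2 * (s + 2 - ((j : ℕ) : ℝ)))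
    {f : Fin 3 → Lp ℂ 1 (volume : Measure (Rn n))} {φ : Fin 3 → ℝ → 𝓢'(Rn n, ℂ)}
    (hφ : IsSobolevSolution τ δ γ s (fun k ↦ (f k : 𝓢'(Rn n, ℂ))) φ)
    (hf : ∀ k : Fin 3, TemperedDistribution.MemSobolev (s + 2 - ((k : ℕ) : ℝ)) 2
      (f k : 𝓢'(Rn n, ℂ))) :
    Tendsto (fun t ↦ ENNReal.ofReal (t ^ decayRate n s j) *
      homSobolevNorm (s + 2 - ((j : ℕ) : ℝ))
        (φ j t - combinedMoment τ γ f • diffusionProfile n γ j t)) atTop (𝓝 0) := by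
  have hlim := isHighFrequencyWeight_inhomogeneous.tendsto_weightedFourierNorm_sub hn hτ hδ hγ
    (j := j) (b := 0) (σ := 0) le_rfl le_rfl (fun y _ ↦ (by simp [gaussianWeight] : _ ≤ (1 : ℝ)))
    (by rwa [add_zero]) hφ (dataNorm_sobolevNorm_ne_top j hf)
  simpa only [cutoffWeight_zero_zero, homSobolevNorm] using hlim

end Profile

section LowerBound

variable {n : ℕ}

theorem exists_gaussianWeight_one_le {b : ℝ} (hb : 0 ≤ b) :
    ∃ B : ℝ, 0 < B ∧ ∀ y, 0 ≤ y → gaussianWeight b 1 y ≤ B := by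
  obtain ⟨B, hB, hexp⟩ := exists_exp_neg_le_rpow b one_pos
  refine ⟨B, hB, fun y hy ↦ ?_⟩
  calc gaussianWeight b 1 y ≤ (1 + y ^ 2) ^ b * (B * (1 + y ^ 2) ^ (-b)) := by
        unfold gaussianWeight
        gcongr
        · nlinarith [sq_nonneg (y - 1)]
        · exact hexp _ (sq_nonneg y)
    _ = B := by
        rw [mul_left_comm, ← Real.rpow_add (by positivity), add_neg_cancel, Real.rpow_zero, mul_one]

theorem gaussianWeightNorm_pos (hn : 1 ≤ n) {a κ : ℝ} (ha : 0 < (n : ℝ) + 2 * a) (hκ : 0 < κ) :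
    0 < gaussianWeightNorm n a κ := by
  refine ENNReal.toReal_pos (fun h ↦ ?_) (memLp_gaussianWeight hn ha hκ).2.ne
  rw [eLpNorm_eq_zero_iff (measurable_gaussianWeight_norm a κ).aestronglyMeasurable two_ne_zero]
    at h
  obtain ⟨ξ, hzero, hξ⟩ := (h.and (ae_norm_pos hn)).exists
  have : 0 < gaussianWeight a κ (2 * Real.pi * ‖ξ‖) := by unfold gaussianWeight; positivity
  exact this.ne' hzero

theorem HasFourierFunction.weightedFourierNorm_le_mul {u : 𝓢'(Rn n, ℂ)} {g : Rn n → ℂ}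
    (hu : HasFourierFunction u g) {w w' : Rn n → ℝ} {B : ℝ} (hw : ∀ ξ, |w ξ| ≤ B * |w' ξ|) :
    weightedFourierNorm w u ≤ ENNReal.ofReal B * weightedFourierNorm w' u := by
  rw [hu.weightedFourierNorm_eq, hu.weightedFourierNorm_eq]
  refine eLpNorm_le_mul_eLpNorm_of_ae_le_mul (Eventually.of_forall fun ξ ↦ ?_) 2
  rw [norm_mul, norm_mul, Complex.norm_real, Complex.norm_real, ← mul_assoc]
  exact mul_le_mul_of_nonneg_right (hw ξ) (norm_nonneg _)

theorem HasFourierFunction.weightedFourierNorm_le_add {u v : 𝓢'(Rn n, ℂ)} {g h : Rn n → ℂ}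
    (hu : HasFourierFunction u g) (hv : HasFourierFunction v h) {w : Rn n → ℝ}
    (hw : Measurable w) :
    weightedFourierNorm w v ≤ weightedFourierNorm w u + weightedFourierNorm w (u - v) := by
  rw [hu.weightedFourierNorm_eq, hv.weightedFourierNorm_eq, (hu.sub hv).weightedFourierNorm_eq]
  have hwm := (Complex.measurable_ofReal.comp hw).aestronglyMeasurable (μ := volume)
  have hg := hu.locallyIntegrable.aestronglyMeasurable
  refine (le_of_eq ?_).trans (eLpNorm_sub_le (hwm.mul hg)
    (hwm.mul (hg.sub hv.locallyIntegrable.aestronglyMeasurable)) one_le_two)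
  exact congrArg (eLpNorm · 2 volume) (funext fun ξ ↦ by simp [mul_sub])

theorem weightedFourierNorm_cutoffWeight_diffusionProfile {γ t r b σ : ℝ} (hn : 1 ≤ n)
    (hγ : 0 < γ) (ht : 0 < t) (hσ : 0 ≤ σ) (hr : 0 < (n : ℝ) + 2 * (r + b)) (j : ℕ) (P : ℂ) :
    ENNReal.ofReal (t ^ (((n : ℝ) + 2 * (r + 2 * j)) / 4)) *
        weightedFourierNorm (cutoffWeight r b σ t) (P • diffusionProfile n γ j t) =
      ENNReal.ofReal (γ⁻¹ ^ (j + 1) * gaussianWeightNorm n (r + b + 2 * j) (γ⁻¹ + σ) * ‖P‖) := by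
  have hprofile := (hasFourierFunction_diffusionProfile (n := n) hγ ht j).smul P
  have hconst : eLpNorm (fun ξ : Rn n ↦ gaussianWeight (r + b + 2 * j) ((γ⁻¹ + σ) * t)
      (2 * Real.pi * ‖ξ‖) • (P * ((γ⁻¹ : ℝ) : ℂ))) 2 volume =
      ENNReal.ofReal (‖P‖ * γ⁻¹ * (t ^ (-(((n : ℝ) + 2 * (r + b + 2 * j)) / 4)) *
        gaussianWeightNorm n (r + b + 2 * j) (γ⁻¹ + σ))) := by
    rw [ENNReal.ofReal_mul (by positivity), ← eLpNorm_gaussianWeight hn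
      (by linarith [(Nat.cast_nonneg j : (0 : ℝ) ≤ j)]) (by positivity) ht,
      ← Real.enorm_of_nonneg (show 0 ≤ ‖P‖ * γ⁻¹ by positivity), ← eLpNorm_const_smul]
    refine eLpNorm_congr_norm_ae (Eventually.of_forall fun ξ ↦ ?_)
    simp only [norm_smul, norm_mul, Pi.smul_apply, Complex.norm_real, norm_norm]
    ring
  have hnorm : eLpNorm (fun ξ : Rn n ↦ (cutoffWeight r b σ t ξ : ℂ) *
      (P * diffusionMultiplier γ j t (2 * Real.pi * ‖ξ‖) • ((γ⁻¹ : ℝ) : ℂ))) 2 volume =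
      eLpNorm (fun ξ : Rn n ↦ cutoffWeight r b σ t ξ *
        ‖diffusionMultiplier γ j t (2 * Real.pi * ‖ξ‖) • (P * ((γ⁻¹ : ℝ) : ℂ))‖) 2 volume :=
    eLpNorm_congr_norm_ae (Eventually.of_forall fun ξ ↦ by
      rw [norm_mul, norm_mul (cutoffWeight _ _ _ _ _), norm_norm, Complex.norm_real,
        mul_smul_comm])
  rw [hprofile.weightedFourierNorm_eq, hnorm, eLpNorm_cutoffWeight_mul_norm_diffusion hn hγ ht
    r b σ j fun _ ↦ P * ((γ⁻¹ : ℝ) : ℂ), hconst,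
    ← ENNReal.ofReal_mul (by positivity), ← ENNReal.ofReal_mul (by positivity),
    Real.rpow_neg ht.le]
  congr 1
  have hcancel := mul_inv_cancel₀ (Real.rpow_pos_of_pos ht
    (((n : ℝ) + 2 * (r + b + 2 * j)) / 4)).ne'
  linear_combination γ⁻¹ ^ (j + 1) * gaussianWeightNorm n (r + b + 2 * j) (γ⁻¹ + σ) * ‖P‖ * hcancel

theorem ofReal_inv_mul_le_of_le_mul_add_half {a B L : ℝ} {x : ℝ≥0∞} (ha : 0 < a) (hB : 0 < B)
    (hL : 0 ≤ L) (h : ENNReal.ofReal L ≤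
      ENNReal.ofReal a * (ENNReal.ofReal B * x) + ENNReal.ofReal (L / 2)) :
    ENNReal.ofReal ((a * B)⁻¹ * (L / 2)) ≤ x := by
  have hhalf : ENNReal.ofReal (L / 2) ≤ ENNReal.ofReal (a * B) * x := by
    refine ENNReal.le_of_add_le_add_right ENNReal.ofReal_ne_top (le_of_eq_of_le ?_ h) |>.trans_eq ?_
    · rw [← ENNReal.ofReal_add (by positivity) (by positivity), add_halves]
    · rw [← mul_assoc, ← ENNReal.ofReal_mul ha.le]
  calc _ = ENNReal.ofReal (a * B)⁻¹ * ENNReal.ofReal (L / 2) := ENNReal.ofReal_mul (by positivity)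
    _ ≤ ENNReal.ofReal (a * B)⁻¹ * (ENNReal.ofReal (a * B) * x) := mul_le_mul_right hhalf _
    _ = x := by
        rw [← mul_assoc, ← ENNReal.ofReal_mul (by positivity), inv_mul_cancel₀ (by positivity),
          ENNReal.ofReal_one, one_mul]

theorem exists_le_homSobolevNorm (hn : 1 ≤ n) {τ δ γ s : ℝ} (hτ : 0 < τ) (hδ : 0 < δ)
    (hγ : 0 < γ) (j : Fin 3) :
    ∃ c : ℝ, 0 < c ∧ ∀ {f : Fin 3 → Lp ℂ 1 (volume : Measure (Rn n))}
      {φ : Fin 3 → ℝ → 𝓢'(Rn n, ℂ)},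
      IsSobolevSolution τ δ γ s (fun k ↦ (f k : 𝓢'(Rn n, ℂ))) φ →
      (∀ k : Fin 3, TemperedDistribution.MemSobolev (s + 2 - ((k : ℕ) : ℝ)) 2
        (f k : 𝓢'(Rn n, ℂ))) →
      combinedMoment τ γ f ≠ 0 → ∀ᶠ t : ℝ in atTop,
        ENNReal.ofReal (c * t ^ (-decayRate n s j) * ‖combinedMoment τ γ f‖) ≤
          homSobolevNorm (s + 2 - ((j : ℕ) : ℝ)) (φ j t) := by
  set r := s + 2 - ((j : ℕ) : ℝ)
  obtain ⟨B, hB, hcutoff⟩ := exists_gaussianWeight_one_le (abs_nonneg r)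
  have hn' : (0 : ℝ) < n := by exact_mod_cast hn
  have hr : 0 < (n : ℝ) + 2 * (r + |r|) := by linarith [neg_abs_le r]
  set N := gaussianWeightNorm n (r + |r| + 2 * ((j : ℕ) : ℝ)) (γ⁻¹ + 1)
  have hN : 0 < N := gaussianWeightNorm_pos hn
    (by linarith [(Nat.cast_nonneg j : (0 : ℝ) ≤ ((j : ℕ) : ℝ))]) (by positivity)
  refine ⟨γ⁻¹ ^ ((j : ℕ) + 1) * N / (2 * B), by positivity, fun {f φ} hφ hf hP ↦ ?_⟩
  set P := combinedMoment τ γ f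
  set L := γ⁻¹ ^ ((j : ℕ) + 1) * N * ‖P‖ with hL
  have : 0 < L := by have := norm_pos_iff.2 hP; positivity
  have hlim := isHighFrequencyWeight_inhomogeneous.tendsto_weightedFourierNorm_sub hn hτ hδ hγ
    (j := j) (abs_nonneg r) zero_le_one hcutoff hr hφ (dataNorm_sobolevNorm_ne_top j hf)
  filter_upwards [eventually_gt_atTop 0, hlim.eventually_le_const (u := ENNReal.ofReal (L / 2))
    (by positivity)] with t ht herror
  obtain ⟨g, hg, -⟩ := exists_hasFourierFunction_of_memSobolev (hφ.cont j t ht.le).1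
  have hmain : ENNReal.ofReal L ≤ ENNReal.ofReal (t ^ decayRate n s j) *
      (ENNReal.ofReal B * homSobolevNorm r (φ j t)) + ENNReal.ofReal (L / 2) := by
    rw [← weightedFourierNorm_cutoffWeight_diffusionProfile hn hγ ht zero_le_one hr j P,
      ← decayRate_eq]
    refine (mul_le_mul_right (hg.weightedFourierNorm_le_add ((hasFourierFunction_diffusionProfile
      hγ ht j).smul P) (measurable_cutoffWeight r |r| 1 t)) _).trans ?_
    rw [mul_add]
    refine add_le_add (mul_le_mul_right (hg.weightedFourierNorm_le_mul fun ξ ↦ ?_) _) herror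
    rw [cutoffWeight, abs_mul]
    gcongr
    rw [abs_of_nonneg (gaussianWeight_nonneg (by positivity) _ _)]
    exact hcutoff _ (by positivity)
  refine le_of_eq_of_le ?_ (ofReal_inv_mul_le_of_le_mul_add_half (by positivity) hB this.le hmain)
  rw [hL, Real.rpow_neg ht.le]
  congr 1
  field_simp

end LowerBound

theorem theorem3p1_general (n : ℕ) (hn : 1 ≤ n) (τ δ γ s : ℝ) (hτ : 0 < τ) (hδ : 0 < δ)
    (hγ : 0 < γ) (j : Fin 3) :
    ∃ C c : ℝ, 0 < C ∧ 0 < c ∧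
      ∀ f : Fin 3 → Lp ℂ 1 (volume : Measure (Rn n)),
        (∀ k : Fin 3, TemperedDistribution.MemSobolev (s + 2 - ((k : ℕ) : ℝ)) 2
          (f k : 𝓢'(Rn n, ℂ))) →
        ∀ φ : Fin 3 → ℝ → 𝓢'(Rn n, ℂ),
          IsSobolevSolution τ δ γ s (fun k ↦ (f k : 𝓢'(Rn n, ℂ))) φ →
          (0 < (n : ℝ) + 2 * (s + 2 - ((j : ℕ) : ℝ)) →
            (∀ t : ℝ, 0 ≤ t →
              homSobolevNorm (s + 2 - ((j : ℕ) : ℝ)) (φ j t) ≤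
                ENNReal.ofReal (C * (1 + t) ^ (-decayRate n s j)) *
                  dataNorm sobolevNorm s j f) ∧
            (∀ t : ℝ, 0 ≤ t →
              homSobolevNorm (s + 2 - ((j : ℕ) : ℝ)) (φ j t) ≤
                ENNReal.ofReal (C * (1 + t) ^ (-decayRate n s j)) *
                  dataNorm homSobolevNorm s j f) ∧
            Tendsto (fun t : ℝ ↦ ENNReal.ofReal (t ^ decayRate n s j) *
                homSobolevNorm (s + 2 - ((j : ℕ) : ℝ))
                  (φ j t - combinedMoment τ γ f • diffusionProfile n γ j t))
              atTop (𝓝 0)) ∧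
          (combinedMoment τ γ f ≠ 0 → ∀ᶠ t : ℝ in atTop,
            ENNReal.ofReal (c * t ^ (-decayRate n s j) * ‖combinedMoment τ γ f‖) ≤
              homSobolevNorm (s + 2 - ((j : ℕ) : ℝ)) (φ j t)) := by
  obtain ⟨c, hc, hlower⟩ := exists_le_homSobolevNorm (s := s) hn hτ hδ hγ j
  by_cases hr : 0 < (n : ℝ) + 2 * (s + 2 - ((j : ℕ) : ℝ))
  · obtain ⟨C, hC, hupper⟩ :=
      isHighFrequencyWeight_inhomogeneous.exists_homSobolevNorm_le hn hτ hδ hγ hr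
    obtain ⟨C', -, hupper'⟩ :=
      isHighFrequencyWeight_homogeneous.exists_homSobolevNorm_le hn hτ hδ hγ hr
    refine ⟨max C C', c, by positivity, hc, fun f hf φ hφ ↦ ⟨fun _ ↦ ⟨fun t ht ↦ ?_,
      fun t ht ↦ ?_, hφ.tendsto_homSobolevNorm_sub hn hτ hδ hγ hr hf⟩, hlower hφ hf⟩⟩
    · refine (hupper hφ ht).trans ?_
      gcongr
      · exact le_max_left _ _
      · exact le_rfl
    · refine (hupper' hφ ht).trans ?_
      gcongr
      · exact le_max_right _ _
      · exact le_rfl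
  · exact ⟨1, c, one_pos, hc, fun f hf φ hφ ↦ ⟨fun h ↦ absurd h hr, hlower hφ hf⟩⟩

theorem theorem3p1 (n : ℕ) (hn : 1 ≤ n) (τ δ γ s : ℝ) (hτ : 0 < τ) (hδ : 0 < δ) (hγ : 0 < γ)
    (hγτ : γ ≠ 1 / (4 * τ)) (j : Fin 3)
    (hrate : 0 < (n : ℝ) + 2 * s + 4 + 2 * ((j : ℕ) : ℝ)) :
    ∃ C c : ℝ, 0 < C ∧ 0 < c ∧
      ∀ f : Fin 3 → Lp ℂ 1 (volume : Measure (Rn n)),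
        (∀ k : Fin 3, TemperedDistribution.MemSobolev (s + 2 - ((k : ℕ) : ℝ)) 2
          (f k : 𝓢'(Rn n, ℂ))) →
        ∀ φ : Fin 3 → ℝ → 𝓢'(Rn n, ℂ),
          IsSobolevSolution τ δ γ s (fun k ↦ (f k : 𝓢'(Rn n, ℂ))) φ →
          -- upper bounds and asymptotic profile, where `|ξ|^{s+2-j}` is square integrable near `0`
          -- (for `s + 2 - j ≤ -n/2` the norm on the left is infinite in general)
          (0 < (n : ℝ) + 2 * (s + 2 - ((j : ℕ) : ℝ)) →
            -- upper bound, with inhomogeneous and with homogeneous Sobolev norms of the data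
            (∀ t : ℝ, 0 ≤ t →
              homSobolevNorm (s + 2 - ((j : ℕ) : ℝ)) (φ j t) ≤
                ENNReal.ofReal (C * (1 + t) ^ (-decayRate n s j)) *
                  dataNorm sobolevNorm s j f) ∧
            (∀ t : ℝ, 0 ≤ t →
              homSobolevNorm (s + 2 - ((j : ℕ) : ℝ)) (φ j t) ≤
                ENNReal.ofReal (C * (1 + t) ^ (-decayRate n s j)) *
                  dataNorm homSobolevNorm s j f) ∧
            -- asymptotic profile
            Tendsto (fun t : ℝ ↦ ENNReal.ofReal (t ^ decayRate n s j) *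
                homSobolevNorm (s + 2 - ((j : ℕ) : ℝ))
                  (φ j t - combinedMoment τ γ f • diffusionProfile n γ j t))
              atTop (𝓝 0)) ∧
          -- lower bound
          (combinedMoment τ γ f ≠ 0 → ∀ᶠ t : ℝ in atTop,
            ENNReal.ofReal (c * t ^ (-decayRate n s j) * ‖combinedMoment τ γ f‖) ≤
              homSobolevNorm (s + 2 - ((j : ℕ) : ℝ)) (φ j t)) :=
  theorem3p1_general n hn τ δ γ s hτ hδ hγ j
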